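/- **Setting.** $\Sigma$ is a finite set of $m$ signals, $\Delta_\Sigma$ the set of probability distributions on $\Sigma$. Agents $1,\dots,n$ receive private signals $(\sigma_1,\dots,\sigma_n)$ drawn from a joint prior $Q$ on $\Sigma^n$. $Q$ is *symmetric* if $\Pr[\sigma_i=\sigma]=q(\sigma)$ and $\Pr[\sigma_j=\sigma'\mid\sigma_i=\sigma]=q(\sigma'|\sigma)$ do not depend on the agent $i$ and the pair $i\ne j$; write $\mathbf q_\sigma=q(\cdot|\sigma)$. It is *non-zero* if all $q(\sigma),q(\sigma'|\sigma)>0$; *informative* if $\mathbf q_\sigma\ne\mathbf q_{\sigma'}$ for $\sigma\neq\sigma'$; *fine-grained* if for all $\sigma\ne\sigma'$ there are $s,t$ with $q(\sigma|s)/q(\sigma'|s)\neq q(\sigma|t)/q(\sigma'|t)$. A *SNIFE* prior is an ensemble $(Q_n)_{n\ge3}$ of symmetric, non-zero, informative, fine-grained priors on $\Sigma^n$ with the same $q(\cdot)$ and $q(\cdot|\cdot)$. Each agent reports a pair $r_i=(\hat\sigma_i,\hat{\mathbf p}_i)\in\Sigma\times\Delta_\Sigma$. A strategy $s_i$ maps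 each private signal to a probability distribution over reports, and agents randomize independently given their signals; $\theta_i(u,\sigma)$ is the probability that agent $i$ reports the signal $u$ when his signal is $\sigma$, and $\bar\theta=\frac1n\sum_i\theta_i$. A profile is symmetric if all agents play the same strategy. *Truth-telling* $\mathbf T$ is to report $(\sigma_i,\mathbf q_{\sigma_i})$. For a permutation $\pi$ of $\Sigma$, the *permutation profile* of $\pi$ is to report $(\pi(\sigma_i),\mathbf q_{\sigma_i}\circ\pi^{-1})$. A profile is *$\tau$-close to a permutation* if each row of $\bar\theta$ has at most one entry $>\tau$. A (Bayesian Nash) *equilibrium* is a profile in which all expected payments exist and no agent can increase his expected payment by changing his own strategy; it is *strict* if every actual change of an agent's own strategy strictly decreases his expected payment. $W(s)$ is the expected sum of all payments and $\overline W(s)=W(s)/n$. **Mechanism.** Let $PS:\Sigma\times\Delta_\Sigma\to\mathbb R$ be a (measurable) strictly proper scoring rule, extended linearly by $PS(\mathbf p,\cdot)=\sum_\sigma\mathbf p(\sigma)PS(\sigma,\cdot)$, let $\alpha,\beta>0$, and let $D^*(\mathbf p,\mathbf p')=\sum_\sigma(\sqrt{\mathbf p(\sigma)}-\sqrt{\mathbf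 p'(\sigma)})^2$. For $i\in G$, the payment $\mathrm{pay}_G(i)$ in a group $G$ is $\alpha\,PS(\hat\sigma_j,\hat{\mathbf p}_i)-\beta\,\mathbf 1[\hat\sigma_i=\hat\sigma_j]\bigl(PS(\hat{\mathbf p}_j,\hat{\mathbf p}_j)-PS(\hat{\mathbf p}_j,\hat{\mathbf p}_i)\bigr)$ for a uniformly random $j\in G\setminus\{i\}$ (and $0$ if $G=\{i\}$). The *disagreement mechanism* $\mathcal M^+(\alpha,\beta,PS)$ divides the agents at random, by a rule that is invariant under permuting the agents, into two non-empty groups $A,B$, and pays agent $i$ $$\mathrm{pay}_{G}(i)-\frac1{|G|}\sum_{l\in G'}\mathrm{pay}_{G'}(l)+\mathrm{score}_C(r_j,r_k),$$ where $G\ni i$ is his group, $G'$ the other one, $j\neq k$ are uniformly random agents other than $i$, and $\mathrm{score}_C(r_j,r_k)=D^*(\hat{\mathbf p}_j,\hat{\mathbf p}_k)$ if $\hat\sigma_j\ne\hat\sigma_k$ and $-\sqrt{D^*(\hat{\mathbf p}_j,\hat{\mathbf p}_k)}$ if $\hat\sigma_j=\hat\sigma_k$. **Constants.** $c_1=\min_{s,t}q(s|t)$,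 $c_2=\min_{s,t}q(s)q(t|s)$, $c_3=\min_{u\ne v}\max_{s,t}\bigl|\frac{q(u|s)}{q(u|t)}-\frac{q(v|s)}{q(v|t)}\bigr|^2$ ($c_3=0$ if $m=1$), $c_4=\min_{s,t,u}f''\bigl(\frac{q(u|s)}{q(u|t)}\bigr)$ with $f(x)=(\sqrt x-1)^2$, and $$\tau_1(\gamma)=\frac1{c_1}\sqrt[3]{\frac{\gamma}{c_2c_3c_4}},\qquad \gamma_2(n)=\frac{4\sqrt2\,m}{\sqrt n},\qquad \tau_2(n)=\sqrt[6]{\frac{128\,m^2}{n\,c_1^6(c_2c_3c_4)^2}}$$ (with $x/0=0$, which matters only for $m=1$). **Theorem.** Let $(Q_n)_{n\ge 3}$ be a SNIFE prior, $n\ge3$, $\alpha,\beta>0$ and $\frac{\beta}{\alpha}<\frac1{4m}$. For the mechanism $\mathcal M^+(\alpha,\beta,PS)$ with $n$ agents: 1. Truth-telling is a strict equilibrium for every symmetric, non-zero, informative prior on $\Sigma^n$ (in particular for $Q_n$). Moreover, under the prior $Q_n$: 2. Every permutation profile has the same welfare $W$ as truth-telling, and every symmetric equilibrium $s$ that is not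 a permutation profile has $W(s)<W(\mathbf T)$. 3. For every $\gamma_1\ge0$, every symmetric equilibrium $s$ with $\overline W(s)\ge\overline W(\mathbf T)-\gamma_1$ is $\tau_1(\gamma_1)$-close to a permutation. 4. Every equilibrium $s$ has $\overline W(s)\le\overline W(\mathbf T)+\gamma_2(n)$, and also $W(s)\le W(\mathbf T)+\frac{8}{c_1}\frac m{\sqrt n}$; and every equilibrium $s$ with $\overline W(s)\ge\overline W(\mathbf T)-\gamma_2(n)$ is $\tau_2(n)$-close to a permutation. -/

import Mathlib

open MeasureTheory

noncomputable section

namespace PeerPrediction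

/-! ## Priors -/

/-- Probability distributions over the finite signal set `S`. -/
abbrev Dist (S : Type*) [Fintype S] : Type _ := ↥(stdSimplex ℝ S)

/-- The first two moments of a symmetric prior: `q σ = Pr[σ_i = σ]`, and `cond σ`, the
distribution `q(· | σ)` of another agent's signal given that one's own signal is `σ`
(so `cond σ σ'` is `q(σ' | σ)`). -/
structure Moments (S : Type*) [Fintype S] where
  q : S → ℝ
  cond : S → Dist S

/-- A joint prior `Q` of the signals of `n` agents is symmetric, with first two moments `M`:
`Pr[σ_i = σ]` and `Pr[σ_j = σ' | σ_i = σ]` are given by `M`, whatever the agent `i` and the pair of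
distinct agents `i`, `j`. -/
def IsSymmetricPrior {S : Type*} [Fintype S] [DecidableEq S] {n : ℕ}
    (M : Moments S) (Q : PMF (Fin n → S)) : Prop :=
  (∀ (i : Fin n) (σ : S), ∑ x with x i = σ, (Q x).toReal = M.q σ) ∧
    ∀ i j : Fin n, i ≠ j → ∀ σ σ' : S,
      ∑ x with x i = σ ∧ x j = σ', (Q x).toReal = M.q σ * M.cond σ σ'

namespace Moments

variable {S : Type*} [Fintype S]

/-- Every signal, and every conditional signal, has positive probability. -/
def NonZero (M : Moments S) : Prop :=
  (∀ σ, 0 < M.q σ) ∧ ∀ σ σ', 0 < M.cond σ σ'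

/-- Different private signals give different beliefs about the other agents' signals. -/
def Informative (M : Moments S) : Prop :=
  ∀ σ σ', σ ≠ σ' → ∃ τ, M.cond σ τ ≠ M.cond σ' τ

/-- For `σ ≠ σ'` the likelihood ratio `q(σ | ·) / q(σ' | ·)` is not constant. -/
def FineGrained (M : Moments S) : Prop :=
  ∀ σ σ', σ ≠ σ' → ∃ s t, M.cond s σ / M.cond s σ' ≠ M.cond t σ / M.cond t σ'

/-- The moments of the prior `π(Q)` obtained from `Q` by relabelling the signals with `π`. -/
def permute (π : Equiv.Perm S) (M : Moments S) : Moments S where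
  q σ := M.q (π.symm σ)
  cond σ := ⟨fun σ' => M.cond (π.symm σ) (π.symm σ'),
    fun _ => (M.cond (π.symm σ)).2.1 _,
    (Equiv.sum_comp π.symm fun σ' => M.cond (π.symm σ) σ').trans (M.cond (π.symm σ)).2.2⟩

/-- `c₁ = min_{s,t} q(s | t)`. -/
def c₁ (M : Moments S) : ℝ := ⨅ p : S × S, M.cond p.2 p.1

/-- `c₂ = min_{s,t} Pr(s, t)`, the least probability that two distinct agents receive `s`, `t`. -/
def c₂ (M : Moments S) : ℝ := ⨅ p : S × S, M.q p.1 * M.cond p.1 p.2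

/-- `c₃ = min_{u ≠ v} max_{s,t} |q(u|s)/q(u|t) - q(v|s)/q(v|t)|²`. -/
def c₃ (M : Moments S) : ℝ :=
  ⨅ u : {p : S × S // p.1 ≠ p.2}, ⨆ s : S × S,
    |M.cond s.1 u.1.1 / M.cond s.2 u.1.1 - M.cond s.1 u.1.2 / M.cond s.2 u.1.2| ^ 2

/-- `c₄ = min_{s,t,u} f''(q(u|s)/q(u|t))`, where `f x = (√x - 1)²`. -/
def c₄ (M : Moments S) : ℝ :=
  ⨅ p : S × S × S,
    iteratedDeriv 2 (fun x : ℝ => (√x - 1) ^ 2) (M.cond p.1 p.2.2 / M.cond p.2.1 p.2.2)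

/-- `τ₁(γ) = (1 / c₁) (γ / (c₂ c₃ c₄))^{1/3}`. -/
def tau₁ (M : Moments S) (γ : ℝ) : ℝ :=
  1 / M.c₁ * (γ / (M.c₂ * M.c₃ * M.c₄)) ^ ((1 : ℝ) / 3)

/-- `τ₂(n) = (128 m² / (n c₁⁶ (c₂ c₃ c₄)²))^{1/6}`, with `m` the number of signals. -/
def tau₂ (M : Moments S) (n : ℕ) : ℝ :=
  (128 * (Fintype.card S : ℝ) ^ 2 / (n * M.c₁ ^ 6 * (M.c₂ * M.c₃ * M.c₄) ^ 2)) ^ ((1 : ℝ) / 6)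

end Moments

/-- `γ₂(n) = 4√2 m / √n`, with `m` the number of signals. -/
def gamma₂ (m n : ℕ) : ℝ := 4 * √2 * m / √n

/-- A SNIFE prior: an ensemble `Q n`, `n ≥ 3`, of symmetric priors, one for each number of agents,
all with the same first two moments `M`, which are non-zero, informative and fine-grained. -/
structure IsSNIFE {S : Type*} [Fintype S] [DecidableEq S]
    (M : Moments S) (Q : (n : ℕ) → PMF (Fin n → S)) : Prop where
  symmetric : ∀ n, 3 ≤ n → IsSymmetricPrior M (Q n)
  nonZero : M.NonZero
  informative : M.Informative
  fineGrained : M.FineGrained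

/-! ## Games, strategies, equilibria -/

/-- A report: a signal together with a prediction. -/
abbrev Report (S : Type*) [Fintype S] : Type _ := S × Dist S

/-- A (mixed) strategy for a given prior: a distribution over reports for each private signal. -/
abbrev Strategy (S : Type*) [Fintype S] [MeasurableSpace S] : Type _ :=
  S → ProbabilityMeasure (Report S)

/-- A mechanism gives every agent a payment that depends on all reports. For a mechanism that
tosses coins, this is the expected payment over its coins. -/
abbrev Mechanism (n : ℕ) (S : Type*) [Fintype S] : Type _ :=
  (Fin n → Report S) → Fin n → ℝ

section Game

variable {S : Type*} [Fintype S] [MeasurableSpace S] {n : ℕ}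

/-- The law of the reports when the signals are drawn from `Q` and the agents, independently given
the signals, play `s`. -/
def reportLaw (Q : PMF (Fin n → S)) (s : Fin n → Strategy S) : Measure (Fin n → Report S) :=
  Measure.sum fun x : Fin n → S => Q x • Measure.pi fun i => (s i (x i) : Measure (Report S))

/-- The payment of agent `i` has a (finite) expectation. -/
def HasExpectedPayment (𝓜 : Mechanism n S) (Q : PMF (Fin n → S)) (s : Fin n → Strategy S)
    (i : Fin n) : Prop :=
  Integrable (fun r => 𝓜 r i) (reportLaw Q s)

/-- The expected payment of agent `i`. -/
def expectedPayment (𝓜 : Mechanism n S) (Q : PMF (Fin n → S)) (s : Fin n → Strategy S)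
    (i : Fin n) : ℝ :=
  ∫ r, 𝓜 r i ∂reportLaw Q s

/-- The agent welfare: the expectation of the sum of all payments. -/
def welfare (𝓜 : Mechanism n S) (Q : PMF (Fin n → S)) (s : Fin n → Strategy S) : ℝ :=
  ∫ r, ∑ i, 𝓜 r i ∂reportLaw Q s

/-- The average agent welfare, per agent. -/
def averageWelfare (𝓜 : Mechanism n S) (Q : PMF (Fin n → S)) (s : Fin n → Strategy S) : ℝ :=
  welfare 𝓜 Q s / n

/-- Bayesian Nash equilibrium: all expected payments exist, and no agent gains by a unilateral
deviation (to any strategy for which his expected payment exists). -/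
def IsEquilibrium (𝓜 : Mechanism n S) (Q : PMF (Fin n → S)) (s : Fin n → Strategy S) : Prop :=
  (∀ i, HasExpectedPayment 𝓜 Q s i) ∧
    ∀ (i : Fin n) (t : Strategy S), HasExpectedPayment 𝓜 Q (Function.update s i t) i →
      expectedPayment 𝓜 Q (Function.update s i t) i ≤ expectedPayment 𝓜 Q s i

/-- Strict Bayesian Nash equilibrium: every actual deviation loses. -/
def IsStrictEquilibrium (𝓜 : Mechanism n S) (Q : PMF (Fin n → S)) (s : Fin n → Strategy S) :
    Prop :=
  IsEquilibrium 𝓜 Q s ∧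
    ∀ (i : Fin n) (t : Strategy S), HasExpectedPayment 𝓜 Q (Function.update s i t) i →
      expectedPayment 𝓜 Q (Function.update s i t) i = expectedPayment 𝓜 Q s i → t = s i

/-- All agents play the same strategy. -/
def IsSymmetricProfile (s : Fin n → Strategy S) : Prop := ∀ i j, s i = s j

/-- Truth-telling under a prior with moments `M`: report the private signal `σ` and the
prediction `q(· | σ)`. -/
def truthStrategy (M : Moments S) : Strategy S := fun σ =>
  ⟨Measure.dirac (σ, M.cond σ), Measure.dirac.isProbabilityMeasure⟩

/-- The truth-telling profile. -/
def truth (n : ℕ) (M : Moments S) : Fin n → Strategy S := fun _ => truthStrategy M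

/-- The permutation profile `π(truth)`: with signal `σ` under the prior `Q`, play what a truthful
agent plays with signal `π σ` under the relabelled prior `π(Q)`. -/
def permProfile (n : ℕ) (M : Moments S) (π : Equiv.Perm S) : Fin n → Strategy S :=
  fun _ σ => truthStrategy (M.permute π) (π σ)

/-- The profile is a permutation profile for the prior with moments `M`. -/
def IsPermutationProfile (M : Moments S) (s : Fin n → Strategy S) : Prop :=
  ∃ π : Equiv.Perm S, s = permProfile n M π

/-- The signal strategy `θ(u, σ)` of a strategy: the probability of reporting the signal `u` when
the private signal is `σ`. -/
def signalStrategy (t : Strategy S) (u σ : S) : ℝ :=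
  (t σ : Measure (Report S)).real {r | r.1 = u}

/-- The average signal strategy of a profile. -/
def averageSignalStrategy (s : Fin n → Strategy S) (u σ : S) : ℝ :=
  (∑ i, signalStrategy (s i) u σ) / n

/-- The profile is `τ`-close to a permutation: every row of its average signal strategy has at most
one entry that is greater than `τ`. -/
def IsCloseToPermutation (τ : ℝ) (s : Fin n → Strategy S) : Prop :=
  ∀ u v w, τ < averageSignalStrategy s u v → τ < averageSignalStrategy s u w → v = w

/-! ## Goals of mechanism design -/

/-- Truth-telling is a strict equilibrium for every symmetric, non-zero and informative prior. -/
def Truthful [DecidableEq S] (𝓜 : Mechanism n S) : Prop :=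
  ∀ (M : Moments S) (Q : PMF (Fin n → S)),
    IsSymmetricPrior M Q → M.NonZero → M.Informative → IsStrictEquilibrium 𝓜 Q (truth n M)

/-- All permutation profiles have the welfare of truth-telling, and every symmetric equilibrium that
is not a permutation profile has strictly less. -/
def SymmetricQuasiFocal (𝓜 : Mechanism n S) (M : Moments S) (Q : PMF (Fin n → S)) : Prop :=
  (∀ s : Fin n → Strategy S, IsPermutationProfile M s →
      welfare 𝓜 Q s = welfare 𝓜 Q (truth n M)) ∧
    ∀ s : Fin n → Strategy S, IsEquilibrium 𝓜 Q s → IsSymmetricProfile s →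
      ¬ IsPermutationProfile M s → welfare 𝓜 Q s < welfare 𝓜 Q (truth n M)

/-- For every `γ ≥ 0`, a symmetric equilibrium that pays (on average over the agents) within `γ` of
truth-telling is `τ γ`-close to a permutation. -/
def RobustSymmetricQuasiFocal (τ : ℝ → ℝ) (𝓜 : Mechanism n S) (M : Moments S)
    (Q : PMF (Fin n → S)) : Prop :=
  ∀ γ : ℝ, 0 ≤ γ → ∀ s : Fin n → Strategy S, IsEquilibrium 𝓜 Q s → IsSymmetricProfile s →
    averageWelfare 𝓜 Q (truth n M) - γ ≤ averageWelfare 𝓜 Q s →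
      IsCloseToPermutation (τ γ) s

/-- All permutation profiles pay the same; no equilibrium pays (on average over the agents) more
than truth-telling plus `γ`; and every equilibrium that pays within `γ` of truth-telling is
`τ`-close to a permutation. -/
def RobustApproximateQuasiFocal (τ γ : ℝ) (𝓜 : Mechanism n S) (M : Moments S)
    (Q : PMF (Fin n → S)) : Prop :=
  (∀ s : Fin n → Strategy S, IsPermutationProfile M s →
      welfare 𝓜 Q s = welfare 𝓜 Q (truth n M)) ∧
    (∀ s : Fin n → Strategy S, IsEquilibrium 𝓜 Q s →
      averageWelfare 𝓜 Q s ≤ averageWelfare 𝓜 Q (truth n M) + γ) ∧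
    ∀ s : Fin n → Strategy S, IsEquilibrium 𝓜 Q s →
      averageWelfare 𝓜 Q (truth n M) - γ ≤ averageWelfare 𝓜 Q s → IsCloseToPermutation τ s

end Game

/-! ## The disagreement mechanism -/

section Mechanism

variable {S : Type*} [Fintype S]

/-- The linear extension `PS(p, p') = E_{σ ∼ p} PS(σ, p')` of a scoring rule. -/
def expectedScore (PS : S → Dist S → ℝ) (p p' : Dist S) : ℝ := ∑ σ, p σ * PS σ p'

/-- Strictly proper scoring rules: `p` is the unique best prediction of a signal drawn from `p`. -/
def StrictlyProper (PS : S → Dist S → ℝ) : Prop :=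
  ∀ p p' : Dist S, p' ≠ p → expectedScore PS p p' < expectedScore PS p p

/-- The Hellinger divergence. -/
def hellinger (p p' : Dist S) : ℝ := ∑ σ, (√(p σ) - √(p' σ)) ^ 2

/-- A random division of the agents into a group `A` and its complement `B`, both non-empty, that
treats all agents alike. -/
structure DivisionRule (n : ℕ) where
  law : PMF (Finset (Fin n))
  nonempty : ∀ A, law A ≠ 0 → A.Nonempty ∧ Aᶜ.Nonempty
  exchangeable : ∀ (π : Equiv.Perm (Fin n)) (A : Finset (Fin n)),
    law (A.map π.toEmbedding) = law A

variable [DecidableEq S] {n : ℕ}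

/-- The prediction score of a report `r` matched with a report `r'`. -/
def scoreP (PS : S → Dist S → ℝ) (r r' : Report S) : ℝ := PS r'.1 r.2

/-- The information score of a report `r` matched with a report `r'`. -/
def scoreI (PS : S → Dist S → ℝ) (r r' : Report S) : ℝ :=
  if r.1 = r'.1 then -(expectedScore PS r'.2 r'.2 - expectedScore PS r'.2 r.2) else 0

/-- The classification score of two reports. -/
def scoreC (r r' : Report S) : ℝ :=
  if r.1 = r'.1 then -√(hellinger r.2 r'.2) else hellinger r.2 r'.2

/-- The expected payment of agent `i ∈ G` in the truthful mechanism played inside the group `G`: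
his peer `j` is uniform in `G \ {i}` (an agent who is alone in his group gets `0`). -/
def truthfulPayment (α β : ℝ) (PS : S → Dist S → ℝ) (G : Finset (Fin n)) (r : Fin n → Report S)
    (i : Fin n) : ℝ :=
  (∑ j ∈ G.erase i, (α * scoreP PS (r i) (r j) + β * scoreI PS (r i) (r j))) / (G.erase i).card

/-- The zero-sum score of agent `i` when the agents are divided into `A` and its complement: his
payment in his own group `G`, minus `1 / |G|` times all payments in the other group. -/
def zeroSumScore (α β : ℝ) (PS : S → Dist S → ℝ) (A : Finset (Fin n)) (r : Fin n → Report S)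
    (i : Fin n) : ℝ :=
  let G := if i ∈ A then A else Aᶜ
  truthfulPayment α β PS G r i - 1 / (G.card : ℝ) * ∑ j ∈ Gᶜ, truthfulPayment α β PS Gᶜ r j

/-- The expected classification reward of agent `i`: the classification score of two distinct
agents `j`, `k`, drawn uniformly among the agents other than `i`. -/
def classificationReward (r : Fin n → Report S) (i : Fin n) : ℝ :=
  (∑ j ∈ Finset.univ.erase i, ∑ k ∈ (Finset.univ.erase i).erase j, scoreC (r j) (r k)) /
    (((n : ℝ) - 1) * ((n : ℝ) - 2))

/-- The disagreement mechanism `M+(α, β, PS)`, with the agents divided according to `D`. -/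
def disagreementMechanism (α β : ℝ) (PS : S → Dist S → ℝ) (D : DivisionRule n) :
    Mechanism n S := fun r i =>
  ∑ A, (D.law A).toReal * zeroSumScore α β PS A r i + classificationReward r i

end Mechanism

end PeerPrediction

end

/-!
Why the disagreement mechanism selects truth-telling.

*Payments.* Since the division of the agents is exchangeable, agent `i` is paid `c ∑ⱼ
peerScore(rᵢ, rⱼ)` with the same `c > 0` for all agents, plus a term that does not depend on his
own report (`disagreementMechanism_update_sub`). The zero-sum scores cancel in the sum over
the agents, so that the welfare consists of the classification scores alone
(`sum_disagreementMechanism`, `welfare_disagreementMechanism`). Truth-telling is a strict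
equilibrium because a wrong prediction loses prediction score, and a wrong signal with the right
prediction loses information score (`truthful_disagreementMechanism`).

*Predictions in equilibrium.* For fixed private signal `σ` and reported signal `u`, the payment
is, up to constants, the proper score of the prediction against a mixture of outcomes. Hence every
equilibrium predicts deterministically, and its prediction is a mixture of the honest forecast
`θ₋ᵢ q_σ` of the reported signals and, with weight of order `β / α`, of the predictions of those
who also report `u` (`IsEquilibrium.ae_eq_bestPrediction`, `IsPredictionEquilibrium`). The
optimality of the reported signal is not needed for the bounds on the welfare.

*Welfare.* By convexity of the Hellinger divergence, the gain in divergence from not forecasting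
honestly is at most `4√2 β / α` times the expected Hellinger distance between the predictions of
agents who report the same signal. The classification score charges exactly this distance, and
`4√2 β / α < 1` as soon as there are two signals (with a single signal all scores vanish); so the
welfare is at most that of honest forecasts (`IsPredictionEquilibrium.sum_sum_scoreC_le`).
Replacing the averages `θ₋ᵢ` by the average `θ` of all agents costs little, since the first-order
terms of the square roots cancel (`sum_sum_sq_sqrt_avgOthers_le`), and the divergence of the
forecasts `θ q_σ`, `θ q_τ` is at most that of `q_σ`, `q_τ`, which is the welfare of truth-telling
(`sqHellinger_channel_le`, `welfare_permProfile`).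

*Closeness.* The loss in the data processing inequality is a sum of Cauchy–Schwarz gaps; a row of
`θ` with two entries greater than `τ₁ γ` makes it greater than `γ`, because the prior is
fine-grained (`Moments.close_of_le_sqHellinger_channel`). For `γ = 0` this forces `θ` to be a
permutation, and then the predictions are those of the permutation profile
(`eq_permProfile_of_perm`).
-/

noncomputable section

namespace PeerPrediction

/-! ### The Hellinger divergence of nonnegative vectors -/

section Hellinger

variable {S : Type*} [Fintype S]

/-- The squared Hellinger distance of two nonnegative vectors. On distributions it is the divergence
`hellinger`; here the arguments are bare functions, since most of those below are not given as
elements of `Dist S`. -/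
def sqHellinger (a b : S → ℝ) : ℝ := ∑ σ, (√(a σ) - √(b σ)) ^ 2

theorem hellinger_eq_sqHellinger (p p' : Dist S) : hellinger p p' = sqHellinger p p' := rfl

theorem sqHellinger_nonneg (a b : S → ℝ) : 0 ≤ sqHellinger a b :=
  Finset.sum_nonneg fun _ _ => sq_nonneg _

theorem sqHellinger_comm (a b : S → ℝ) : sqHellinger a b = sqHellinger b a :=
  Finset.sum_congr rfl fun _ _ => by ring

@[simp] theorem sqHellinger_self (a : S → ℝ) : sqHellinger a a = 0 := by
  simp [sqHellinger]

theorem sqHellinger_comp_equiv (π : Equiv.Perm S) (a b : S → ℝ) :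
    sqHellinger (fun σ => a (π σ)) (fun σ => b (π σ)) = sqHellinger a b :=
  Equiv.sum_comp π fun σ => (√(a σ) - √(b σ)) ^ 2

theorem sqHellinger_eq_sum_sub {a b : S → ℝ} (ha : ∀ σ, 0 ≤ a σ) (hb : ∀ σ, 0 ≤ b σ) :
    sqHellinger a b = ∑ σ, a σ + ∑ σ, b σ - 2 * ∑ σ, √(a σ) * √(b σ) := by
  rw [sqHellinger, Finset.mul_sum, ← Finset.sum_add_distrib, ← Finset.sum_sub_distrib]
  refine Finset.sum_congr rfl fun σ _ => ?_
  nlinarith [Real.sq_sqrt (ha σ), Real.sq_sqrt (hb σ)]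

theorem sqHellinger_le_two {a b : S → ℝ} (ha : a ∈ stdSimplex ℝ S) (hb : b ∈ stdSimplex ℝ S) :
    sqHellinger a b ≤ 2 := by
  rw [sqHellinger_eq_sum_sub ha.1 hb.1, ha.2, hb.2]
  have : 0 ≤ ∑ σ, √(a σ) * √(b σ) := Finset.sum_nonneg fun _ _ => by positivity
  linarith

theorem sqrt_sqHellinger_triangle (a b c : S → ℝ) :
    √(sqHellinger a c) ≤ √(sqHellinger a b) + √(sqHellinger b c) := by
  have h (a b : S → ℝ) : √(sqHellinger a b) =
      dist (WithLp.toLp 2 fun σ => √(a σ) : EuclideanSpace ℝ S)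
        (WithLp.toLp 2 fun σ => √(b σ)) := by
    rw [EuclideanSpace.dist_eq]
    simp [sqHellinger, Real.dist_eq]
  simp only [h]
  exact dist_triangle _ _ _

/-- On distributions, the divergence from `c` is `2√2`-Lipschitz for the Hellinger distance. -/
theorem sqHellinger_le_add {a b c : S → ℝ} (ha : a ∈ stdSimplex ℝ S) (hb : b ∈ stdSimplex ℝ S)
    (hc : c ∈ stdSimplex ℝ S) :
    sqHellinger a c ≤ sqHellinger b c + 2 * √2 * √(sqHellinger a b) := by
  have h := sqrt_sqHellinger_triangle a b c
  have h1 : √(sqHellinger a c) ≤ √2 := Real.sqrt_le_sqrt (sqHellinger_le_two ha hc)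
  have h2 : √(sqHellinger b c) ≤ √2 := Real.sqrt_le_sqrt (sqHellinger_le_two hb hc)
  have h3 := Real.sq_sqrt (sqHellinger_nonneg a c)
  have h4 := Real.sq_sqrt (sqHellinger_nonneg b c)
  have h5 := Real.sqrt_nonneg (sqHellinger a c)
  have h6 := Real.sqrt_nonneg (sqHellinger b c)
  have h7 := Real.sqrt_nonneg (sqHellinger a b)
  nlinarith [mul_le_mul_of_nonneg_right (show √(sqHellinger a c) - √(sqHellinger b c) ≤
    √(sqHellinger a b) by linarith) (add_nonneg h5 h6)]

theorem sqHellinger_convex {ι : Type*} (T : Finset ι) (w : ι → ℝ) (z : ι → S → ℝ) (p b : S → ℝ)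
    (hw : ∀ k, 0 ≤ w k) (hz : ∀ k σ, 0 ≤ z k σ) (hp : ∀ σ, 0 ≤ p σ) (hb : ∀ σ, 0 ≤ b σ)
    (h : ∀ σ, (∑ k ∈ T, w k) * p σ = ∑ k ∈ T, w k * z k σ) :
    (∑ k ∈ T, w k) * sqHellinger p b ≤ ∑ k ∈ T, w k * sqHellinger (z k) b := by
  have hW : 0 ≤ ∑ k ∈ T, w k := Finset.sum_nonneg fun k _ => hw k
  have h0 : ∑ k ∈ T, w k * sqHellinger (z k) b =
      ∑ σ, ∑ k ∈ T, w k * (√(z k σ) - √(b σ)) ^ 2 := by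
    simp only [sqHellinger, Finset.mul_sum]
    exact Finset.sum_comm
  rw [h0, sqHellinger, Finset.mul_sum]
  refine Finset.sum_le_sum fun σ _ => ?_
  have hcs := Real.sum_sqrt_mul_sqrt_le (f := fun k => w k * z k σ) (g := fun k => w k * b σ) T
    (fun k => mul_nonneg (hw k) (hz k σ)) (fun k => mul_nonneg (hw k) (hb σ))
  simp only [← Finset.sum_mul] at hcs
  rw [← h σ, Real.sqrt_mul hW, Real.sqrt_mul hW] at hcs
  have e1 : ∑ k ∈ T, √(w k * z k σ) * √(w k * b σ) = ∑ k ∈ T, w k * (√(z k σ) * √(b σ)) := by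
    refine Finset.sum_congr rfl fun k _ => ?_
    rw [Real.sqrt_mul (hw k), Real.sqrt_mul (hw k)]
    linear_combination (√(z k σ) * √(b σ)) * Real.mul_self_sqrt (hw k)
  have e2 : ∑ k ∈ T, w k * (√(z k σ) - √(b σ)) ^ 2 =
      ∑ k ∈ T, w k * z k σ + (∑ k ∈ T, w k) * b σ - 2 * ∑ k ∈ T, w k * (√(z k σ) * √(b σ)) := by
    rw [Finset.sum_mul, Finset.mul_sum, ← Finset.sum_add_distrib, ← Finset.sum_sub_distrib]
    refine Finset.sum_congr rfl fun k _ => ?_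
    linear_combination w k * Real.sq_sqrt (hz k σ) + w k * Real.sq_sqrt (hb σ)
  rw [e1] at hcs
  rw [e2, ← h σ]
  nlinarith [Real.mul_self_sqrt hW, Real.sq_sqrt (hp σ), Real.sq_sqrt (hb σ)]

end Hellinger

/-! ### Channels and the data processing inequality -/

section Channel

variable {S : Type*} [Fintype S]

/-- The distribution of the reported signal when the private signal has distribution `p` and
`θ u σ` is the probability of reporting `u` with signal `σ`. -/
def channel (θ : S → S → ℝ) (p : S → ℝ) (u : S) : ℝ := ∑ σ, θ u σ * p σ

/-- `θ` is column-stochastic: every `θ(·, σ)` is a probability distribution. -/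
def IsChannel (θ : S → S → ℝ) : Prop := ∀ σ, (fun u => θ u σ) ∈ stdSimplex ℝ S

theorem IsChannel.nonneg {θ : S → S → ℝ} (h : IsChannel θ) (u σ : S) : 0 ≤ θ u σ := (h σ).1 u

theorem IsChannel.sum_eq_one {θ : S → S → ℝ} (h : IsChannel θ) (σ : S) : ∑ u, θ u σ = 1 := (h σ).2

theorem IsChannel.le_one {θ : S → S → ℝ} (h : IsChannel θ) (u σ : S) : θ u σ ≤ 1 := by
  rw [← h.sum_eq_one σ]
  exact Finset.single_le_sum (fun v _ => h.nonneg v σ) (Finset.mem_univ u)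

theorem IsChannel.channel_mem {θ : S → S → ℝ} (h : IsChannel θ) {p : S → ℝ}
    (hp : p ∈ stdSimplex ℝ S) : channel θ p ∈ stdSimplex ℝ S := by
  refine ⟨fun u => Finset.sum_nonneg fun σ _ => mul_nonneg (h.nonneg u σ) (hp.1 σ), ?_⟩
  simp only [channel]
  rw [Finset.sum_comm]
  simp [← Finset.sum_mul, h.sum_eq_one, hp.2]

theorem channel_le_one {θ : S → S → ℝ} (h : IsChannel θ) {p : S → ℝ}
    (hp : p ∈ stdSimplex ℝ S) (u : S) : channel θ p u ≤ 1 := by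
  rw [← (h.channel_mem hp).2]
  exact Finset.single_le_sum (fun v _ => (h.channel_mem hp).1 v) (Finset.mem_univ u)

/-- The divergence lost in the channel is a sum of Cauchy–Schwarz gaps, one for each reported
signal. -/
theorem sqHellinger_sub_channel {θ : S → S → ℝ} (h : IsChannel θ) {p p' : S → ℝ}
    (hp : p ∈ stdSimplex ℝ S) (hp' : p' ∈ stdSimplex ℝ S) :
    sqHellinger p p' - sqHellinger (channel θ p) (channel θ p') =
      2 * ∑ u, (√(channel θ p u) * √(channel θ p' u) -
        ∑ σ, √(θ u σ * p σ) * √(θ u σ * p' σ)) := by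
  have hc := h.channel_mem hp
  have hc' := h.channel_mem hp'
  have e : ∑ u, ∑ σ, √(θ u σ * p σ) * √(θ u σ * p' σ) = ∑ σ, √(p σ) * √(p' σ) := by
    rw [Finset.sum_comm]
    refine Finset.sum_congr rfl fun σ _ => ?_
    rw [← one_mul (√(p σ) * √(p' σ)), ← h.sum_eq_one σ, Finset.sum_mul]
    refine Finset.sum_congr rfl fun u _ => ?_
    rw [Real.sqrt_mul (h.nonneg u σ), Real.sqrt_mul (h.nonneg u σ)]
    linear_combination (√(p σ) * √(p' σ)) * Real.mul_self_sqrt (h.nonneg u σ)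
  rw [sqHellinger_eq_sum_sub hp.1 hp'.1, sqHellinger_eq_sum_sub hc.1 hc'.1, hp.2, hp'.2, hc.2,
    hc'.2, Finset.sum_sub_distrib, e]
  ring

theorem channel_gap_nonneg {θ : S → S → ℝ} (h : IsChannel θ) {p p' : S → ℝ}
    (hp : p ∈ stdSimplex ℝ S) (hp' : p' ∈ stdSimplex ℝ S) (u : S) :
    0 ≤ √(channel θ p u) * √(channel θ p' u) - ∑ σ, √(θ u σ * p σ) * √(θ u σ * p' σ) :=
  sub_nonneg.2 <| Real.sum_sqrt_mul_sqrt_le _ (fun σ => mul_nonneg (h.nonneg u σ) (hp.1 σ))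
    (fun σ => mul_nonneg (h.nonneg u σ) (hp'.1 σ))

theorem sqHellinger_channel_le {θ : S → S → ℝ} (h : IsChannel θ) {p p' : S → ℝ}
    (hp : p ∈ stdSimplex ℝ S) (hp' : p' ∈ stdSimplex ℝ S) :
    sqHellinger (channel θ p) (channel θ p') ≤ sqHellinger p p' := by
  have := Finset.sum_nonneg fun u (_ : u ∈ Finset.univ) => channel_gap_nonneg h hp hp' u
  linarith [sqHellinger_sub_channel h hp hp']

/-- Two terms of Lagrange's identity. -/
theorem sq_sum_mul_add_sq_le [DecidableEq S] (x y : S → ℝ) {v w : S} (hvw : v ≠ w) :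
    (∑ σ, x σ * y σ) ^ 2 + (x v * y w - x w * y v) ^ 2 ≤ (∑ σ, x σ ^ 2) * ∑ σ, y σ ^ 2 := by
  have e : ∑ σ, ∑ ρ, (x σ * y ρ - x ρ * y σ) ^ 2 =
      2 * ((∑ σ, x σ ^ 2) * ∑ σ, y σ ^ 2) - 2 * (∑ σ, x σ * y σ) ^ 2 := by
    have e1 : ∀ σ ρ, (x σ * y ρ - x ρ * y σ) ^ 2 =
        x σ ^ 2 * y ρ ^ 2 + y σ ^ 2 * x ρ ^ 2 - 2 * ((x σ * y σ) * (x ρ * y ρ)) := fun _ _ => by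
      ring
    simp only [e1, Finset.sum_sub_distrib, Finset.sum_add_distrib, ← Finset.mul_sum,
      ← Finset.sum_mul]
    ring
  have h1 : ∑ ρ, (x v * y ρ - x ρ * y v) ^ 2 + ∑ ρ, (x w * y ρ - x ρ * y w) ^ 2 ≤
      ∑ σ, ∑ ρ, (x σ * y ρ - x ρ * y σ) ^ 2 := by
    rw [← Finset.sum_pair (f := fun σ => ∑ ρ, (x σ * y ρ - x ρ * y σ) ^ 2) hvw]
    exact Finset.sum_le_sum_of_subset_of_nonneg (Finset.subset_univ _) fun _ _ _ =>
      Finset.sum_nonneg fun _ _ => sq_nonneg _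
  have h2 := Finset.single_le_sum (f := fun ρ => (x v * y ρ - x ρ * y v) ^ 2)
    (fun _ _ => sq_nonneg _) (Finset.mem_univ w)
  have h3 := Finset.single_le_sum (f := fun ρ => (x w * y ρ - x ρ * y w) ^ 2)
    (fun _ _ => sq_nonneg _) (Finset.mem_univ v)
  nlinarith

/-- Two private signals `v ≠ w` that are both reported as `u` cost divergence. -/
theorem sq_le_sqHellinger_sub_channel [DecidableEq S] {θ : S → S → ℝ} (h : IsChannel θ)
    {p p' : S → ℝ} (hp : p ∈ stdSimplex ℝ S) (hp' : p' ∈ stdSimplex ℝ S) (u : S) {v w : S}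
    (hvw : v ≠ w) :
    θ u v * θ u w * (√(p v) * √(p' w) - √(p w) * √(p' v)) ^ 2 ≤
      sqHellinger p p' - sqHellinger (channel θ p) (channel θ p') := by
  rw [sqHellinger_sub_channel h hp hp']
  have h1 := Finset.single_le_sum (f := fun u => √(channel θ p u) * √(channel θ p' u) -
    ∑ σ, √(θ u σ * p σ) * √(θ u σ * p' σ)) (fun u _ => channel_gap_nonneg h hp hp' u)
    (Finset.mem_univ u)
  have h2 := channel_gap_nonneg h hp hp' u
  have h3 := sq_sum_mul_add_sq_le (fun σ => √(θ u σ * p σ)) (fun σ => √(θ u σ * p' σ)) hvw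
  simp only [Real.sq_sqrt (mul_nonneg (h.nonneg u _) (hp.1 _)),
    Real.sq_sqrt (mul_nonneg (h.nonneg u _) (hp'.1 _))] at h3
  change _ ≤ channel θ p u * channel θ p' u at h3
  have h4 : √(channel θ p u) ≤ 1 := Real.sqrt_le_one.2 (channel_le_one h hp u)
  have h5 : √(channel θ p' u) ≤ 1 := Real.sqrt_le_one.2 (channel_le_one h hp' u)
  have h6 := Real.sq_sqrt ((h.channel_mem hp).1 u)
  have h7 := Real.sq_sqrt ((h.channel_mem hp').1 u)
  have e : (√(θ u v * p v) * √(θ u w * p' w) - √(θ u w * p w) * √(θ u v * p' v)) ^ 2 =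
      θ u v * θ u w * (√(p v) * √(p' w) - √(p w) * √(p' v)) ^ 2 := by
    rw [Real.sqrt_mul (h.nonneg u v), Real.sqrt_mul (h.nonneg u w), Real.sqrt_mul (h.nonneg u v),
      Real.sqrt_mul (h.nonneg u w)]
    rw [show √(θ u v) * √(p v) * (√(θ u w) * √(p' w)) - √(θ u w) * √(p w) * (√(θ u v) * √(p' v))
      = √(θ u v) * √(θ u w) * (√(p v) * √(p' w) - √(p w) * √(p' v)) by ring, mul_pow, mul_pow,
      Real.sq_sqrt (h.nonneg u v), Real.sq_sqrt (h.nonneg u w)]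
  rw [e] at h3
  set R := √(channel θ p u) * √(channel θ p' u) with hR
  set C := ∑ σ, √(θ u σ * p σ) * √(θ u σ * p' σ)
  have hR1 : R ≤ 1 := mul_le_one₀ h4 (Real.sqrt_nonneg _) h5
  have hRR : R ^ 2 = channel θ p u * channel θ p' u := by rw [hR, mul_pow, h6, h7]
  have hC : 0 ≤ C := Finset.sum_nonneg fun _ _ => by positivity
  rw [← hRR] at h3
  nlinarith

end Channel

/-! ### The constants of the prior -/

section Constants

variable {S : Type*} [Fintype S]

theorem iteratedDeriv_two_sqrt_sub_one_sq {x : ℝ} (hx : 0 < x) :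
    iteratedDeriv 2 (fun x : ℝ => (√x - 1) ^ 2) x = 1 / (2 * (x * √x)) := by
  have h1 : ∀ y : ℝ, 0 < y → deriv (fun x : ℝ => (√x - 1) ^ 2) y = 1 - (√y)⁻¹ := by
    intro y hy
    have hs : √y ≠ 0 := (Real.sqrt_pos.2 hy).ne'
    have := (((Real.hasDerivAt_sqrt hy.ne').sub_const 1).pow 2).deriv
    refine Eq.trans this ?_
    field_simp
    ring
  have h2 : deriv (fun x : ℝ => (√x - 1) ^ 2) =ᶠ[nhds x] fun y => 1 - (√y)⁻¹ := by
    filter_upwards [lt_mem_nhds hx] with y hy using h1 y hy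
  have hs : √x ≠ 0 := (Real.sqrt_pos.2 hx).ne'
  rw [iteratedDeriv_succ, iteratedDeriv_one, h2.deriv_eq]
  have := (((Real.hasDerivAt_sqrt hx.ne').inv hs).const_sub 1).deriv
  refine Eq.trans this ?_
  rw [Real.sq_sqrt hx.le]
  field_simp

namespace Moments

variable {M : Moments S}

theorem cond_mem (M : Moments S) (s : S) : ⇑(M.cond s) ∈ stdSimplex ℝ S := (M.cond s).2

theorem c₁_le (M : Moments S) (s t : S) : M.c₁ ≤ M.cond s t :=
  ciInf_le (f := fun p : S × S => M.cond p.2 p.1) (Set.finite_range _).bddBelow (t, s)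

theorem c₂_le (M : Moments S) (s t : S) : M.c₂ ≤ M.q s * M.cond s t :=
  ciInf_le (f := fun p : S × S => M.q p.1 * M.cond p.1 p.2) (Set.finite_range _).bddBelow (s, t)

theorem NonZero.c₁_pos [Nonempty S] (hM : M.NonZero) : 0 < M.c₁ := by
  obtain ⟨p, hp⟩ := exists_eq_ciInf_of_finite (f := fun p : S × S => M.cond p.2 p.1)
  rw [c₁, ← hp]
  exact hM.2 _ _

theorem NonZero.c₂_pos [Nonempty S] (hM : M.NonZero) : 0 < M.c₂ := by
  obtain ⟨p, hp⟩ := exists_eq_ciInf_of_finite (f := fun p : S × S => M.q p.1 * M.cond p.1 p.2)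
  rw [c₂, ← hp]
  exact mul_pos (hM.1 _) (hM.2 _ _)

theorem c₁_le_one [Nonempty S] (M : Moments S) : M.c₁ ≤ 1 :=
  (M.c₁_le (Classical.arbitrary S) (Classical.arbitrary S)).trans (stdSimplex.le_one _ _)

theorem c₁_le_half {v w : S} (hvw : v ≠ w) (M : Moments S) : M.c₁ ≤ 1 / 2 := by
  classical
  have h : M.cond v v + M.cond v w ≤ 1 := by
    rw [← stdSimplex.sum_eq_one (M.cond v), ← Finset.sum_pair hvw]
    exact Finset.sum_le_sum_of_subset_of_nonneg (Finset.subset_univ _) fun _ _ _ =>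
      stdSimplex.zero_le _ _
  linarith [M.c₁_le v v, M.c₁_le v w]

theorem exists_c₃_le [Nonempty S] {u v : S} (huv : u ≠ v) (M : Moments S) :
    ∃ s t, M.c₃ ≤ |M.cond s u / M.cond t u - M.cond s v / M.cond t v| ^ 2 := by
  obtain ⟨p, hp⟩ := exists_eq_ciSup_of_finite
    (f := fun s : S × S => |M.cond s.1 u / M.cond s.2 u - M.cond s.1 v / M.cond s.2 v| ^ 2)
  refine ⟨p.1, p.2, ?_⟩
  rw [hp]
  exact ciInf_le (f := fun u : {p : S × S // p.1 ≠ p.2} => ⨆ s : S × S,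
    |M.cond s.1 u.1.1 / M.cond s.2 u.1.1 - M.cond s.1 u.1.2 / M.cond s.2 u.1.2| ^ 2)
    (Set.finite_range _).bddBelow ⟨(u, v), huv⟩

theorem NonZero.c₃_pos {u v : S} (huv : u ≠ v) (hM : M.NonZero) (hF : M.FineGrained) :
    0 < M.c₃ := by
  have : Nonempty {p : S × S // p.1 ≠ p.2} := ⟨⟨(u, v), huv⟩⟩
  obtain ⟨⟨⟨a, b⟩, hab⟩, hp⟩ := exists_eq_ciInf_of_finite
    (f := fun u : {p : S × S // p.1 ≠ p.2} => ⨆ s : S × S,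
      |M.cond s.1 u.1.1 / M.cond s.2 u.1.1 - M.cond s.1 u.1.2 / M.cond s.2 u.1.2| ^ 2)
  rw [c₃, ← hp]
  obtain ⟨s, t, hst⟩ := hF a b hab
  refine lt_of_lt_of_le ?_ (le_ciSup (f := fun s : S × S =>
    |M.cond s.1 a / M.cond s.2 a - M.cond s.1 b / M.cond s.2 b| ^ 2)
    (Set.finite_range _).bddAbove (s, t))
  refine pow_pos (abs_pos.2 (sub_ne_zero.2 fun h => hst ?_)) 2
  have h1 := (hM.2 t a).ne'
  have h2 := (hM.2 t b).ne'
  have h3 := (hM.2 s b).ne'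
  simp only at h
  field_simp at h ⊢
  linear_combination h

theorem NonZero.c₄_le (hM : M.NonZero) (s t u : S) :
    M.c₄ ≤ 1 / (2 * (M.cond s u / M.cond t u * √(M.cond s u / M.cond t u))) := by
  rw [← iteratedDeriv_two_sqrt_sub_one_sq (div_pos (hM.2 s u) (hM.2 t u))]
  exact ciInf_le (f := fun p : S × S × S => iteratedDeriv 2 (fun x : ℝ => (√x - 1) ^ 2)
    (M.cond p.1 p.2.2 / M.cond p.2.1 p.2.2)) (Set.finite_range _).bddBelow (s, t, u)

theorem NonZero.c₄_pos [Nonempty S] (hM : M.NonZero) : 0 < M.c₄ := by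
  obtain ⟨p, hp⟩ := exists_eq_ciInf_of_finite
    (f := fun p : S × S × S => iteratedDeriv 2 (fun x : ℝ => (√x - 1) ^ 2)
      (M.cond p.1 p.2.2 / M.cond p.2.1 p.2.2))
  have h := div_pos (hM.2 p.1 p.2.2) (hM.2 p.2.1 p.2.2)
  rw [c₄, ← hp, iteratedDeriv_two_sqrt_sub_one_sq h]
  positivity

/-- The curvature bound in the form in which it is used; the case `x < 1` reduces to the curvature
at the ratio `1`. -/
theorem NonZero.c₄_mul_le (hM : M.NonZero) (s t u : S) :
    2 * M.c₄ * (M.cond s u / M.cond t u) ≤ 1 := by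
  have h1 := hM.c₄_le s t u
  have h2 := hM.c₄_le s s u
  rw [div_self (hM.2 s u).ne'] at h2
  set x := M.cond s u / M.cond t u
  have hx : 0 < x := div_pos (hM.2 s u) (hM.2 t u)
  rcases le_total 1 x with h | h
  · have hs : 1 ≤ √x := Real.one_le_sqrt.2 h
    rw [le_div_iff₀ (by positivity)] at h1
    have : Nonempty S := ⟨s⟩
    nlinarith [mul_nonneg hM.c₄_pos.le (mul_nonneg hx.le (sub_nonneg.2 hs))]
  · norm_num at h2
    nlinarith

/-- The Hellinger gap of two signals `v`, `w` that are pooled, in terms of the constants. -/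
theorem NonZero.c₃_mul_c₄_le (hM : M.NonZero) {v w s t : S}
    (h : M.c₃ ≤ |M.cond s v / M.cond t v - M.cond s w / M.cond t w| ^ 2) :
    M.cond t v * M.cond t w * (M.c₃ * M.c₄) / 2 ≤
      (√(M.cond s v) * √(M.cond t w) - √(M.cond s w) * √(M.cond t v)) ^ 2 := by
  have : Nonempty S := ⟨v⟩
  have hv := hM.2 t v
  have hw := hM.2 t w
  set x := M.cond s v / M.cond t v with hx
  set y := M.cond s w / M.cond t w with hy
  have hx0 : 0 < x := div_pos (hM.2 s v) hv
  have hy0 : 0 < y := div_pos (hM.2 s w) hw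
  have e1 : M.cond s v = x * M.cond t v := by rw [hx]; field_simp
  have e2 : M.cond s w = y * M.cond t w := by rw [hy]; field_simp
  have h4x := hM.c₄_mul_le s t v
  have h4y := hM.c₄_mul_le s t w
  rw [← hx] at h4x
  rw [← hy] at h4y
  rw [sq_abs] at h
  have e3 : (√(M.cond s v) * √(M.cond t w) - √(M.cond s w) * √(M.cond t v)) ^ 2 =
      M.cond t v * M.cond t w * (√x - √y) ^ 2 := by
    rw [e1, e2, Real.sqrt_mul hx0.le, Real.sqrt_mul hy0.le,
      show √x * √(M.cond t v) * √(M.cond t w) - √y * √(M.cond t w) * √(M.cond t v) =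
        √(M.cond t v) * √(M.cond t w) * (√x - √y) by ring, mul_pow, mul_pow,
      Real.sq_sqrt hv.le, Real.sq_sqrt hw.le]
  rw [e3, mul_div_assoc]
  refine mul_le_mul_of_nonneg_left ?_ (mul_pos hv hw).le
  have sx := Real.sq_sqrt hx0.le
  have sy := Real.sq_sqrt hy0.le
  have e4 : (x - y) ^ 2 = (√x - √y) ^ 2 * (√x + √y) ^ 2 := by
    rw [← mul_pow]
    congr 1
    linear_combination sy - sx
  have e5 : (√x + √y) ^ 2 ≤ 2 * (x + y) := by nlinarith [sq_nonneg (√x - √y)]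
  calc M.c₃ * M.c₄ / 2 ≤ (√x - √y) ^ 2 * (2 * (x + y)) * M.c₄ / 2 := by
        have h5 : M.c₃ ≤ (√x - √y) ^ 2 * (2 * (x + y)) :=
          (h.trans_eq e4).trans (mul_le_mul_of_nonneg_left e5 (sq_nonneg _))
        have := mul_le_mul_of_nonneg_right h5 hM.c₄_pos.le
        linarith
    _ = (√x - √y) ^ 2 * ((2 * M.c₄ * x + 2 * M.c₄ * y) / 2) := by ring
    _ ≤ (√x - √y) ^ 2 * 1 := mul_le_mul_of_nonneg_left (by linarith) (sq_nonneg _)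
    _ = _ := mul_one _

/-- If a channel loses at most `γ` of the expected divergence between the beliefs of two agents,
then it is `τ₁ γ`-close to a permutation. -/
theorem close_of_le_sqHellinger_channel (hM : M.NonZero) (hF : M.FineGrained) {θ : S → S → ℝ}
    (hθ : IsChannel θ) {γ : ℝ} (hγ : 0 ≤ γ)
    (h : ∑ s, ∑ t, M.q s * M.cond s t * sqHellinger (M.cond s) (M.cond t) - γ ≤
      ∑ s, ∑ t, M.q s * M.cond s t *
        sqHellinger (channel θ (M.cond s)) (channel θ (M.cond t)))
    (u v w : S) (hv : M.tau₁ γ < θ u v) (hw : M.tau₁ γ < θ u w) : v = w := by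
  classical
  by_contra hvw
  have : Nonempty S := ⟨v⟩
  have p1 := hM.c₁_pos
  have p2 := hM.c₂_pos
  have p3 := hM.c₃_pos hvw hF
  have p4 := hM.c₄_pos
  obtain ⟨s, t, hst⟩ := M.exists_c₃_le hvw
  set K := M.c₂ * M.c₃ * M.c₄ with hK
  have pK : 0 < K := by positivity
  set g := (γ / K) ^ ((1 : ℝ) / 3) with hg
  have hτ : M.tau₁ γ = g / M.c₁ := by rw [tau₁]; ring
  have g0 : 0 ≤ g := by positivity
  have hg3 : γ = K * g ^ 3 := by
    rw [hg, ← Real.rpow_natCast, ← Real.rpow_mul (by positivity)]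
    norm_num
    field_simp
  -- Now `g = c₁ τ₁(γ)`, and the two entries of `θ` exceed `g / c₁`.
  rw [hτ, div_lt_iff₀ p1] at hv hw
  have c_half := M.c₁_le_half hvw
  have hg_half : g ≤ 1 / 2 := by nlinarith [hθ.le_one u v]
  -- A single pair `s`, `t` of private signals already costs more than `γ`.
  have loss : M.c₂ * (sqHellinger (M.cond s) (M.cond t) -
      sqHellinger (channel θ (M.cond s)) (channel θ (M.cond t))) ≤ γ := by
    have nn : ∀ s t, 0 ≤ M.q s * M.cond s t * (sqHellinger (M.cond s) (M.cond t) -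
        sqHellinger (channel θ (M.cond s)) (channel θ (M.cond t))) := fun s t =>
      mul_nonneg (mul_pos (hM.1 s) (hM.2 s t)).le
        (sub_nonneg.2 (sqHellinger_channel_le hθ (M.cond_mem s) (M.cond_mem t)))
    have h1 : ∑ s, ∑ t, M.q s * M.cond s t * (sqHellinger (M.cond s) (M.cond t) -
        sqHellinger (channel θ (M.cond s)) (channel θ (M.cond t))) ≤ γ := by
      simp only [mul_sub, Finset.sum_sub_distrib]
      linarith
    refine le_trans ?_ h1
    refine le_trans ?_ (Finset.single_le_sum (fun s _ => Finset.sum_nonneg fun t _ => nn s t)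
      (Finset.mem_univ s))
    refine le_trans ?_ (Finset.single_le_sum (fun t _ => nn s t) (Finset.mem_univ t))
    exact mul_le_mul_of_nonneg_right (M.c₂_le s t)
      (sub_nonneg.2 (sqHellinger_channel_le hθ (M.cond_mem s) (M.cond_mem t)))
  have h1 := sq_le_sqHellinger_sub_channel hθ (M.cond_mem s) (M.cond_mem t) u hvw
  have h2 := hM.c₃_mul_c₄_le hst
  have h3 : g < θ u v * M.cond t v :=
    hv.trans_le (mul_le_mul_of_nonneg_left (M.c₁_le t v) (hθ.nonneg u v))
  have h4 : g < θ u w * M.cond t w :=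
    hw.trans_le (mul_le_mul_of_nonneg_left (M.c₁_le t w) (hθ.nonneg u w))
  have h5 : g ^ 2 < θ u v * θ u w * (M.cond t v * M.cond t w) := by
    have := mul_lt_mul'' h3 h4 g0 g0
    nlinarith
  have h6 : θ u v * θ u w * (M.cond t v * M.cond t w * (M.c₃ * M.c₄) / 2) ≤
      sqHellinger (M.cond s) (M.cond t) -
        sqHellinger (channel θ (M.cond s)) (channel θ (M.cond t)) :=
    le_trans (mul_le_mul_of_nonneg_left h2 (mul_nonneg (hθ.nonneg u v) (hθ.nonneg u w))) h1
  have h7 : K * (θ u v * θ u w * (M.cond t v * M.cond t w)) / 2 ≤ γ := by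
    refine le_trans (le_of_eq ?_) ((mul_le_mul_of_nonneg_left h6 p2.le).trans loss)
    rw [hK]
    ring
  -- The quadratic loss dominates the cubic `γ = K g³` since `g ≤ 1/2`.
  have h8 : K * g ^ 3 ≤ K * g ^ 2 / 2 := by
    have : K * g ^ 2 * (1 / 2 - g) ≥ 0 :=
      mul_nonneg (by positivity) (by linarith)
    nlinarith
  have h9 := mul_lt_mul_of_pos_left h5 pK
  linarith

theorem tau₁_zero (M : Moments S) : M.tau₁ 0 = 0 := by simp [tau₁]

theorem gamma₂_nonneg (m n : ℕ) : 0 ≤ gamma₂ m n := by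
  rw [gamma₂]
  positivity

theorem NonZero.tau₂_eq_tau₁ [Nonempty S] (hM : M.NonZero) (hc₃ : 0 < M.c₃) (n : ℕ) :
    M.tau₂ n = M.tau₁ (2 * gamma₂ (Fintype.card S) n) := by
  have p1 := hM.c₁_pos
  have p2 := hM.c₂_pos
  have p4 := hM.c₄_pos
  have hg := gamma₂_nonneg (Fintype.card S) n
  have hg2 : (2 * gamma₂ (Fintype.card S) n) ^ 2 = 128 * (Fintype.card S : ℝ) ^ 2 / n := by
    rw [gamma₂, mul_pow, div_pow, mul_pow, mul_pow, Real.sq_sqrt (by norm_num),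
      Real.sq_sqrt (by positivity)]
    ring
  rw [tau₂, tau₁]
  set K := M.c₂ * M.c₃ * M.c₄
  have pK : 0 < K := by positivity
  set γ := 2 * gamma₂ (Fintype.card S) n
  set z := (γ / K) ^ ((1 : ℝ) / 3) with hz
  have z0 : 0 ≤ z := by positivity
  have hz3 : γ / K = z ^ 3 := by
    rw [hz, ← Real.rpow_natCast, ← Real.rpow_mul (by positivity)]
    norm_num
  have e : 128 * (Fintype.card S : ℝ) ^ 2 / (n * M.c₁ ^ 6 * K ^ 2) = (1 / M.c₁ * z) ^ 6 := by
    rw [mul_pow (1 / M.c₁), show z ^ 6 = (z ^ 3) ^ 2 by ring, ← hz3, div_pow γ K, hg2]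
    field_simp
  rw [e, show ((1 : ℝ) / 6) = ((6 : ℕ) : ℝ)⁻¹ by norm_num,
    Real.pow_rpow_inv_natCast (by positivity) (by norm_num)]

end Moments

end Constants

/-! ### The payments of the disagreement mechanism -/

section Payments

variable {S : Type*} [Fintype S] {n : ℕ}

/-- The group of agent `i` when the agents are divided into `A` and its complement. -/
def ownGroup (A : Finset (Fin n)) (i : Fin n) : Finset (Fin n) := if i ∈ A then A else Aᶜ

theorem mem_ownGroup_self (A : Finset (Fin n)) (i : Fin n) : i ∈ ownGroup A i := by
  unfold ownGroup
  split_ifs with h <;> simp [h]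

theorem mem_ownGroup_map (A : Finset (Fin n)) (π : Equiv.Perm (Fin n)) (i j : Fin n) :
    π j ∈ ownGroup (A.map π.toEmbedding) (π i) ↔ j ∈ ownGroup A i := by
  by_cases h : i ∈ A <;> simp [ownGroup, h]

theorem ownGroup_map (A : Finset (Fin n)) (π : Equiv.Perm (Fin n)) (i : Fin n) :
    ownGroup (A.map π.toEmbedding) (π i) = (ownGroup A i).map π.toEmbedding := by
  ext j
  obtain ⟨j, rfl⟩ := π.surjective j
  simp [mem_ownGroup_map]

/-- The probability that `j` becomes the peer of `i`. -/
def DivisionRule.peerProb (D : DivisionRule n) (i j : Fin n) : ℝ :=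
  ∑ A, (D.law A).toReal *
    if j ∈ ownGroup A i then (1 : ℝ) / ((ownGroup A i).erase i).card else 0

theorem exists_perm_apply_eq_apply_eq {i j i' j' : Fin n} (h : i ≠ j) (h' : i' ≠ j') :
    ∃ π : Equiv.Perm (Fin n), π i = i' ∧ π j = j' := by
  have h1 : Equiv.swap i i' j ≠ i' := fun e =>
    h ((Equiv.swap i i').injective ((Equiv.swap_apply_left i i').trans e.symm))
  refine ⟨(Equiv.swap i i').trans (Equiv.swap (Equiv.swap i i' j) j'), ?_, ?_⟩
  · simp only [Equiv.trans_apply, Equiv.swap_apply_left]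
    exact Equiv.swap_apply_of_ne_of_ne h1.symm h'
  · simp

/-- By exchangeability, all other agents are equally likely to become the peer. -/
theorem DivisionRule.peerProb_eq (D : DivisionRule n) {i j i' j' : Fin n} (h : i ≠ j)
    (h' : i' ≠ j') : D.peerProb i j = D.peerProb i' j' := by
  obtain ⟨π, rfl, rfl⟩ := exists_perm_apply_eq_apply_eq h h'
  refine Fintype.sum_equiv π.finsetCongr _ _ fun A => ?_
  simp only [Equiv.finsetCongr_apply, D.exchangeable, ownGroup_map, Finset.mem_map_equiv,
    Equiv.symm_apply_apply]
  rw [show π i = π.toEmbedding i from rfl, ← Finset.map_erase, Finset.card_map]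

/-- With at least three agents, one of the two groups has at least two members, so that every agent
has a peer with positive probability. -/
theorem DivisionRule.peerProb_pos (D : DivisionRule n) (hn : 3 ≤ n) {i j : Fin n} (h : i ≠ j) :
    0 < D.peerProb i j := by
  obtain ⟨A, hA⟩ := D.law.support_nonempty
  rw [PMF.mem_support_iff] at hA
  obtain ⟨a, b, hab, hb⟩ : ∃ a b, a ≠ b ∧ b ∈ ownGroup A a := by
    have hc : A.card + Aᶜ.card = n := by simp
    by_cases h2 : 1 < A.card
    · obtain ⟨a, ha, b, hb, hab⟩ := Finset.one_lt_card.1 h2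
      exact ⟨a, b, hab, by simp [ownGroup, ha, hb]⟩
    · obtain ⟨a, ha, b, hb, hab⟩ := Finset.one_lt_card.1 (show 1 < Aᶜ.card by omega)
      rw [Finset.mem_compl] at ha hb
      exact ⟨a, b, hab, by simp [ownGroup, ha, hb]⟩
  rw [D.peerProb_eq h hab]
  refine lt_of_lt_of_le ?_ (Finset.single_le_sum (f := fun A => (D.law A).toReal *
    if b ∈ ownGroup A a then (1 : ℝ) / ((ownGroup A a).erase a).card else 0)
    (fun A _ => mul_nonneg ENNReal.toReal_nonneg (by split_ifs <;> positivity))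
    (Finset.mem_univ A))
  have h1 : 0 < ((ownGroup A a).erase a).card :=
    Finset.card_pos.2 ⟨b, Finset.mem_erase.2 ⟨hab.symm, hb⟩⟩
  simp only [hb, if_true]
  exact mul_pos (ENNReal.toReal_pos hA (D.law.apply_ne_top A)) (by positivity)

variable [DecidableEq S]

/-- What agent `i` receives for his report `a` from a peer who reports `b`. -/
def peerScore (α β : ℝ) (PS : S → Dist S → ℝ) (a b : Report S) : ℝ :=
  α * scoreP PS a b + β * scoreI PS a b

/-- The part of the payment of agent `i` that does not depend on his own report. -/
def restPayment (α β : ℝ) (PS : S → Dist S → ℝ) (D : DivisionRule n) (r : Fin n → Report S)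
    (i : Fin n) : ℝ :=
  classificationReward r i - ∑ A, (D.law A).toReal * (1 / ((ownGroup A i).card : ℝ) *
    ∑ j ∈ (ownGroup A i)ᶜ, truthfulPayment α β PS (ownGroup A i)ᶜ r j)

theorem disagreementMechanism_eq_peerProb (α β : ℝ) (PS : S → Dist S → ℝ) (D : DivisionRule n)
    (r : Fin n → Report S) (i : Fin n) :
    disagreementMechanism α β PS D r i =
      ∑ j ∈ Finset.univ.erase i, D.peerProb i j * peerScore α β PS (r i) (r j) +
        restPayment α β PS D r i := by
  have h : ∀ A : Finset (Fin n), truthfulPayment α β PS (ownGroup A i) r i =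
      ∑ j ∈ Finset.univ.erase i,
        (if j ∈ ownGroup A i then (1 : ℝ) / ((ownGroup A i).erase i).card else 0) *
          peerScore α β PS (r i) (r j) := by
    intro A
    simp only [ite_mul, zero_mul]
    rw [truthfulPayment, Finset.sum_div, ← Finset.sum_filter]
    refine Finset.sum_congr ?_ fun j _ => ?_
    · ext j
      simp
    · rw [peerScore]
      ring
  have h2 : ∑ A, (D.law A).toReal * truthfulPayment α β PS (ownGroup A i) r i =
      ∑ j ∈ Finset.univ.erase i, D.peerProb i j * peerScore α β PS (r i) (r j) := by
    simp only [h, DivisionRule.peerProb, Finset.sum_mul, Finset.mul_sum]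
    rw [Finset.sum_comm]
    simp only [mul_assoc]
  rw [restPayment, ← h2]
  change ∑ A, (D.law A).toReal * (truthfulPayment α β PS (ownGroup A i) r i -
    1 / ((ownGroup A i).card : ℝ) *
      ∑ j ∈ (ownGroup A i)ᶜ, truthfulPayment α β PS (ownGroup A i)ᶜ r j) + _ = _
  simp only [mul_sub, Finset.sum_sub_distrib]
  ring

theorem truthfulPayment_congr (α β : ℝ) (PS : S → Dist S → ℝ) (G : Finset (Fin n))
    {r r' : Fin n → Report S} (h : ∀ j ∈ G, r j = r' j) {i : Fin n} (hi : i ∈ G) :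
    truthfulPayment α β PS G r i = truthfulPayment α β PS G r' i := by
  unfold truthfulPayment
  congr 1
  refine Finset.sum_congr rfl fun j hj => ?_
  rw [h i hi, h j (Finset.mem_of_mem_erase hj)]

theorem restPayment_update (α β : ℝ) (PS : S → Dist S → ℝ) (D : DivisionRule n)
    (r : Fin n → Report S) (i : Fin n) (a : Report S) :
    restPayment α β PS D (Function.update r i a) i = restPayment α β PS D r i := by
  unfold restPayment classificationReward
  congr 1
  · congr 1
    refine Finset.sum_congr rfl fun j hj => Finset.sum_congr rfl fun k hk => ?_
    rw [Function.update_of_ne (Finset.ne_of_mem_erase hj),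
      Function.update_of_ne (Finset.ne_of_mem_erase (Finset.mem_of_mem_erase hk))]
  · refine Finset.sum_congr rfl fun A _ => ?_
    congr 2
    refine Finset.sum_congr rfl fun j hj => ?_
    have hne : ∀ k ∈ (ownGroup A i)ᶜ, Function.update r i a k = r k := by
      intro k hk
      refine Function.update_of_ne ?_ _ _
      rintro rfl
      exact Finset.mem_compl.1 hk (mem_ownGroup_self A k)
    exact truthfulPayment_congr α β PS _ hne hj

/-- The effect of a change of the own report: it is evaluated against the other agents only. -/
theorem disagreementMechanism_update_sub (α β : ℝ) (PS : S → Dist S → ℝ) (D : DivisionRule n)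
    {i₀ j₀ : Fin n} (h₀ : i₀ ≠ j₀) (r : Fin n → Report S) (i : Fin n) (a b : Report S) :
    disagreementMechanism α β PS D (Function.update r i a) i -
        disagreementMechanism α β PS D (Function.update r i b) i =
      D.peerProb i₀ j₀ * ∑ j ∈ Finset.univ.erase i,
        (peerScore α β PS a (r j) - peerScore α β PS b (r j)) := by
  have h : ∀ c, ∑ j ∈ Finset.univ.erase i, D.peerProb i j *
      peerScore α β PS (Function.update r i c i) (Function.update r i c j) =
      D.peerProb i₀ j₀ * ∑ j ∈ Finset.univ.erase i, peerScore α β PS c (r j) := by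
    intro c
    rw [Finset.mul_sum]
    refine Finset.sum_congr rfl fun j hj => ?_
    have hj := Finset.ne_of_mem_erase hj
    rw [Function.update_self, Function.update_of_ne hj, D.peerProb_eq hj.symm h₀]
  rw [disagreementMechanism_eq_peerProb, disagreementMechanism_eq_peerProb, h, h,
    restPayment_update, restPayment_update, Finset.sum_sub_distrib]
  ring

theorem sum_zeroSumScore (α β : ℝ) (PS : S → Dist S → ℝ) {A : Finset (Fin n)}
    (hA : A.Nonempty) (hA' : Aᶜ.Nonempty) (r : Fin n → Report S) :
    ∑ i, zeroSumScore α β PS A r i = 0 := by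
  have h1 : (A.card : ℝ) ≠ 0 := by exact_mod_cast hA.card_pos.ne'
  have h2 : (Aᶜ.card : ℝ) ≠ 0 := by exact_mod_cast hA'.card_pos.ne'
  rw [← Finset.sum_add_sum_compl A]
  have e1 : ∀ i ∈ A, zeroSumScore α β PS A r i = truthfulPayment α β PS A r i -
      1 / (A.card : ℝ) * ∑ j ∈ Aᶜ, truthfulPayment α β PS Aᶜ r j := fun i hi => by
    simp [zeroSumScore, hi]
  have e2 : ∀ i ∈ Aᶜ, zeroSumScore α β PS A r i = truthfulPayment α β PS Aᶜ r i -
      1 / (Aᶜ.card : ℝ) * ∑ j ∈ A, truthfulPayment α β PS A r j := fun i hi => by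
    simp [zeroSumScore, Finset.mem_compl.1 hi]
  rw [Finset.sum_congr rfl e1, Finset.sum_congr rfl e2, Finset.sum_sub_distrib,
    Finset.sum_sub_distrib, Finset.sum_const, Finset.sum_const, nsmul_eq_mul, nsmul_eq_mul]
  field_simp
  ring

theorem sum_classificationReward (hn : 3 ≤ n) (r : Fin n → Report S) :
    ∑ i, classificationReward r i =
      (∑ j, ∑ k ∈ Finset.univ.erase j, scoreC (r j) (r k)) / ((n : ℝ) - 1) := by
  have hn' : (3 : ℝ) ≤ n := by exact_mod_cast hn
  have h1 : (n : ℝ) - 1 ≠ 0 := by linarith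
  have h2 : (n : ℝ) - 2 ≠ 0 := by linarith
  have e : ∑ i, ∑ j ∈ Finset.univ.erase i, ∑ k ∈ (Finset.univ.erase i).erase j,
      scoreC (r j) (r k) =
      ((n : ℝ) - 2) * ∑ j, ∑ k ∈ Finset.univ.erase j, scoreC (r j) (r k) := by
    rw [Finset.mul_sum, Finset.sum_comm' (t' := Finset.univ)
      (s' := fun j => Finset.univ.erase j) (by intro i j; simp [ne_comm])]
    refine Finset.sum_congr rfl fun j _ => ?_
    rw [Finset.mul_sum, Finset.sum_comm' (t' := Finset.univ.erase j)
      (s' := fun k => (Finset.univ.erase j).erase k) (by intro i k; simp; tauto)]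
    refine Finset.sum_congr rfl fun k hk => ?_
    rw [Finset.sum_const, Finset.card_erase_of_mem hk, Finset.card_erase_of_mem (Finset.mem_univ j),
      Finset.card_univ, Fintype.card_fin, nsmul_eq_mul, Nat.sub_sub, Nat.cast_sub (by omega)]
    norm_num
  simp only [classificationReward]
  rw [← Finset.sum_div, e]
  field_simp

/-- The zero-sum scores cancel, so that the agents share the classification scores. -/
theorem sum_disagreementMechanism (α β : ℝ) (PS : S → Dist S → ℝ) (D : DivisionRule n)
    (hn : 3 ≤ n) (r : Fin n → Report S) :
    ∑ i, disagreementMechanism α β PS D r i =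
      (∑ j, ∑ k ∈ Finset.univ.erase j, scoreC (r j) (r k)) / ((n : ℝ) - 1) := by
  simp only [disagreementMechanism]
  rw [Finset.sum_add_distrib, sum_classificationReward hn, Finset.sum_comm]
  rw [add_eq_right]
  refine Finset.sum_eq_zero fun A _ => ?_
  rw [← Finset.mul_sum]
  by_cases hA : D.law A = 0
  · simp [hA]
  · rw [sum_zeroSumScore α β PS (D.nonempty A hA).1 (D.nonempty A hA).2, mul_zero]

end Payments

/-! ### The law of the reports and unilateral deviations -/

section Law

theorem map_update_prod_pi {ι X : Type*} [Fintype ι] [DecidableEq ι] [MeasurableSpace X]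
    (κ ν : ι → Measure X)
    [∀ j, IsProbabilityMeasure (κ j)] [∀ j, IsProbabilityMeasure (ν j)] (i : ι)
    (h : ∀ j, j ≠ i → κ j = ν j) :
    ((κ i).prod (Measure.pi ν)).map (fun p => Function.update p.2 i p.1) = Measure.pi κ := by
  have hm : Measurable fun p : X × (ι → X) => Function.update p.2 i p.1 :=
    measurable_update'.comp measurable_swap
  refine (Measure.pi_eq fun B hB => ?_).symm
  rw [Measure.map_apply hm (MeasurableSet.univ_pi hB)]
  have e : (fun p : X × (ι → X) => Function.update p.2 i p.1) ⁻¹' Set.univ.pi B =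
      B i ×ˢ Set.univ.pi (Function.update B i Set.univ) := by
    ext ⟨a, r⟩
    simp only [Set.mem_preimage, Set.mem_pi, Set.mem_univ, true_imp_iff, Set.mem_prod]
    constructor
    · refine fun H => ⟨by simpa using H i, fun j => ?_⟩
      by_cases hj : j = i
      · subst hj
        simp
      · simpa [hj] using H j
    · rintro ⟨H1, H2⟩ j
      by_cases hj : j = i
      · subst hj
        simpa using H1
      · simpa [hj] using H2 j
  rw [e, Measure.prod_prod, Measure.pi_pi, ← Finset.mul_prod_erase _ _ (Finset.mem_univ i),
    ← Finset.mul_prod_erase Finset.univ (fun j => κ j (B j)) (Finset.mem_univ i)]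
  simp only [Function.update_self, measure_univ, one_mul]
  congr 1
  refine Finset.prod_congr rfl fun j hj => ?_
  have hj := Finset.ne_of_mem_erase hj
  rw [Function.update_of_ne hj, h j hj]

theorem pi_dirac {ι X : Type*} [Fintype ι] [MeasurableSpace X] (f : ι → X) :
    Measure.pi (fun i => Measure.dirac (f i)) = Measure.dirac f := by
  classical
  refine Measure.pi_eq fun B hB => ?_
  rw [Measure.dirac_apply' _ (MeasurableSet.univ_pi hB)]
  by_cases hf : ∀ i, f i ∈ B i
  · rw [Set.indicator_of_mem (by simpa using hf)]
    simp [fun i => Measure.dirac_apply' (f i) (hB i), hf]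
  · rw [Set.indicator_of_notMem (by simpa using hf)]
    push Not at hf
    obtain ⟨i, hi⟩ := hf
    refine (Finset.prod_eq_zero (Finset.mem_univ i) ?_).symm
    rw [Measure.dirac_apply' _ (hB i), Set.indicator_of_notMem hi]

variable {S : Type*} [Fintype S] [MeasurableSpace S] {n : ℕ}

/-- The law of the reports given the private signals `x`. -/
def condLaw (s : Fin n → Strategy S) (x : Fin n → S) : Measure (Fin n → Report S) :=
  Measure.pi fun i => (s i (x i) : Measure (Report S))

instance (s : Fin n → Strategy S) (x : Fin n → S) : IsProbabilityMeasure (condLaw s x) := by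
  unfold condLaw
  infer_instance

theorem integrable_reportLaw_iff {Q : PMF (Fin n → S)} {s : Fin n → Strategy S}
    {f : (Fin n → Report S) → ℝ} :
    Integrable f (reportLaw Q s) ↔ ∀ x, Q x ≠ 0 → Integrable f (condLaw s x) := by
  rw [reportLaw, Measure.sum_fintype, integrable_finsetSum_measure]
  simp only [Finset.mem_univ, true_imp_iff]
  refine forall_congr' fun x => ?_
  by_cases hx : Q x = 0
  · simp [hx]
  · rw [integrable_smul_measure hx (Q.apply_ne_top x)]
    simp [hx, condLaw]

theorem integral_reportLaw {Q : PMF (Fin n → S)} {s : Fin n → Strategy S}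
    {f : (Fin n → Report S) → ℝ} (hf : Integrable f (reportLaw Q s)) :
    ∫ r, f r ∂reportLaw Q s = ∑ x, (Q x).toReal * ∫ r, f r ∂condLaw s x := by
  rw [reportLaw, Measure.sum_fintype] at hf ⊢
  rw [integrable_finsetSum_measure] at hf
  rw [integral_finsetSum_measure hf]
  simp only [integral_smul_measure, smul_eq_mul, condLaw]

/-- The strategy that plays `t` and then changes the report with `h`. -/
def Strategy.remap (t : Strategy S) (h : S → Report S → Report S) (hh : ∀ σ, Measurable (h σ)) :
    Strategy S := fun σ => (t σ).map (hh σ).aemeasurable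

theorem condLaw_update (s : Fin n → Strategy S) (i : Fin n) (t : Strategy S) (x : Fin n → S) :
    condLaw (Function.update s i t) x =
      ((t (x i) : Measure (Report S)).prod (condLaw s x)).map
        fun p => Function.update p.2 i p.1 := by
  have := map_update_prod_pi
    (fun j => (Function.update s i t j (x j) : Measure (Report S)))
    (fun j => (s j (x j) : Measure (Report S))) i
    (fun j hj => by simp only [Function.update_of_ne hj])
  simp only [Function.update_self] at this
  exact this.symm

theorem condLaw_update_remap (s : Fin n → Strategy S) (i : Fin n) (t : Strategy S)
    (h : S → Report S → Report S) (hh : ∀ σ, Measurable (h σ)) (x : Fin n → S) :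
    condLaw (Function.update s i (t.remap h hh)) x =
      ((t (x i) : Measure (Report S)).prod (condLaw s x)).map
        fun p => Function.update p.2 i (h (x i) p.1) := by
  have hm : Measurable fun p : Report S × (Fin n → Report S) => Function.update p.2 i p.1 :=
    measurable_update'.comp measurable_swap
  rw [condLaw_update]
  have := Measure.map_prod_map (t (x i) : Measure (Report S)) (condLaw s x) (hh (x i))
    measurable_id
  rw [Measure.map_id] at this
  change Measure.map _ ((Measure.map (h (x i)) (t (x i) : Measure (Report S))).prod _) = _
  rw [this, Measure.map_map hm ((hh (x i)).prodMap measurable_id)]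
  rfl

theorem Strategy.remap_id (t : Strategy S) :
    t.remap (fun _ => id) (fun _ => measurable_id) = t := by
  funext σ
  exact Subtype.ext Measure.map_id

theorem measurable_update_comp {i : Fin n} {h : Report S → Report S} (hh : Measurable h) :
    Measurable fun p : Report S × (Fin n → Report S) => Function.update p.2 i (h p.1) :=
  Measurable.comp (g := fun q : (Fin n → Report S) × Report S => Function.update q.1 i q.2)
    measurable_update' (measurable_snd.prodMk (hh.comp measurable_fst))

theorem hasExpectedPayment_remap_iff {𝓜 : Mechanism n S} (hM : ∀ i, Measurable fun r => 𝓜 r i)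
    {Q : PMF (Fin n → S)} {s : Fin n → Strategy S} {i : Fin n} {t : Strategy S}
    {h : S → Report S → Report S} {hh : ∀ σ, Measurable (h σ)} :
    HasExpectedPayment 𝓜 Q (Function.update s i (t.remap h hh)) i ↔ ∀ x, Q x ≠ 0 →
      Integrable (fun p => 𝓜 (Function.update p.2 i (h (x i) p.1)) i)
        ((t (x i) : Measure (Report S)).prod (condLaw s x)) := by
  rw [HasExpectedPayment, integrable_reportLaw_iff]
  refine forall₂_congr fun x _ => ?_
  rw [condLaw_update_remap, integrable_map_measure (hM i).aestronglyMeasurable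
    (measurable_update_comp (hh (x i))).aemeasurable]
  rfl

theorem expectedPayment_remap {𝓜 : Mechanism n S} (hM : ∀ i, Measurable fun r => 𝓜 r i)
    {Q : PMF (Fin n → S)} {s : Fin n → Strategy S} {i : Fin n} {t : Strategy S}
    {h : S → Report S → Report S} {hh : ∀ σ, Measurable (h σ)}
    (hint : HasExpectedPayment 𝓜 Q (Function.update s i (t.remap h hh)) i) :
    expectedPayment 𝓜 Q (Function.update s i (t.remap h hh)) i =
      ∑ x, (Q x).toReal * ∫ p, 𝓜 (Function.update p.2 i (h (x i) p.1)) i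
        ∂(t (x i) : Measure (Report S)).prod (condLaw s x) := by
  rw [expectedPayment, integral_reportLaw hint]
  refine Finset.sum_congr rfl fun x _ => ?_
  rw [condLaw_update_remap, integral_map (measurable_update_comp (hh (x i))).aemeasurable
    (hM i).aestronglyMeasurable]

/-- The expected gain (weighted with the probability of `σ`) of agent `i` with private signal `σ`
from reporting `a` instead of `b` when the others play `s`. -/
def reportGain [DecidableEq S] (𝓜 : Mechanism n S) (Q : PMF (Fin n → S)) (s : Fin n → Strategy S)
    (i : Fin n) (σ : S) (a b : Report S) : ℝ :=
  ∑ x with x i = σ, (Q x).toReal *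
    ∫ r, (𝓜 (Function.update r i a) i - 𝓜 (Function.update r i b) i) ∂condLaw s x

/-- If changing every report with `h` never loses, then remapping a strategy with `h` does not lose,
and it gains unless `h` almost surely gains nothing. -/
theorem expectedPayment_le_remap [DecidableEq S] {𝓜 : Mechanism n S}
    (hM : ∀ i, Measurable fun r => 𝓜 r i)
    {Q : PMF (Fin n → S)} {s : Fin n → Strategy S} {i : Fin n} {t : Strategy S}
    {h : S → Report S → Report S} (hh : ∀ σ, Measurable (h σ))
    (ht : HasExpectedPayment 𝓜 Q (Function.update s i t) i)
    (hth : HasExpectedPayment 𝓜 Q (Function.update s i (t.remap h hh)) i)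
    (hgain : ∀ σ a, reportGain 𝓜 Q s i σ a (h σ a) ≤ 0) :
    expectedPayment 𝓜 Q (Function.update s i t) i ≤
        expectedPayment 𝓜 Q (Function.update s i (t.remap h hh)) i ∧
      (expectedPayment 𝓜 Q (Function.update s i (t.remap h hh)) i ≤
          expectedPayment 𝓜 Q (Function.update s i t) i →
        ∀ σ, ∀ᵐ a ∂(t σ : Measure (Report S)), reportGain 𝓜 Q s i σ a (h σ a) = 0) := by
  rw [← t.remap_id] at ht
  have i1 := (hasExpectedPayment_remap_iff hM).1 ht
  have i2 := (hasExpectedPayment_remap_iff hM).1 hth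
  have e1 := expectedPayment_remap hM ht
  have e2 := expectedPayment_remap hM hth
  rw [t.remap_id] at e1
  simp only [id] at i1 e1
  set φ : (Fin n → S) → Report S → ℝ := fun x a =>
    ∫ r, (𝓜 (Function.update r i a) i - 𝓜 (Function.update r i (h (x i) a)) i) ∂condLaw s x with hφ
  have iφ : ∀ x, Integrable (fun a => (Q x).toReal * φ x a) (t (x i) : Measure (Report S)) := by
    intro x
    by_cases hx : Q x = 0
    · simp [hx]
    · exact ((i1 x hx).sub (i2 x hx)).integral_prod_left.const_mul _
  have eφ : ∀ x, (Q x).toReal * ∫ p, 𝓜 (Function.update p.2 i p.1) i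
        ∂(t (x i) : Measure (Report S)).prod (condLaw s x) -
      (Q x).toReal * ∫ p, 𝓜 (Function.update p.2 i (h (x i) p.1)) i
        ∂(t (x i) : Measure (Report S)).prod (condLaw s x) =
      ∫ a, (Q x).toReal * φ x a ∂(t (x i) : Measure (Report S)) := by
    intro x
    by_cases hx : Q x = 0
    · simp [hx]
    · rw [← mul_sub, ← integral_sub (i1 x hx) (i2 x hx),
        integral_const_mul]
      congr 1
      exact integral_prod _ ((i1 x hx).sub (i2 x hx))
  have gain_eq : ∀ σ a, reportGain 𝓜 Q s i σ a (h σ a) =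
      ∑ x with x i = σ, (Q x).toReal * φ x a := by
    intro σ a
    refine Finset.sum_congr rfl fun x hx => ?_
    rw [← (Finset.mem_filter.1 hx).2]
  have iφ' : ∀ σ x, x ∈ Finset.univ.filter (fun x : Fin n → S => x i = σ) →
      Integrable (fun a => (Q x).toReal * φ x a) (t σ : Measure (Report S)) := by
    intro σ x hx
    rw [← (Finset.mem_filter.1 hx).2]
    exact iφ x
  have igain : ∀ σ, Integrable (fun a => reportGain 𝓜 Q s i σ a (h σ a))
      (t σ : Measure (Report S)) := by
    intro σ
    simp only [gain_eq]
    exact integrable_finsetSum _ (iφ' σ)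
  have key : expectedPayment 𝓜 Q (Function.update s i t) i -
      expectedPayment 𝓜 Q (Function.update s i (t.remap h hh)) i =
      ∑ σ, ∫ a, reportGain 𝓜 Q s i σ a (h σ a) ∂(t σ : Measure (Report S)) := by
    rw [e1, e2, ← Finset.sum_sub_distrib, Finset.sum_congr rfl fun x _ => eφ x,
      ← Finset.sum_fiberwise Finset.univ (fun x : Fin n → S => x i)]
    refine Finset.sum_congr rfl fun σ _ => ?_
    simp only [gain_eq]
    rw [integral_finsetSum _ (iφ' σ)]
    refine Finset.sum_congr rfl fun x hx => ?_
    rw [(Finset.mem_filter.1 hx).2]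
  have hle : ∀ σ, ∫ a, reportGain 𝓜 Q s i σ a (h σ a) ∂(t σ : Measure (Report S)) ≤ 0 :=
    fun σ => integral_nonpos fun a => hgain σ a
  have hsum := Finset.sum_nonpos fun σ (_ : σ ∈ Finset.univ) => hle σ
  refine ⟨by linarith, fun hge σ => ?_⟩
  have h0 := (Finset.sum_eq_zero_iff_of_nonpos fun σ (_ : σ ∈ Finset.univ) => hle σ).1
    (le_antisymm hsum (by linarith)) σ (Finset.mem_univ σ)
  have h1 := (integral_eq_zero_iff_of_nonneg (f := fun a => -reportGain 𝓜 Q s i σ a (h σ a))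
    (fun a => neg_nonneg.2 (hgain σ a)) (igain σ).neg).1 (by rw [integral_neg, h0, neg_zero])
  filter_upwards [h1] with a ha
  simpa using ha

end Law

/-! ### Expectations under a symmetric prior -/

section Prior

variable {S : Type*} [Fintype S] [DecidableEq S] {n : ℕ} {M : Moments S} {Q : PMF (Fin n → S)}

theorem IsSymmetricPrior.sum_filter_mul (hQ : IsSymmetricPrior M Q) {i j : Fin n} (h : i ≠ j)
    (σ : S) (F : S → ℝ) :
    ∑ x with x i = σ, (Q x).toReal * F (x j) = M.q σ * ∑ τ, M.cond σ τ * F τ := by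
  rw [← Finset.sum_fiberwise (Finset.univ.filter fun x : Fin n → S => x i = σ) (fun x => x j),
    Finset.mul_sum]
  refine Finset.sum_congr rfl fun τ _ => ?_
  rw [← mul_assoc, ← hQ.2 i j h σ τ, Finset.sum_mul, Finset.filter_filter]
  refine Finset.sum_congr rfl fun x hx => ?_
  rw [(Finset.mem_filter.1 hx).2.2]

theorem IsSymmetricPrior.sum_mul (hQ : IsSymmetricPrior M Q) {i j : Fin n} (h : i ≠ j)
    (F : S → S → ℝ) :
    ∑ x, (Q x).toReal * F (x i) (x j) = ∑ σ, ∑ τ, M.q σ * M.cond σ τ * F σ τ := by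
  rw [← Finset.sum_fiberwise Finset.univ (fun x : Fin n → S => x i)]
  refine Finset.sum_congr rfl fun σ _ => ?_
  simp only [mul_assoc]
  rw [← Finset.mul_sum, ← hQ.sum_filter_mul h σ]
  refine Finset.sum_congr rfl fun x hx => ?_
  rw [(Finset.mem_filter.1 hx).2]

theorem IsSymmetricPrior.q_mul_cond_comm (hQ : IsSymmetricPrior M Q) {i j : Fin n} (h : i ≠ j)
    (σ τ : S) : M.q σ * M.cond σ τ = M.q τ * M.cond τ σ := by
  rw [← hQ.2 i j h, ← hQ.2 j i h.symm]
  simp only [and_comm]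

theorem IsSymmetricPrior.sum_q (hQ : IsSymmetricPrior M Q) (i : Fin n) : ∑ σ, M.q σ = 1 := by
  simp only [← hQ.1 i]
  rw [Finset.sum_fiberwise Finset.univ (fun x : Fin n → S => x i) (fun x => (Q x).toReal),
    ← ENNReal.toReal_sum fun x _ => Q.apply_ne_top x, ← tsum_fintype (L := .unconditional _),
    Q.tsum_coe, ENNReal.toReal_one]

theorem IsSymmetricPrior.nonempty (hQ : IsSymmetricPrior M Q) (i : Fin n) : Nonempty S := by
  by_contra h
  rw [not_nonempty_iff] at h
  simpa using hQ.sum_q i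

end Prior

/-! ### Measurability of the payments -/

section Measurability

variable {S X : Type*} [Fintype S] [MeasurableSpace X]

theorem measurable_dist_apply (σ : S) : Measurable fun p : Dist S => p σ :=
  (measurable_pi_apply σ).comp measurable_subtype_coe

theorem measurable_expectedScore {PS : S → Dist S → ℝ} (hPS : ∀ σ, Measurable (PS σ))
    {f g : X → Dist S} (hf : Measurable f) (hg : Measurable g) :
    Measurable fun x => expectedScore PS (f x) (g x) :=
  Finset.measurable_sum _ fun σ _ =>
    ((measurable_dist_apply σ).comp hf).mul ((hPS σ).comp hg)

theorem measurable_hellinger {f g : X → Dist S} (hf : Measurable f) (hg : Measurable g) :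
    Measurable fun x => hellinger (f x) (g x) :=
  Finset.measurable_sum _ fun σ _ =>
    (((measurable_dist_apply σ).comp hf).sqrt.sub
      ((measurable_dist_apply σ).comp hg).sqrt).pow_const 2

variable [MeasurableSpace S] [MeasurableSingletonClass S]

theorem measurable_apply_signal {F : S → X → ℝ} (hF : ∀ σ, Measurable (F σ)) {f : X → S}
    (hf : Measurable f) : Measurable fun x => F (f x) x := by
  classical
  have e : (fun x => F (f x) x) = fun x => ∑ σ, if f x = σ then F σ x else 0 := by
    funext x
    simp
  rw [e]
  exact Finset.measurable_sum _ fun σ _ =>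
    Measurable.ite (hf (measurableSet_singleton σ)) (hF σ) measurable_const

theorem measurableSet_signal_eq {f g : X → Report S} (hf : Measurable f) (hg : Measurable g) :
    MeasurableSet {x | (f x).1 = (g x).1} :=
  (hf.fst.prodMk hg.fst) (Set.toFinite {p : S × S | p.1 = p.2}).measurableSet

variable [DecidableEq S]

theorem measurable_scoreC {f g : X → Report S} (hf : Measurable f) (hg : Measurable g) :
    Measurable fun x => scoreC (f x) (g x) :=
  Measurable.ite (measurableSet_signal_eq hf hg) (measurable_hellinger hf.snd hg.snd).sqrt.neg
    (measurable_hellinger hf.snd hg.snd)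

theorem measurable_peerScore {PS : S → Dist S → ℝ} (hPS : ∀ σ, Measurable (PS σ)) (α β : ℝ)
    {f g : X → Report S} (hf : Measurable f) (hg : Measurable g) :
    Measurable fun x => peerScore α β PS (f x) (g x) := by
  refine (Measurable.const_mul ?_ α).add (Measurable.const_mul ?_ β)
  · exact measurable_apply_signal (F := fun σ x => PS σ (f x).2) (fun σ => (hPS σ).comp hf.snd)
      hg.fst
  · exact Measurable.ite (measurableSet_signal_eq hf hg)
      ((measurable_expectedScore hPS hg.snd hg.snd).sub
        (measurable_expectedScore hPS hg.snd hf.snd)).neg measurable_const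

theorem measurable_disagreementMechanism {n : ℕ} {PS : S → Dist S → ℝ}
    (hPS : ∀ σ, Measurable (PS σ)) (α β : ℝ) (D : DivisionRule n) (i : Fin n) :
    Measurable fun r => disagreementMechanism α β PS D r i := by
  have hT : ∀ (G : Finset (Fin n)) (j : Fin n),
      Measurable fun r : Fin n → Report S => truthfulPayment α β PS G r j := fun G j =>
    (Finset.measurable_sum _ fun k _ => measurable_peerScore hPS α β (measurable_pi_apply j)
      (measurable_pi_apply k)).div_const _
  have hC : Measurable fun r : Fin n → Report S => classificationReward r i :=
    (Finset.measurable_sum _ fun j _ => Finset.measurable_sum _ fun k _ =>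
      measurable_scoreC (measurable_pi_apply j) (measurable_pi_apply k)).div_const _
  refine (Finset.measurable_sum _ fun A _ => Measurable.const_mul ?_ _).add hC
  exact (hT _ i).sub ((Finset.measurable_sum _ fun j _ => hT _ j).const_mul _)

end Measurability

/-! ### Truthfulness -/

section Truthful

variable {S : Type*} [Fintype S] {n : ℕ} {M : Moments S} {Q : PMF (Fin n → S)}

theorem StrictlyProper.le {PS : S → Dist S → ℝ} (hPS : StrictlyProper PS) (p p' : Dist S) :
    expectedScore PS p p' ≤ expectedScore PS p p := by
  by_cases h : p' = p
  · rw [h]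
  · exact (hPS p p' h).le

section

variable [MeasurableSpace S]

theorem integrable_condLaw_eval {s : Fin n → Strategy S} {x : Fin n → S} {j : Fin n}
    {F : Report S → ℝ} (hF : Integrable F (s j (x j) : Measure (Report S))) :
    Integrable (fun r => F (r j)) (condLaw s x) :=
  have h := measurePreserving_eval (fun j => (s j (x j) : Measure (Report S))) j
  h.integrable_comp_of_integrable hF

theorem integral_condLaw_eval {s : Fin n → Strategy S} {x : Fin n → S} {j : Fin n}
    {F : Report S → ℝ} (hF : Integrable F (s j (x j) : Measure (Report S))) :
    ∫ r, F (r j) ∂condLaw s x = ∫ b, F b ∂(s j (x j) : Measure (Report S)) := by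
  have h := measurePreserving_eval (fun j => (s j (x j) : Measure (Report S))) j
  rw [← h.map_eq] at hF
  have := integral_map h.measurable.aemeasurable hF.aestronglyMeasurable
  rw [h.map_eq] at this
  exact this.symm

theorem condLaw_truth (x : Fin n → S) :
    condLaw (truth n M) x = Measure.dirac fun i => (x i, M.cond (x i)) :=
  pi_dirac _

end

variable [DecidableEq S]

/-- Reporting the signal `u` and the prediction `p` with private signal `σ`, against a truthful
peer: the loss in the prediction score and the loss in the information score. -/
theorem sum_peerScore_truth (α β : ℝ) (PS : S → Dist S → ℝ) (σ : S) (a : Report S) :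
    ∑ τ, M.cond σ τ * (peerScore α β PS a (τ, M.cond τ) -
        peerScore α β PS (σ, M.cond σ) (τ, M.cond τ)) =
      -(α * (expectedScore PS (M.cond σ) (M.cond σ) - expectedScore PS (M.cond σ) a.2)) -
        β * (M.cond σ a.1 * (expectedScore PS (M.cond a.1) (M.cond a.1) -
          expectedScore PS (M.cond a.1) a.2)) := by
  have h1 : ∀ τ, scoreI PS (σ, M.cond σ) (τ, M.cond τ) = 0 := by
    intro τ
    by_cases h : σ = τ
    · subst h
      simp [scoreI]
    · simp [scoreI, h]
  have h2 : ∑ τ, M.cond σ τ * scoreI PS a (τ, M.cond τ) =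
      -(M.cond σ a.1 * (expectedScore PS (M.cond a.1) (M.cond a.1) -
          expectedScore PS (M.cond a.1) a.2)) := by
    simp only [scoreI, mul_ite, mul_zero, Finset.sum_ite_eq, Finset.mem_univ, if_true]
    ring
  have h3 : ∀ p, ∑ τ, M.cond σ τ * PS τ p = expectedScore PS (M.cond σ) p := fun p => rfl
  have h4 : ∀ τ, M.cond σ τ * (peerScore α β PS a (τ, M.cond τ) -
        peerScore α β PS (σ, M.cond σ) (τ, M.cond τ)) =
      α * (M.cond σ τ * PS τ a.2) - α * (M.cond σ τ * PS τ (M.cond σ)) +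
        β * (M.cond σ τ * scoreI PS a (τ, M.cond τ)) := by
    intro τ
    simp only [peerScore, h1, scoreP]
    ring
  simp only [h4]
  rw [Finset.sum_add_distrib, Finset.sum_sub_distrib, ← Finset.mul_sum, ← Finset.mul_sum,
    ← Finset.mul_sum, h2, h3, h3]
  ring

variable [MeasurableSpace S]

theorem reportGain_disagreementMechanism (hQ : IsSymmetricPrior M Q) {α β : ℝ}
    {PS : S → Dist S → ℝ} (D : DivisionRule n) {i₀ j₀ : Fin n} (h₀ : i₀ ≠ j₀)
    {s : Fin n → Strategy S} (i : Fin n) (σ : S) (a b : Report S)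
    (hint : ∀ j τ, Integrable (fun y => peerScore α β PS a y - peerScore α β PS b y)
      (s j τ : Measure (Report S))) :
    reportGain (disagreementMechanism α β PS D) Q s i σ a b =
      D.peerProb i₀ j₀ * (M.q σ * ∑ j ∈ Finset.univ.erase i, ∑ τ, M.cond σ τ *
        ∫ y, (peerScore α β PS a y - peerScore α β PS b y) ∂(s j τ : Measure (Report S))) := by
  have e : ∀ x : Fin n → S, ∫ r, (disagreementMechanism α β PS D (Function.update r i a) i -
      disagreementMechanism α β PS D (Function.update r i b) i) ∂condLaw s x =
      D.peerProb i₀ j₀ * ∑ j ∈ Finset.univ.erase i,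
        ∫ y, (peerScore α β PS a y - peerScore α β PS b y) ∂(s j (x j) : Measure (Report S)) := by
    intro x
    simp only [disagreementMechanism_update_sub α β PS D h₀]
    rw [integral_const_mul, integral_finsetSum _ fun j _ => integrable_condLaw_eval (hint j (x j))]
    simp only [integral_condLaw_eval (hint _ (x _))]
  simp only [reportGain, e, Finset.mul_sum]
  rw [Finset.sum_comm]
  refine Finset.sum_congr rfl fun j hj => ?_
  have := hQ.sum_filter_mul (Finset.ne_of_mem_erase hj).symm σ fun τ =>
    ∫ y, (peerScore α β PS a y - peerScore α β PS b y) ∂(s j τ : Measure (Report S))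
  simp only [← Finset.mul_sum]
  rw [← this, Finset.mul_sum]
  exact Finset.sum_congr rfl fun x _ => by ring

variable [MeasurableSingletonClass S]

theorem truthful_disagreementMechanism (hn : 3 ≤ n) {PS : S → Dist S → ℝ}
    (hPS_meas : ∀ σ, Measurable (PS σ)) (hPS : StrictlyProper PS) {α β : ℝ} (hα : 0 < α)
    (hβ : 0 < β) (D : DivisionRule n) : Truthful (disagreementMechanism α β PS D) := by
  intro M Q hQ hM hinf
  obtain ⟨i₀, j₀, h₀⟩ : ∃ i₀ j₀ : Fin n, i₀ ≠ j₀ :=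
    ⟨⟨0, by omega⟩, ⟨1, by omega⟩, by simp⟩
  have hc := D.peerProb_pos hn h₀
  have hmeas := measurable_disagreementMechanism hPS_meas α β D
  have hint : ∀ i, HasExpectedPayment (disagreementMechanism α β PS D) Q (truth n M) i := by
    intro i
    refine integrable_reportLaw_iff.2 fun x _ => ?_
    rw [condLaw_truth]
    exact integrable_dirac (by simp)
  -- Each deviation is compared with truth-telling as its remapping by a constant report.
  have hgain : ∀ i σ a, reportGain (disagreementMechanism α β PS D) Q (truth n M) i σ a
      (σ, M.cond σ) = D.peerProb i₀ j₀ * (M.q σ * (((n : ℝ) - 1) *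
        (-(α * (expectedScore PS (M.cond σ) (M.cond σ) - expectedScore PS (M.cond σ) a.2)) -
        β * (M.cond σ a.1 * (expectedScore PS (M.cond a.1) (M.cond a.1) -
          expectedScore PS (M.cond a.1) a.2))))) := by
    intro i σ a
    rw [reportGain_disagreementMechanism hQ D h₀ i σ a _ fun j τ => integrable_dirac (by simp)]
    have e : ∀ j τ, ∫ y, (peerScore α β PS a y - peerScore α β PS (σ, M.cond σ) y)
        ∂(truth n M j τ : Measure (Report S)) = peerScore α β PS a (τ, M.cond τ) -
          peerScore α β PS (σ, M.cond σ) (τ, M.cond τ) := fun j τ => integral_dirac _ _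
    simp only [e, sum_peerScore_truth]
    rw [Finset.sum_const, Finset.card_erase_of_mem (Finset.mem_univ i), Finset.card_univ,
      Fintype.card_fin, nsmul_eq_mul, Nat.cast_sub (by omega), Nat.cast_one]
  have hn' : 0 < (n : ℝ) - 1 := by
    have : (3 : ℝ) ≤ n := by exact_mod_cast hn
    linarith
  have hloss : ∀ σ (a : Report S), -(α * (expectedScore PS (M.cond σ) (M.cond σ) -
      expectedScore PS (M.cond σ) a.2)) -
        β * (M.cond σ a.1 * (expectedScore PS (M.cond a.1) (M.cond a.1) -
          expectedScore PS (M.cond a.1) a.2)) ≤ 0 := by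
    intro σ a
    have h1 := mul_nonneg hα.le (sub_nonneg.2 (hPS.le (M.cond σ) a.2))
    have h2 := mul_nonneg hβ.le (mul_nonneg (hM.2 σ a.1).le
      (sub_nonneg.2 (hPS.le (M.cond a.1) a.2)))
    linarith
  have hle : ∀ i σ a, reportGain (disagreementMechanism α β PS D) Q (truth n M) i σ a
      (σ, M.cond σ) ≤ 0 := by
    intro i σ a
    rw [hgain]
    exact mul_nonpos_of_nonneg_of_nonpos hc.le (mul_nonpos_of_nonneg_of_nonpos (hM.1 σ).le
      (mul_nonpos_of_nonneg_of_nonpos hn'.le (hloss σ a)))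
  have heq : ∀ i σ a, reportGain (disagreementMechanism α β PS D) Q (truth n M) i σ a
      (σ, M.cond σ) = 0 → a = (σ, M.cond σ) := by
    intro i σ a h
    rw [hgain] at h
    have h := ((mul_eq_zero.1 ((mul_eq_zero.1 ((mul_eq_zero.1 h).resolve_left hc.ne')).resolve_left
      (hM.1 σ).ne')).resolve_left hn'.ne')
    have h1 := mul_nonneg hα.le (sub_nonneg.2 (hPS.le (M.cond σ) a.2))
    have h2 := mul_nonneg hβ.le (mul_nonneg (hM.2 σ a.1).le
      (sub_nonneg.2 (hPS.le (M.cond a.1) a.2)))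
    have hp : a.2 = M.cond σ := by
      by_contra hne
      have := mul_pos hα (sub_pos.2 (hPS (M.cond σ) a.2 hne))
      linarith
    have hu : a.1 = σ := by
      by_contra hne
      obtain ⟨τ, hτ⟩ := hinf a.1 σ hne
      have hne' : a.2 ≠ M.cond a.1 := by
        rw [hp]
        exact fun e => hτ (by rw [e])
      have := mul_pos hβ (mul_pos (hM.2 σ a.1) (sub_pos.2 (hPS (M.cond a.1) a.2 hne')))
      linarith
    exact Prod.ext hu hp
  have hremap : ∀ t : Strategy S, t.remap (fun σ _ => (σ, M.cond σ)) (fun _ => measurable_const) =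
      truthStrategy M := by
    intro t
    funext σ
    refine Subtype.ext ?_
    change Measure.map (fun _ => (σ, M.cond σ)) (t σ : Measure (Report S)) = Measure.dirac _
    rw [Measure.map_const, measure_univ, one_smul]
  have hself : ∀ i, Function.update (truth n M) i (truthStrategy M) = truth n M := fun i =>
    Function.update_eq_self i (truth n M)
  have hdev : ∀ i t, HasExpectedPayment (disagreementMechanism α β PS D) Q
      (Function.update (truth n M) i t) i → _ := fun i t ht =>
    expectedPayment_le_remap (h := fun σ _ => (σ, M.cond σ)) hmeas (fun _ => measurable_const) ht
      (by rw [hremap, hself]; exact hint i) (hle i)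
  simp only [hremap, hself] at hdev
  refine ⟨⟨hint, fun i t ht => (hdev i t ht).1⟩, fun i t ht he => ?_⟩
  funext σ
  refine Subtype.ext ?_
  have hae : (fun a : Report S => a) =ᵐ[(t σ : Measure (Report S))] fun _ => (σ, M.cond σ) := by
    filter_upwards [(hdev i t ht).2 he.ge σ] with a ha using heq i σ a ha
  calc (t σ : Measure (Report S)) = (t σ : Measure (Report S)).map fun a => a :=
        Measure.map_id'.symm
    _ = (t σ : Measure (Report S)).map fun _ => (σ, M.cond σ) := Measure.map_congr hae
    _ = Measure.dirac (σ, M.cond σ) := by rw [Measure.map_const, measure_univ, one_smul]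

end Truthful

/-! ### Expectations under a strategy with deterministic predictions -/

section Strategies

variable {S : Type*} [Fintype S] [MeasurableSpace S]

variable [MeasurableSingletonClass S]

/-- If the prediction is a function of the reported signal, then expectations are finite sums. -/
theorem integral_strategy {t : Strategy S} {σ : S} {p : S → Dist S}
    (h : ∀ᵐ a ∂(t σ : Measure (Report S)), a.2 = p a.1) (F : Report S → ℝ) :
    ∫ a, F a ∂(t σ : Measure (Report S)) = ∑ u, signalStrategy t u σ * F (u, p u) := by
  have e : ∫ a, F a ∂(t σ : Measure (Report S)) =
      ∫ a, F (a.1, p a.1) ∂(t σ : Measure (Report S)) := by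
    refine integral_congr_ae ?_
    filter_upwards [h] with a ha
    rw [← ha]
  have : IsProbabilityMeasure ((t σ : Measure (Report S)).map Prod.fst) :=
    Measure.isProbabilityMeasure_map measurable_fst.aemeasurable
  have hG : Measurable fun u : S => F (u, p u) := measurable_of_finite _
  rw [e, ← integral_map (f := fun u => F (u, p u)) measurable_fst.aemeasurable
    hG.aestronglyMeasurable, integral_fintype Integrable.of_finite]
  refine Finset.sum_congr rfl fun u _ => ?_
  rw [smul_eq_mul, map_measureReal_apply measurable_fst (measurableSet_singleton u)]
  rfl

theorem signalStrategy_isChannel (t : Strategy S) : IsChannel (signalStrategy t) := by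
  refine fun σ => ⟨fun u => measureReal_nonneg, ?_⟩
  have : IsProbabilityMeasure ((t σ : Measure (Report S)).map Prod.fst) :=
    Measure.isProbabilityMeasure_map measurable_fst.aemeasurable
  have h := integral_fintype (μ := (t σ : Measure (Report S)).map Prod.fst)
    (f := fun _ : S => (1 : ℝ)) Integrable.of_finite
  simp only [integral_const, probReal_univ, smul_eq_mul, mul_one] at h
  rw [h]
  refine Finset.sum_congr rfl fun u _ => ?_
  rw [map_measureReal_apply measurable_fst (measurableSet_singleton u)]
  rfl

end Strategies

/-! ### Optimal predictions -/

section Predictions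

variable {S : Type*} [Fintype S] [DecidableEq S] {n : ℕ} {M : Moments S} {Q : PMF (Fin n → S)}

/-- The weight that an agent with report signal `u` gives to the outcome `τ` of his prediction when
his peer reports `b`: `α` for the signal of the peer, `β b.2 τ` if the peer reports `u`, too. -/
def outcomeWeight (α β : ℝ) (u τ : S) (b : Report S) : ℝ :=
  α * (if b.1 = τ then 1 else 0) + β * (if b.1 = u then b.2 τ else 0)

theorem outcomeWeight_nonneg {α β : ℝ} (hα : 0 ≤ α) (hβ : 0 ≤ β) (u τ : S) (b : Report S) :
    0 ≤ outcomeWeight α β u τ b :=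
  add_nonneg (mul_nonneg hα (by split_ifs <;> simp))
    (mul_nonneg hβ (by split_ifs <;> simp [stdSimplex.zero_le]))

theorem outcomeWeight_le {α β : ℝ} (hα : 0 ≤ α) (hβ : 0 ≤ β) (u τ : S) (b : Report S) :
    outcomeWeight α β u τ b ≤ α + β :=
  add_le_add (mul_le_of_le_one_right hα (by split_ifs <;> simp))
    (mul_le_of_le_one_right hβ (by split_ifs <;> simp [stdSimplex.le_one]))

theorem sum_outcomeWeight (α β : ℝ) (u : S) (b : Report S) :
    ∑ τ, outcomeWeight α β u τ b = α + β * if b.1 = u then 1 else 0 := by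
  simp only [outcomeWeight, Finset.sum_add_distrib, ← Finset.mul_sum]
  congr 2
  · simp
  · split_ifs
    · exact stdSimplex.sum_eq_one _
    · simp

/-- Two reports with the same signal differ in payment as two predictions of an outcome with weights
`outcomeWeight`. -/
theorem peerScore_sub (α β : ℝ) (PS : S → Dist S → ℝ) (u : S) (p p' : Dist S) (b : Report S) :
    peerScore α β PS (u, p) b - peerScore α β PS (u, p') b =
      ∑ τ, outcomeWeight α β u τ b * (PS τ p - PS τ p') := by
  have e1 : ∑ τ, (α * (if b.1 = τ then 1 else 0)) * (PS τ p - PS τ p') =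
      α * (PS b.1 p - PS b.1 p') := by
    simp
  have e2 : ∑ τ, (β * (if b.1 = u then b.2 τ else 0)) * (PS τ p - PS τ p') =
      β * (if b.1 = u then expectedScore PS b.2 p - expectedScore PS b.2 p' else 0) := by
    split_ifs
    · simp only [expectedScore, ← Finset.sum_sub_distrib, Finset.mul_sum]
      exact Finset.sum_congr rfl fun _ _ => by ring
    · simp
  simp only [outcomeWeight, add_mul, Finset.sum_add_distrib, e1, e2, peerScore, scoreP, scoreI,
    eq_comm (a := u)]
  split_ifs <;> ring

variable [MeasurableSpace S]

/-- The unnormalized distribution of the outcome that agent `i` predicts with private signal `σ` and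
report signal `u`. -/
def outcomeMass (M : Moments S) (α β : ℝ) (s : Fin n → Strategy S) (i : Fin n) (σ u τ : S) : ℝ :=
  ∑ j ∈ Finset.univ.erase i, ∑ σ', M.cond σ σ' *
    ∫ b, outcomeWeight α β u τ b ∂(s j σ' : Measure (Report S))

theorem outcomeMass_nonneg {α β : ℝ} (hα : 0 ≤ α) (hβ : 0 ≤ β) (s : Fin n → Strategy S) (i : Fin n)
    (σ u τ : S) : 0 ≤ outcomeMass M α β s i σ u τ :=
  Finset.sum_nonneg fun _ _ => Finset.sum_nonneg fun _ _ => mul_nonneg (stdSimplex.zero_le _ _)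
    (integral_nonneg fun b => outcomeWeight_nonneg hα hβ u τ b)

variable [MeasurableSingletonClass S]

theorem measurable_outcomeWeight (α β : ℝ) (u τ : S) :
    Measurable fun b : Report S => outcomeWeight α β u τ b :=
  ((Measurable.ite (measurable_fst (measurableSet_singleton τ)) measurable_const
      measurable_const).const_mul α).add
    ((Measurable.ite (measurable_fst (measurableSet_singleton u))
      ((measurable_dist_apply τ).comp measurable_snd) measurable_const).const_mul β)

theorem integrable_outcomeWeight {α β : ℝ} (hα : 0 ≤ α) (hβ : 0 ≤ β) (u τ : S)
    (μ : Measure (Report S)) [IsFiniteMeasure μ] : Integrable (outcomeWeight α β u τ) μ :=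
  Integrable.of_bound (measurable_outcomeWeight α β u τ).aestronglyMeasurable (α + β)
    (Filter.Eventually.of_forall fun b => by
      rw [Real.norm_of_nonneg (outcomeWeight_nonneg hα hβ u τ b)]
      exact outcomeWeight_le hα hβ u τ b)

theorem sum_outcomeMass_pos (hn : 3 ≤ n) {α β : ℝ} (hα : 0 < α) (hβ : 0 ≤ β)
    (s : Fin n → Strategy S) (i : Fin n) (σ u : S) : 0 < ∑ τ, outcomeMass M α β s i σ u τ := by
  have e : ∑ τ, outcomeMass M α β s i σ u τ =
      ∑ j ∈ Finset.univ.erase i, ∑ σ', M.cond σ σ' *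
        ∫ b, ∑ τ, outcomeWeight α β u τ b ∂(s j σ' : Measure (Report S)) := by
    simp only [outcomeMass]
    rw [Finset.sum_comm]
    refine Finset.sum_congr rfl fun j _ => ?_
    rw [Finset.sum_comm]
    refine Finset.sum_congr rfl fun σ' _ => ?_
    rw [← Finset.mul_sum,
      integral_finsetSum _ fun τ _ => integrable_outcomeWeight hα.le hβ u τ _]
  rw [e]
  have h1 : ∀ j σ', α ≤ ∫ b, ∑ τ, outcomeWeight α β u τ b ∂(s j σ' : Measure (Report S)) := by
    intro j σ'
    have hint : Integrable (fun b => ∑ τ, outcomeWeight α β u τ b) (s j σ' : Measure (Report S)) :=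
      integrable_finsetSum _ fun τ _ => integrable_outcomeWeight hα.le hβ u τ _
    calc α = ∫ _, α ∂(s j σ' : Measure (Report S)) := by simp
      _ ≤ _ := integral_mono (integrable_const α) hint fun b => by
        simp only [sum_outcomeWeight]
        have : 0 ≤ β * if b.1 = u then (1 : ℝ) else 0 :=
          mul_nonneg hβ (by split_ifs <;> simp)
        linarith
  have h2 : ∀ j, α ≤ ∑ σ', M.cond σ σ' *
      ∫ b, ∑ τ, outcomeWeight α β u τ b ∂(s j σ' : Measure (Report S)) := by
    intro j
    calc α = ∑ σ', M.cond σ σ' * α := by rw [← Finset.sum_mul, stdSimplex.sum_eq_one, one_mul]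
      _ ≤ _ := Finset.sum_le_sum fun σ' _ =>
        mul_le_mul_of_nonneg_left (h1 j σ') (stdSimplex.zero_le _ _)
  refine Finset.sum_pos (fun j _ => hα.trans_le (h2 j)) (Finset.card_pos.1 ?_)
  rw [Finset.card_erase_of_mem (Finset.mem_univ i), Finset.card_univ, Fintype.card_fin]
  omega

/-- The best prediction of agent `i` with private signal `σ` who reports the signal `u`. -/
def bestPrediction (M : Moments S) (hn : 3 ≤ n) {α β : ℝ} (hα : 0 < α) (hβ : 0 ≤ β)
    (s : Fin n → Strategy S) (i : Fin n) (σ u : S) : Dist S :=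
  ⟨fun τ => outcomeMass M α β s i σ u τ / ∑ τ, outcomeMass M α β s i σ u τ,
    fun τ => div_nonneg (outcomeMass_nonneg hα.le hβ s i σ u τ)
      (sum_outcomeMass_pos hn hα hβ s i σ u).le, by
    rw [← Finset.sum_div, div_self (sum_outcomeMass_pos hn hα hβ s i σ u).ne']⟩

theorem sum_outcomeMass_mul_bestPrediction (hn : 3 ≤ n) {α β : ℝ} (hα : 0 < α) (hβ : 0 ≤ β)
    (s : Fin n → Strategy S) (i : Fin n) (σ u τ : S) :
    (∑ τ, outcomeMass M α β s i σ u τ) * bestPrediction M hn hα hβ s i σ u τ =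
      outcomeMass M α β s i σ u τ :=
  mul_div_cancel₀ _ (sum_outcomeMass_pos hn hα hβ s i σ u).ne'

theorem reportGain_bestPrediction (hQ : IsSymmetricPrior M Q) (hn : 3 ≤ n) {α β : ℝ} (hα : 0 < α)
    (hβ : 0 ≤ β) {PS : S → Dist S → ℝ} (D : DivisionRule n) {i₀ j₀ : Fin n} (h₀ : i₀ ≠ j₀)
    (s : Fin n → Strategy S) (i : Fin n) (σ u : S) (p : Dist S) :
    reportGain (disagreementMechanism α β PS D) Q s i σ (u, p)
        (u, bestPrediction M hn hα hβ s i σ u) =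
      D.peerProb i₀ j₀ * (M.q σ * ((∑ τ, outcomeMass M α β s i σ u τ) *
        (expectedScore PS (bestPrediction M hn hα hβ s i σ u) p -
          expectedScore PS (bestPrediction M hn hα hβ s i σ u)
            (bestPrediction M hn hα hβ s i σ u)))) := by
  set p' := bestPrediction M hn hα hβ s i σ u with hp'
  have hint : ∀ j σ' τ, Integrable (fun b => outcomeWeight α β u τ b * (PS τ p - PS τ p'))
      (s j σ' : Measure (Report S)) := fun j σ' τ =>
    (integrable_outcomeWeight hα.le hβ u τ _).mul_const _
  rw [reportGain_disagreementMechanism hQ D h₀ i σ (u, p) (u, p') (by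
    intro j σ'
    simp only [peerScore_sub]
    exact integrable_finsetSum _ fun τ _ => hint j σ' τ)]
  congr 2
  simp only [peerScore_sub, expectedScore]
  rw [← Finset.sum_sub_distrib, Finset.mul_sum]
  have e : ∀ τ, (∑ τ, outcomeMass M α β s i σ u τ) * (p' τ * PS τ p - p' τ * PS τ p') =
      outcomeMass M α β s i σ u τ * (PS τ p - PS τ p') := by
    intro τ
    rw [← sum_outcomeMass_mul_bestPrediction hn hα hβ s i σ u τ]
    ring
  simp only [e]
  simp only [outcomeMass, Finset.sum_mul]
  symm
  rw [Finset.sum_comm]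
  refine Finset.sum_congr rfl fun j _ => ?_
  rw [Finset.sum_comm]
  refine Finset.sum_congr rfl fun σ' _ => ?_
  rw [integral_finsetSum _ fun τ _ => hint j σ' τ, Finset.mul_sum]
  refine Finset.sum_congr rfl fun τ _ => ?_
  rw [integral_mul_const, mul_assoc]

/-- A payment that is integrable, and that changes by a bounded amount with the prediction, stays
integrable if the prediction is replaced by one that depends only on the reported signal. The slices
of the product measure reduce this to finitely many reports. -/
theorem integrable_update_prediction {α β : ℝ} (hα : 0 ≤ α) (hβ : 0 ≤ β) {PS : S → Dist S → ℝ}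
    (D : DivisionRule n) {i₀ j₀ : Fin n} (h₀ : i₀ ≠ j₀) (i : Fin n) (μ : Measure (Report S))
    [IsProbabilityMeasure μ] (s : Fin n → Strategy S) (x : Fin n → S) (p : S → Dist S)
    (h : Integrable (fun y => disagreementMechanism α β PS D (Function.update y.2 i y.1) i)
      (μ.prod (condLaw s x))) :
    Integrable (fun y => disagreementMechanism α β PS D (Function.update y.2 i (y.1.1, p y.1.1)) i)
      (μ.prod (condLaw s x)) := by
  have hslice : ∀ u, μ {a | a.1 = u} ≠ 0 →
      Integrable (fun r => disagreementMechanism α β PS D (Function.update r i (u, p u)) i)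
        (condLaw s x) := by
    intro u hu
    obtain ⟨⟨v, p'⟩, ha, rfl⟩ : ∃ a : Report S, Integrable (fun r =>
        disagreementMechanism α β PS D (Function.update r i a) i) (condLaw s x) ∧ a.1 = u := by
      by_contra hne
      push Not at hne
      refine hu (measure_mono_null (fun a ha => ?_) (ae_iff.1 h.prod_right_ae))
      exact fun hi => hne a hi ha
    have e : (fun r => disagreementMechanism α β PS D (Function.update r i (v, p v)) i) =
        fun r => disagreementMechanism α β PS D (Function.update r i (v, p')) i -
          D.peerProb i₀ j₀ * ∑ j ∈ Finset.univ.erase i,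
            ∑ τ, outcomeWeight α β v τ (r j) * (PS τ p' - PS τ (p v)) := by
      funext r
      have := disagreementMechanism_update_sub α β PS D h₀ r i (v, p') (v, p v)
      simp only [peerScore_sub] at this
      linarith
    simp only
    rw [e]
    refine ha.sub (Integrable.const_mul (integrable_finsetSum _ fun j _ =>
      integrable_finsetSum _ fun τ _ => Integrable.mul_const ?_ _) _)
    exact integrable_condLaw_eval (integrable_outcomeWeight hα hβ v τ _)
  have e : (fun y : Report S × (Fin n → Report S) =>
      disagreementMechanism α β PS D (Function.update y.2 i (y.1.1, p y.1.1)) i) =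
      fun y => ∑ u, (if y.1.1 = u then (1 : ℝ) else 0) *
        disagreementMechanism α β PS D (Function.update y.2 i (u, p u)) i := by
    funext y
    simp
  rw [e]
  refine integrable_finsetSum _ fun u _ => ?_
  have hms : MeasurableSet {a : Report S | a.1 = u} := measurable_fst (measurableSet_singleton u)
  by_cases hu : μ {a | a.1 = u} = 0
  · refine (integrable_zero _ _ _).congr ?_
    have h1 : ∀ᵐ a ∂μ, ¬ a.1 = u := by
      rw [ae_iff]
      simpa using hu
    filter_upwards [Measure.quasiMeasurePreserving_fst.ae h1] with y hy
    simp [hy]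
  · refine Integrable.mul_prod (f := fun a : Report S => if a.1 = u then (1 : ℝ) else 0) ?_
      (hslice u hu)
    exact Integrable.of_bound
      (Measurable.ite hms measurable_const measurable_const).aestronglyMeasurable 1
      (Filter.Eventually.of_forall fun a => by split_ifs <;> simp)

/-- In equilibrium, predictions are a function of the private and the reported signal. -/
theorem IsEquilibrium.ae_eq_bestPrediction (hQ : IsSymmetricPrior M Q) (hM : M.NonZero)
    (hn : 3 ≤ n) {α β : ℝ} (hα : 0 < α) (hβ : 0 ≤ β) {PS : S → Dist S → ℝ}
    (hPS_meas : ∀ σ, Measurable (PS σ)) (hPS : StrictlyProper PS) (D : DivisionRule n)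
    {s : Fin n → Strategy S} (hs : IsEquilibrium (disagreementMechanism α β PS D) Q s)
    (i : Fin n) (σ : S) :
    ∀ᵐ a ∂(s i σ : Measure (Report S)), a.2 = bestPrediction M hn hα hβ s i σ a.1 := by
  obtain ⟨i₀, j₀, h₀⟩ : ∃ i₀ j₀ : Fin n, i₀ ≠ j₀ :=
    ⟨⟨0, by omega⟩, ⟨1, by omega⟩, by simp⟩
  have hmeas := measurable_disagreementMechanism hPS_meas α β D
  set h : S → Report S → Report S := fun σ a => (a.1, bestPrediction M hn hα hβ s i σ a.1)
  have hh : ∀ σ, Measurable (h σ) := fun σ =>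
    (measurable_of_finite fun u : S => ((u, bestPrediction M hn hα hβ s i σ u) : Report S)).comp
      measurable_fst
  have hgain : ∀ σ a, reportGain (disagreementMechanism α β PS D) Q s i σ a (h σ a) = _ :=
    fun σ a => reportGain_bestPrediction hQ hn hα hβ D h₀ s i σ a.1 a.2
  have hc := D.peerProb_pos hn h₀
  have hself : HasExpectedPayment (disagreementMechanism α β PS D) Q
      (Function.update s i (s i)) i := by
    rw [Function.update_eq_self]
    exact hs.1 i
  have hdev : HasExpectedPayment (disagreementMechanism α β PS D) Q
      (Function.update s i ((s i).remap h hh)) i := by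
    refine (hasExpectedPayment_remap_iff hmeas).2 fun x hx => ?_
    refine integrable_update_prediction hα.le hβ D h₀ i _ s x
      (bestPrediction M hn hα hβ s i (x i)) ?_
    rw [← (s i).remap_id] at hself
    exact (hasExpectedPayment_remap_iff hmeas).1 hself x hx
  have hle := expectedPayment_le_remap hmeas hh hself hdev fun σ a => by
    rw [hgain]
    exact mul_nonpos_of_nonneg_of_nonpos hc.le (mul_nonpos_of_nonneg_of_nonpos (hM.1 σ).le
      (mul_nonpos_of_nonneg_of_nonpos (sum_outcomeMass_pos hn hα hβ s i σ a.1).le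
        (sub_nonpos.2 (hPS.le _ _))))
  have hopt := hs.2 i _ hdev
  rw [Function.update_eq_self] at hle
  filter_upwards [hle.2 hopt σ] with a ha
  rw [hgain] at ha
  by_contra hne
  have := (((mul_eq_zero.1 ((mul_eq_zero.1 ((mul_eq_zero.1 ha).resolve_left hc.ne')).resolve_left
    (hM.1 σ).ne')).resolve_left (sum_outcomeMass_pos hn hα hβ s i σ a.1).ne'))
  exact absurd this (sub_neg.2 (hPS _ _ hne)).ne

theorem outcomeMass_eq {α β : ℝ} {s : Fin n → Strategy S} {p : Fin n → S → S → Dist S}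
    (h : ∀ i σ, ∀ᵐ a ∂(s i σ : Measure (Report S)), a.2 = p i σ a.1) (i : Fin n) (σ u τ : S) :
    outcomeMass M α β s i σ u τ = ∑ j ∈ Finset.univ.erase i, ∑ σ', M.cond σ σ' *
      (α * signalStrategy (s j) τ σ' + β * (signalStrategy (s j) u σ' * p j σ' u τ)) := by
  refine Finset.sum_congr rfl fun j _ => Finset.sum_congr rfl fun σ' _ => ?_
  rw [integral_strategy (h j σ')]
  congr 1
  simp only [outcomeWeight, mul_add, Finset.sum_add_distrib, mul_ite, mul_zero, mul_one,
    Finset.sum_ite_eq', Finset.mem_univ, if_true]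
  ring

end Predictions

/-! ### The welfare of a profile -/

section Welfare

variable {S : Type*} [Fintype S] [DecidableEq S] {n : ℕ} {M : Moments S} {Q : PMF (Fin n → S)}

theorem abs_scoreC_le (a b : Report S) : |scoreC a b| ≤ 2 := by
  have h0 : 0 ≤ hellinger a.2 b.2 := sqHellinger_nonneg _ _
  have h2 : hellinger a.2 b.2 ≤ 2 := sqHellinger_le_two a.2.2 b.2.2
  unfold scoreC
  split_ifs
  · rw [abs_neg, abs_of_nonneg (Real.sqrt_nonneg _)]
    exact Real.sqrt_le_iff.2 ⟨by norm_num, by linarith⟩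
  · rwa [abs_of_nonneg h0]

variable [MeasurableSpace S] [MeasurableSingletonClass S]

theorem integrable_scoreC {X : Type*} [MeasurableSpace X] (μ : Measure X) [IsFiniteMeasure μ]
    {f g : X → Report S} (hf : Measurable f) (hg : Measurable g) :
    Integrable (fun x => scoreC (f x) (g x)) μ :=
  Integrable.of_bound (measurable_scoreC hf hg).aestronglyMeasurable 2
    (Filter.Eventually.of_forall fun _ => abs_scoreC_le _ _)

theorem integral_condLaw_scoreC (s : Fin n → Strategy S) (x : Fin n → S) {j k : Fin n}
    (h : k ≠ j) :
    ∫ r, scoreC (r j) (r k) ∂condLaw s x =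
      ∫ a, ∫ b, scoreC a b ∂(s k (x k) : Measure (Report S))
        ∂(s j (x j) : Measure (Report S)) := by
  have hu := condLaw_update s j (s j) x
  rw [Function.update_eq_self] at hu
  have hm : Measurable fun p : Report S × (Fin n → Report S) => Function.update p.2 j p.1 :=
    measurable_update_comp (h := id) measurable_id
  rw [hu, integral_map hm.aemeasurable
    (measurable_scoreC (measurable_pi_apply j) (measurable_pi_apply k)).aestronglyMeasurable]
  simp only [Function.update_self, Function.update_of_ne h]
  rw [integral_prod _ (integrable_scoreC _ measurable_fst
    ((measurable_pi_apply k).comp measurable_snd))]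
  refine integral_congr_ae (Filter.Eventually.of_forall fun a => ?_)
  exact integral_condLaw_eval (integrable_scoreC _ measurable_const measurable_id)

theorem welfare_disagreementMechanism (hQ : IsSymmetricPrior M Q) (hn : 3 ≤ n) (α β : ℝ)
    (PS : S → Dist S → ℝ) (D : DivisionRule n) (s : Fin n → Strategy S) :
    welfare (disagreementMechanism α β PS D) Q s =
      (∑ j, ∑ k ∈ Finset.univ.erase j, ∑ σ, ∑ τ, M.q σ * M.cond σ τ *
        ∫ a, ∫ b, scoreC a b ∂(s k τ : Measure (Report S)) ∂(s j σ : Measure (Report S))) /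
        ((n : ℝ) - 1) := by
  have hint : ∀ (j k : Fin n) (x : Fin n → S), Integrable (fun r => scoreC (r j) (r k))
      (condLaw s x) := fun j k x =>
    integrable_scoreC _ (measurable_pi_apply j) (measurable_pi_apply k)
  simp only [welfare, sum_disagreementMechanism α β PS D hn]
  rw [integral_div, integral_reportLaw (integrable_reportLaw_iff.2 fun x _ =>
    integrable_finsetSum _ fun j _ => integrable_finsetSum _ fun k _ => hint j k x)]
  congr 1
  have e : ∀ x, ∫ r, ∑ j, ∑ k ∈ Finset.univ.erase j, scoreC (r j) (r k) ∂condLaw s x =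
      ∑ j, ∑ k ∈ Finset.univ.erase j, ∫ a, ∫ b, scoreC a b ∂(s k (x k) : Measure (Report S))
        ∂(s j (x j) : Measure (Report S)) := by
    intro x
    rw [integral_finsetSum _ fun j _ => integrable_finsetSum _ fun k _ => hint j k x]
    refine Finset.sum_congr rfl fun j _ => ?_
    rw [integral_finsetSum _ fun k _ => hint j k x]
    exact Finset.sum_congr rfl fun k hk => integral_condLaw_scoreC s x (Finset.ne_of_mem_erase hk)
  simp only [e, Finset.mul_sum]
  rw [Finset.sum_comm]
  refine Finset.sum_congr rfl fun j _ => ?_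
  rw [Finset.sum_comm]
  refine Finset.sum_congr rfl fun k hk => ?_
  rw [hQ.sum_mul (Finset.ne_of_mem_erase hk).symm fun σ τ => ∫ a, ∫ b, scoreC a b
    ∂(s k τ : Measure (Report S)) ∂(s j σ : Measure (Report S))]

/-- A permutation profile realizes the divergence between the beliefs of any two agents. -/
theorem welfare_permProfile (hQ : IsSymmetricPrior M Q) (hn : 3 ≤ n) (α β : ℝ)
    (PS : S → Dist S → ℝ) (D : DivisionRule n) (π : Equiv.Perm S) :
    welfare (disagreementMechanism α β PS D) Q (permProfile n M π) =
      n * ∑ σ, ∑ τ, M.q σ * M.cond σ τ * sqHellinger (M.cond σ) (M.cond τ) := by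
  have hm : ∀ a : Report S, StronglyMeasurable fun b => scoreC a b := fun a =>
    (measurable_scoreC measurable_const measurable_id).stronglyMeasurable
  have hm' : ∀ b : Report S, StronglyMeasurable fun a => scoreC a b := fun a =>
    (measurable_scoreC measurable_id measurable_const).stronglyMeasurable
  have e : ∀ (j k : Fin n) σ τ, ∫ a, ∫ b, scoreC a b
      ∂(permProfile n M π k τ : Measure (Report S))
        ∂(permProfile n M π j σ : Measure (Report S)) = sqHellinger (M.cond σ) (M.cond τ) := by
    intro j k σ τ
    change ∫ a, ∫ b, scoreC a b ∂(Measure.dirac (π τ, (M.permute π).cond (π τ)))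
      ∂(Measure.dirac (π σ, (M.permute π).cond (π σ))) = _
    simp only [integral_dirac' _ _ (hm _)]
    rw [integral_dirac' _ _ (hm' _)]
    have h : hellinger ((M.permute π).cond (π σ)) ((M.permute π).cond (π τ)) =
        sqHellinger (M.cond σ) (M.cond τ) := by
      change sqHellinger (fun ρ => M.cond (π.symm (π σ)) (π.symm ρ))
        (fun ρ => M.cond (π.symm (π τ)) (π.symm ρ)) = _
      rw [sqHellinger_comp_equiv π.symm (M.cond (π.symm (π σ))), π.symm_apply_apply,
        π.symm_apply_apply]
    unfold scoreC
    split_ifs with hst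
    · simp only [EmbeddingLike.apply_eq_iff_eq] at hst
      subst hst
      simp [hellinger_eq_sqHellinger]
    · exact h
  have hn' : (n : ℝ) - 1 ≠ 0 := by
    have : (3 : ℝ) ≤ n := by exact_mod_cast hn
    linarith
  rw [welfare_disagreementMechanism hQ hn]
  simp only [e, Finset.sum_const, Finset.card_erase_of_mem (Finset.mem_univ _), Finset.card_univ,
    Fintype.card_fin, nsmul_eq_mul]
  rw [Nat.cast_sub (by omega), Nat.cast_one]
  field_simp

end Welfare

/-! ### The effect of leaving out one agent -/

section LeaveOneOut

variable {n : ℕ}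

/-- The average over the agents other than `i`. -/
def avgOthers (x : Fin n → ℝ) (i : Fin n) : ℝ := (∑ j ∈ Finset.univ.erase i, x j) / ((n : ℝ) - 1)

theorem avgOthers_nonneg (hn : 3 ≤ n) {x : Fin n → ℝ} (h0 : ∀ i, 0 ≤ x i) (i : Fin n) :
    0 ≤ avgOthers x i := by
  have : (3 : ℝ) ≤ n := by exact_mod_cast hn
  exact div_nonneg (Finset.sum_nonneg fun j _ => h0 j) (by linarith)

theorem avgOthers_sub (hn : 3 ≤ n) (x : Fin n → ℝ) (i : Fin n) :
    avgOthers x i - (∑ j, x j) / n = ((∑ j, x j) / n - x i) / ((n : ℝ) - 1) := by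
  have hn' : (3 : ℝ) ≤ n := by exact_mod_cast hn
  have h1 : (n : ℝ) - 1 ≠ 0 := by linarith
  have h2 : (n : ℝ) ≠ 0 := by linarith
  have e := Finset.add_sum_erase Finset.univ x (Finset.mem_univ i)
  rw [avgOthers, ← e]
  field_simp
  ring

theorem sum_avgOthers_sub (hn : 3 ≤ n) (x : Fin n → ℝ) :
    ∑ i, (avgOthers x i - (∑ j, x j) / n) = 0 := by
  have hn' : (n : ℝ) ≠ 0 := by
    have : (3 : ℝ) ≤ n := by exact_mod_cast hn
    linarith
  simp only [avgOthers_sub hn]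
  rw [← Finset.sum_div, Finset.sum_sub_distrib, Finset.sum_const, Finset.card_univ,
    Fintype.card_fin, nsmul_eq_mul, mul_div_cancel₀ _ hn', sub_self, zero_div]

/-- The first-order terms of `√` cancel on average. -/
theorem two_mul_sqrt_mul_sum (hn : 3 ≤ n) {x : Fin n → ℝ} (h0 : ∀ i, 0 ≤ x i) :
    2 * √((∑ j, x j) / n) * ∑ i, (√(avgOthers x i) - √((∑ j, x j) / n)) =
      -∑ i, (√(avgOthers x i) - √((∑ j, x j) / n)) ^ 2 := by
  have ha : 0 ≤ (∑ j, x j) / n := div_nonneg (Finset.sum_nonneg fun j _ => h0 j) n.cast_nonneg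
  rw [eq_neg_iff_add_eq_zero, ← sum_avgOthers_sub hn x, Finset.mul_sum, ← Finset.sum_add_distrib]
  refine Finset.sum_congr rfl fun i _ => ?_
  linear_combination Real.sq_sqrt (avgOthers_nonneg hn h0 i) - Real.sq_sqrt ha

/-- For numbers in `[0, 1]`, leaving out one of them changes the square root of the average by
`O(1/n)` in quadratic mean. The bound is uniform because `∑ xᵢ² ≤ ∑ xᵢ`, so that the variance is
at most the average itself. -/
theorem sum_sq_sqrt_avgOthers_sub_le (hn : 3 ≤ n) {x : Fin n → ℝ} (h0 : ∀ i, 0 ≤ x i)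
    (h1 : ∀ i, x i ≤ 1) :
    ∑ i, (√(avgOthers x i) - √((∑ j, x j) / n)) ^ 2 ≤ n / ((n : ℝ) - 1) ^ 2 := by
  have hn' : (3 : ℝ) ≤ n := by exact_mod_cast hn
  have hsum : 0 ≤ ∑ j, x j := Finset.sum_nonneg fun j _ => h0 j
  rcases hsum.eq_or_lt with hs | hs
  · have hx : ∀ i, x i = 0 := fun i =>
      (Finset.sum_eq_zero_iff_of_nonneg fun j _ => h0 j).1 hs.symm i (Finset.mem_univ i)
    simp only [avgOthers, hx]
    simp
    positivity
  · have hna : ∑ j, x j = n * ((∑ j, x j) / n) := by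
      rw [mul_div_cancel₀]
      linarith
    set a := (∑ j, x j) / n
    have ha : 0 < a := by
      rw [hna] at hs
      exact pos_of_mul_pos_right hs (by linarith)
    have e1 : ∀ i, a * (√(avgOthers x i) - √a) ^ 2 ≤ (a - x i) ^ 2 / ((n : ℝ) - 1) ^ 2 := by
      intro i
      have h2 := Real.sq_sqrt (avgOthers_nonneg hn h0 i)
      have h3 := Real.sq_sqrt ha.le
      have h4 := Real.sqrt_nonneg (avgOthers x i)
      have h5 := Real.sqrt_nonneg a
      rw [← div_pow, ← avgOthers_sub hn]
      change _ ≤ (avgOthers x i - a) ^ 2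
      have e : avgOthers x i - a = (√(avgOthers x i) - √a) * (√(avgOthers x i) + √a) := by
        linear_combination h3 - h2
      rw [e, mul_pow, mul_comm]
      refine mul_le_mul_of_nonneg_left ?_ (sq_nonneg _)
      nlinarith
    have e2 : ∑ i, (a - x i) ^ 2 ≤ n * a := by
      have : ∀ i, (a - x i) ^ 2 ≤ a ^ 2 - 2 * a * x i + x i := fun i => by
        nlinarith [mul_nonneg (h0 i) (sub_nonneg.2 (h1 i))]
      refine (Finset.sum_le_sum fun i _ => this i).trans ?_
      rw [Finset.sum_add_distrib, Finset.sum_sub_distrib, ← Finset.mul_sum, Finset.sum_const,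
        Finset.card_univ, Fintype.card_fin, nsmul_eq_mul, hna]
      nlinarith [mul_nonneg (show (0 : ℝ) ≤ n by linarith) (sq_nonneg a)]
    have e3 : a * ∑ i, (√(avgOthers x i) - √a) ^ 2 ≤ a * (n / ((n : ℝ) - 1) ^ 2) := by
      rw [Finset.mul_sum]
      refine (Finset.sum_le_sum fun i _ => e1 i).trans ?_
      rw [← Finset.sum_div, show a * (n / ((n : ℝ) - 1) ^ 2) = n * a / ((n : ℝ) - 1) ^ 2 by ring]
      exact div_le_div_of_nonneg_right e2 (sq_nonneg _)
    exact le_of_mul_le_mul_left e3 ha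

theorem sum_sum_erase_fst (f : Fin n → ℝ) (hn : 3 ≤ n) :
    ∑ i, ∑ _k ∈ Finset.univ.erase i, f i = ((n : ℝ) - 1) * ∑ i, f i := by
  simp only [Finset.sum_const, Finset.card_erase_of_mem (Finset.mem_univ _), Finset.card_univ,
    Fintype.card_fin, nsmul_eq_mul]
  rw [Nat.cast_sub (by omega), Nat.cast_one, Finset.mul_sum]

theorem sum_sum_erase_comm {R : Type*} [AddCommMonoid R] (f : Fin n → Fin n → R) :
    ∑ i, ∑ k ∈ Finset.univ.erase i, f i k = ∑ k, ∑ i ∈ Finset.univ.erase k, f i k :=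
  Finset.sum_comm' (by intro i k; simp [ne_comm])

theorem sum_sum_erase_snd (f : Fin n → ℝ) (hn : 3 ≤ n) :
    ∑ i, ∑ k ∈ Finset.univ.erase i, f k = ((n : ℝ) - 1) * ∑ i, f i := by
  rw [sum_sum_erase_comm, sum_sum_erase_fst f hn]

/-- The averages of two sequences, with a different agent left out in each: if the averages are
comparable, then the squared difference of the square roots changes by `O(1/n²)` on average, since
the terms of first order cancel. -/
theorem sum_sum_sq_sqrt_avgOthers_le (hn : 3 ≤ n) {x y : Fin n → ℝ} (hx0 : ∀ i, 0 ≤ x i)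
    (hx1 : ∀ i, x i ≤ 1) (hy0 : ∀ i, 0 ≤ y i) (hy1 : ∀ i, y i ≤ 1) {c : ℝ} (hc : 0 < c)
    (hc1 : c ≤ 1) (hxy : c * ((∑ j, x j) / n) ≤ (∑ j, y j) / n)
    (hyx : c * ((∑ j, y j) / n) ≤ (∑ j, x j) / n) :
    ∑ i, ∑ k ∈ Finset.univ.erase i, (√(avgOthers x i) - √(avgOthers y k)) ^ 2 ≤
      n * ((n : ℝ) - 1) * (√((∑ j, x j) / n) - √((∑ j, y j) / n)) ^ 2 +
        4 / c * (n / ((n : ℝ) - 1)) := by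
  have hn' : (3 : ℝ) ≤ n := by exact_mod_cast hn
  have hx := two_mul_sqrt_mul_sum hn hx0
  have hy := two_mul_sqrt_mul_sum hn hy0
  have hx2 := sum_sq_sqrt_avgOthers_sub_le hn hx0 hx1
  have hy2 := sum_sq_sqrt_avgOthers_sub_le hn hy0 hy1
  have ha : 0 ≤ (∑ j, x j) / n := div_nonneg (Finset.sum_nonneg fun j _ => hx0 j) n.cast_nonneg
  have hb : 0 ≤ (∑ j, y j) / n := div_nonneg (Finset.sum_nonneg fun j _ => hy0 j) n.cast_nonneg
  set a := (∑ j, x j) / n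
  set b := (∑ j, y j) / n
  set E := (n : ℝ) / ((n : ℝ) - 1) ^ 2 with hE
  -- `√b ≤ √a / c` and `√a ≤ √b / c`
  have key : ∀ {a b : ℝ}, 0 ≤ b → c * b ≤ a → c * √b ≤ √a := by
    intro a b hb h
    refine Real.le_sqrt_of_sq_le ?_
    rw [mul_pow, Real.sq_sqrt hb]
    nlinarith [mul_nonneg hc.le hb]
  have hab := key hb hyx
  have hba := key ha hxy
  -- the cross term of one of the two sequences
  have cross : ∀ {A B δ V : ℝ}, 0 ≤ A → 0 ≤ B → c * B ≤ A → 0 ≤ V → 2 * A * δ = -V →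
      (A = 0 → δ = 0) → 2 * (A - B) * δ ≤ (1 / c - 1) * V := by
    intro A B δ V hA hB h hV he h0
    rcases hA.eq_or_lt with h' | h'
    · rw [h0 h'.symm]
      have : 1 ≤ 1 / c := by rwa [le_div_iff₀ hc, one_mul]
      nlinarith
    · have h2 : B / A ≤ 1 / c := by
        rw [div_le_div_iff₀ h' hc]
        linarith
      have e : 2 * (A - B) * δ = (B / A - 1) * V := by
        rw [show V = -(2 * A * δ) by linarith]
        field_simp
        ring
      rw [e]
      exact mul_le_mul_of_nonneg_right (by linarith) hV
  have zero : ∀ {x : Fin n → ℝ}, (∀ i, 0 ≤ x i) → √((∑ j, x j) / n) = 0 →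
      ∑ i, (√(avgOthers x i) - √((∑ j, x j) / n)) = 0 := by
    intro x h0 h
    have hs : 0 ≤ ∑ j, x j := Finset.sum_nonneg fun j _ => h0 j
    have h' := (Real.sqrt_eq_zero (div_nonneg hs n.cast_nonneg)).1 h
    have h2 : ∑ j, x j = 0 := (div_eq_zero_iff.1 h').resolve_right (by linarith)
    have h3 : ∀ i, x i = 0 := fun i =>
      (Finset.sum_eq_zero_iff_of_nonneg fun j _ => h0 j).1 h2 i (Finset.mem_univ i)
    simp [avgOthers, h3]
  set δ := ∑ i, (√(avgOthers x i) - √a)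
  set ε := ∑ i, (√(avgOthers y i) - √b)
  have V0 : 0 ≤ ∑ i, (√(avgOthers x i) - √a) ^ 2 := Finset.sum_nonneg fun _ _ => sq_nonneg _
  have U0 : 0 ≤ ∑ i, (√(avgOthers y i) - √b) ^ 2 := Finset.sum_nonneg fun _ _ => sq_nonneg _
  have c1 := cross (Real.sqrt_nonneg a) (Real.sqrt_nonneg b) hab V0 hx (zero hx0)
  have c2 := cross (Real.sqrt_nonneg b) (Real.sqrt_nonneg a) hba U0 hy (zero hy0)
  have expand : ∑ i, ∑ k ∈ Finset.univ.erase i, (√(avgOthers x i) - √(avgOthers y k)) ^ 2 ≤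
      ∑ i, ∑ k ∈ Finset.univ.erase i, ((√a - √b) ^ 2 +
        (2 * (√a - √b) * (√(avgOthers x i) - √a) + 2 * (√(avgOthers x i) - √a) ^ 2) +
        (2 * (√b - √a) * (√(avgOthers y k) - √b) + 2 * (√(avgOthers y k) - √b) ^ 2)) := by
    refine Finset.sum_le_sum fun i _ => Finset.sum_le_sum fun k _ => ?_
    nlinarith [sq_nonneg ((√(avgOthers x i) - √a) + (√(avgOthers y k) - √b))]
  refine expand.trans ?_
  simp only [Finset.sum_add_distrib (s := Finset.univ.erase _), Finset.sum_add_distrib]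
  rw [sum_sum_erase_fst (fun _ => (√a - √b) ^ 2) hn,
    sum_sum_erase_fst (fun i => 2 * (√a - √b) * (√(avgOthers x i) - √a)) hn,
    sum_sum_erase_fst (fun i => 2 * (√(avgOthers x i) - √a) ^ 2) hn,
    sum_sum_erase_snd (fun i => 2 * (√b - √a) * (√(avgOthers y i) - √b)) hn,
    sum_sum_erase_snd (fun i => 2 * (√(avgOthers y i) - √b) ^ 2) hn]
  simp only [← Finset.mul_sum, Finset.sum_const, Finset.card_univ, Fintype.card_fin, nsmul_eq_mul]
  have hc' : 1 ≤ 1 / c := by rwa [le_div_iff₀ hc, one_mul]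
  have e : 4 / c * (n / ((n : ℝ) - 1)) = ((n : ℝ) - 1) * (4 * (1 / c) * E) := by
    have : (n : ℝ) - 1 ≠ 0 := by linarith
    rw [hE]
    field_simp
  rw [e]
  have hE0 : 0 ≤ E := by positivity
  have f1 : 2 * (√a - √b) * δ + 2 * ∑ i, (√(avgOthers x i) - √a) ^ 2 ≤ (1 / c + 1) * E := by
    have := mul_le_mul_of_nonneg_left hx2 (show 0 ≤ 1 / c + 1 by linarith)
    linarith
  have f2 : 2 * (√b - √a) * ε + 2 * ∑ i, (√(avgOthers y i) - √b) ^ 2 ≤ (1 / c + 1) * E := by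
    have := mul_le_mul_of_nonneg_left hy2 (show 0 ≤ 1 / c + 1 by linarith)
    linarith
  have f3 : (1 / c + 1) * E ≤ 2 * (1 / c) * E := mul_le_mul_of_nonneg_right (by linarith) hE0
  have f4 := mul_le_mul_of_nonneg_left (show 2 * (√a - √b) * δ +
    2 * ∑ i, (√(avgOthers x i) - √a) ^ 2 + (2 * (√b - √a) * ε +
      2 * ∑ i, (√(avgOthers y i) - √b) ^ 2) ≤ 4 * (1 / c) * E by linarith)
    (show 0 ≤ (n : ℝ) - 1 by linarith)
  linarith

end LeaveOneOut

/-! ### Average channels -/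

section AverageChannel

variable {S : Type*} {n : ℕ}

/-- The average signal strategy of the agents other than `i`. -/
def othersChannel (θ : Fin n → S → S → ℝ) (i : Fin n) (u σ : S) : ℝ :=
  avgOthers (fun j => θ j u σ) i

/-- The average signal strategy of all agents. -/
def avgChannel (θ : Fin n → S → S → ℝ) (u σ : S) : ℝ := (∑ j, θ j u σ) / n

theorem avgChannel_of_eq (hn : 3 ≤ n) {θ : Fin n → S → S → ℝ} {κ : S → S → ℝ}
    (h : ∀ i, θ i = κ) : avgChannel θ = κ := by
  have hn' : (n : ℝ) ≠ 0 := by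
    have : (3 : ℝ) ≤ n := by exact_mod_cast hn
    linarith
  funext u σ
  simp [avgChannel, h, hn']

theorem othersChannel_of_eq (hn : 3 ≤ n) {θ : Fin n → S → S → ℝ} {κ : S → S → ℝ}
    (h : ∀ i, θ i = κ) (i : Fin n) : othersChannel θ i = κ := by
  have hn' : (n : ℝ) - 1 ≠ 0 := by
    have : (3 : ℝ) ≤ n := by exact_mod_cast hn
    linarith
  funext u σ
  simp only [othersChannel, avgOthers, h, Finset.sum_const,
    Finset.card_erase_of_mem (Finset.mem_univ i), Finset.card_univ, Fintype.card_fin, nsmul_eq_mul]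
  rw [Nat.cast_sub (by omega), Nat.cast_one, mul_div_cancel_left₀ _ hn']

variable [Fintype S]

theorem othersChannel_isChannel (hn : 3 ≤ n) {θ : Fin n → S → S → ℝ} (h : ∀ i, IsChannel (θ i))
    (i : Fin n) : IsChannel (othersChannel θ i) := by
  have hn' : (3 : ℝ) ≤ n := by exact_mod_cast hn
  refine fun σ => ⟨fun u => avgOthers_nonneg hn (fun j => (h j).nonneg u σ) i, ?_⟩
  simp only [othersChannel, avgOthers]
  rw [← Finset.sum_div, Finset.sum_comm]
  simp only [(h _).sum_eq_one, Finset.sum_const, Finset.card_erase_of_mem (Finset.mem_univ i),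
    Finset.card_univ, Fintype.card_fin, nsmul_eq_mul, mul_one]
  rw [Nat.cast_sub (by omega), Nat.cast_one, div_self]
  linarith

theorem avgChannel_isChannel (hn : 3 ≤ n) {θ : Fin n → S → S → ℝ} (h : ∀ i, IsChannel (θ i)) :
    IsChannel (avgChannel θ) := by
  have hn' : (3 : ℝ) ≤ n := by exact_mod_cast hn
  refine fun σ => ⟨fun u => div_nonneg (Finset.sum_nonneg fun j _ => (h j).nonneg u σ)
    n.cast_nonneg, ?_⟩
  simp only [avgChannel]
  rw [← Finset.sum_div, Finset.sum_comm]
  simp only [(h _).sum_eq_one, Finset.sum_const, Finset.card_univ, Fintype.card_fin, nsmul_eq_mul,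
    mul_one]
  rw [div_self]
  linarith

theorem channel_othersChannel (θ : Fin n → S → S → ℝ) (i : Fin n) (p : S → ℝ) (u : S) :
    channel (othersChannel θ i) p u = avgOthers (fun j => channel (θ j) p u) i := by
  simp only [channel, othersChannel, avgOthers, div_mul_eq_mul_div, Finset.sum_mul]
  rw [← Finset.sum_div, Finset.sum_comm]

theorem channel_avgChannel (θ : Fin n → S → S → ℝ) (p : S → ℝ) (u : S) :
    channel (avgChannel θ) p u = (∑ j, channel (θ j) p u) / n := by
  simp only [channel, avgChannel, div_mul_eq_mul_div, Finset.sum_mul]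
  rw [← Finset.sum_div, Finset.sum_comm]

/-- If all beliefs are bounded below by `c`, then leaving out the agents themselves changes the
divergences by `O(1/n²)` on average. -/
theorem sum_sum_sqHellinger_othersChannel_le (hn : 3 ≤ n) {θ : Fin n → S → S → ℝ}
    (h : ∀ i, IsChannel (θ i)) {p p' : S → ℝ} (hp : p ∈ stdSimplex ℝ S)
    (hp' : p' ∈ stdSimplex ℝ S) {c : ℝ} (hc : 0 < c) (hc1 : c ≤ 1) (hcp : ∀ σ, c ≤ p σ)
    (hcp' : ∀ σ, c ≤ p' σ) :
    ∑ i, ∑ k ∈ Finset.univ.erase i, sqHellinger (channel (othersChannel θ i) p)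
        (channel (othersChannel θ k) p') ≤
      n * ((n : ℝ) - 1) * sqHellinger (channel (avgChannel θ) p) (channel (avgChannel θ) p') +
        Fintype.card S * (4 / c * (n / ((n : ℝ) - 1))) := by
  have hcomp : ∀ {p p' : S → ℝ}, p ∈ stdSimplex ℝ S → (∀ σ, c ≤ p' σ) → ∀ u,
      c * ((∑ j, channel (θ j) p u) / n) ≤ (∑ j, channel (θ j) p' u) / n := by
    intro p p' hp hcp' u
    rw [← channel_avgChannel, ← channel_avgChannel, channel, channel, Finset.mul_sum]
    refine Finset.sum_le_sum fun σ _ => ?_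
    have h1 := (avgChannel_isChannel hn h).nonneg u σ
    have h2 : p σ ≤ 1 := (mem_Icc_of_mem_stdSimplex hp σ).2
    have h3 : c * p σ ≤ p' σ := (mul_le_of_le_one_right hc.le h2).trans (hcp' σ)
    nlinarith
  have main : ∀ u, ∑ i, ∑ k ∈ Finset.univ.erase i, (√(channel (othersChannel θ i) p u) -
      √(channel (othersChannel θ k) p' u)) ^ 2 ≤
      n * ((n : ℝ) - 1) *
        (√(channel (avgChannel θ) p u) - √(channel (avgChannel θ) p' u)) ^ 2 +
        4 / c * (n / ((n : ℝ) - 1)) := by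
    intro u
    simp only [channel_othersChannel, channel_avgChannel]
    exact sum_sum_sq_sqrt_avgOthers_le hn (fun j => ((h j).channel_mem hp).1 u)
      (fun j => channel_le_one (h j) hp u) (fun j => ((h j).channel_mem hp').1 u)
      (fun j => channel_le_one (h j) hp' u) hc hc1 (hcomp hp hcp' u) (hcomp hp' hcp u)
  have := Finset.sum_le_sum fun u (_ : u ∈ Finset.univ) => main u
  rw [Finset.sum_add_distrib, ← Finset.mul_sum, Finset.sum_const, Finset.card_univ,
    nsmul_eq_mul] at this
  refine le_trans (le_of_eq ?_) this
  simp only [sqHellinger]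
  symm
  rw [Finset.sum_comm]
  refine Finset.sum_congr rfl fun i _ => ?_
  rw [Finset.sum_comm]

theorem sum_sqrt_sqHellinger_othersChannel_le (hn : 3 ≤ n) {θ : Fin n → S → S → ℝ}
    (h : ∀ i, IsChannel (θ i)) {p : S → ℝ} (hp : p ∈ stdSimplex ℝ S) :
    ∑ i, √(sqHellinger (channel (othersChannel θ i) p) (channel (avgChannel θ) p)) ≤
      √(Fintype.card S) * (n / ((n : ℝ) - 1)) := by
  have hn' : (3 : ℝ) ≤ n := by exact_mod_cast hn
  have h1 : ∑ i, sqHellinger (channel (othersChannel θ i) p) (channel (avgChannel θ) p) ≤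
      Fintype.card S * (n / ((n : ℝ) - 1) ^ 2) := by
    simp only [sqHellinger]
    rw [Finset.sum_comm]
    refine (Finset.sum_le_sum (g := fun _ => (n : ℝ) / ((n : ℝ) - 1) ^ 2) fun u _ => ?_).trans
      (by simp)
    simp only [channel_othersChannel, channel_avgChannel]
    exact sum_sq_sqrt_avgOthers_sub_le hn (fun j => ((h j).channel_mem hp).1 u)
      (fun j => channel_le_one (h j) hp u)
  have h2 := Finset.sum_mul_sq_le_sq_mul_sq Finset.univ (fun _ : Fin n => (1 : ℝ))
    (fun i => √(sqHellinger (channel (othersChannel θ i) p) (channel (avgChannel θ) p)))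
  simp only [one_mul, one_pow, Finset.sum_const, Finset.card_univ, Fintype.card_fin, nsmul_eq_mul,
    mul_one, Real.sq_sqrt (sqHellinger_nonneg _ _)] at h2
  refine (abs_le_of_sq_le_sq' ?_ ?_).2
  · refine h2.trans ((mul_le_mul_of_nonneg_left h1 n.cast_nonneg).trans_eq ?_)
    rw [mul_pow, div_pow, Real.sq_sqrt (Nat.cast_nonneg _)]
    ring
  · exact mul_nonneg (Real.sqrt_nonneg _) (div_nonneg n.cast_nonneg (by linarith))

/-- A bound for the effect of leaving out agents that does not depend on the prior. -/
theorem sum_sum_sqHellinger_othersChannel_le' (hn : 3 ≤ n) {θ : Fin n → S → S → ℝ}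
    (h : ∀ i, IsChannel (θ i)) {p p' : S → ℝ} (hp : p ∈ stdSimplex ℝ S)
    (hp' : p' ∈ stdSimplex ℝ S) :
    ∑ i, ∑ k ∈ Finset.univ.erase i, sqHellinger (channel (othersChannel θ i) p)
        (channel (othersChannel θ k) p') ≤
      n * ((n : ℝ) - 1) * sqHellinger (channel (avgChannel θ) p) (channel (avgChannel θ) p') +
        4 * √2 * n * √(Fintype.card S) := by
  have hn' : (3 : ℝ) ≤ n := by exact_mod_cast hn
  have hA := avgChannel_isChannel hn h
  have hO := othersChannel_isChannel hn h
  have h1 : ∀ i k, sqHellinger (channel (othersChannel θ i) p) (channel (othersChannel θ k) p') ≤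
      sqHellinger (channel (avgChannel θ) p) (channel (avgChannel θ) p') +
      2 * √2 * √(sqHellinger (channel (othersChannel θ i) p) (channel (avgChannel θ) p)) +
      2 * √2 * √(sqHellinger (channel (othersChannel θ k) p') (channel (avgChannel θ) p')) := by
    intro i k
    have e1 := sqHellinger_le_add ((hO i).channel_mem hp) (hA.channel_mem hp)
      ((hO k).channel_mem hp')
    have e2 := sqHellinger_le_add ((hO k).channel_mem hp') (hA.channel_mem hp')
      (hA.channel_mem hp)
    rw [sqHellinger_comm _ (channel (avgChannel θ) p),
      sqHellinger_comm (channel (avgChannel θ) p') (channel (avgChannel θ) p)] at e2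
    linarith
  refine (Finset.sum_le_sum fun i _ => Finset.sum_le_sum fun k _ => h1 i k).trans ?_
  simp only [Finset.sum_add_distrib (s := Finset.univ.erase _), Finset.sum_add_distrib]
  rw [sum_sum_erase_fst (fun _ => sqHellinger (channel (avgChannel θ) p)
      (channel (avgChannel θ) p')) hn,
    sum_sum_erase_fst (fun i => 2 * √2 * √(sqHellinger (channel (othersChannel θ i) p)
      (channel (avgChannel θ) p))) hn,
    sum_sum_erase_snd (fun i => 2 * √2 * √(sqHellinger (channel (othersChannel θ i) p')
      (channel (avgChannel θ) p'))) hn]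
  simp only [← Finset.mul_sum, Finset.sum_const, Finset.card_univ, Fintype.card_fin, nsmul_eq_mul]
  have d1 := sum_sqrt_sqHellinger_othersChannel_le hn h hp
  have d2 := sum_sqrt_sqHellinger_othersChannel_le hn h hp'
  have hk : 0 ≤ ((n : ℝ) - 1) * (2 * √2) := mul_nonneg (by linarith) (by positivity)
  have d3 := mul_le_mul_of_nonneg_left (add_le_add d1 d2) hk
  have e : ((n : ℝ) - 1) * (2 * √2) * (√(Fintype.card S) * (n / ((n : ℝ) - 1)) +
      √(Fintype.card S) * (n / ((n : ℝ) - 1))) = 4 * √2 * n * √(Fintype.card S) := by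
    have : (n : ℝ) - 1 ≠ 0 := by linarith
    field_simp
    ring
  rw [e] at d3
  linarith

end AverageChannel

/-! ### The divergence of the predictions in equilibrium -/

section PredictionDivergence

variable {S : Type*} [Fintype S] {n : ℕ} {M : Moments S} {α β : ℝ} {θ : Fin n → S → S → ℝ}
  {p : Fin n → S → S → Dist S}

theorem dist_mem (p : Dist S) : ⇑p ∈ stdSimplex ℝ S := p.2

/-- The predictions `p i σ u` (of agent `i` with private signal `σ` and report signal `u`) are the
optimal ones when the agents play the signal strategies `θ`: a mixture of the distribution of
the reported signals of the others, with weight `α` for each of them, and of the predictions of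
those who also report `u`, with weight `β` times their probability. -/
def IsPredictionEquilibrium (M : Moments S) (α β : ℝ) (θ : Fin n → S → S → ℝ)
    (p : Fin n → S → S → Dist S) : Prop :=
  ∀ i σ u τ, (((n : ℝ) - 1) * α + β * ∑ j ∈ Finset.univ.erase i, ∑ σ', M.cond σ σ' * θ j u σ') *
      p i σ u τ =
    ((n : ℝ) - 1) * α * channel (othersChannel θ i) (M.cond σ) τ +
      β * ∑ j ∈ Finset.univ.erase i, ∑ σ', M.cond σ σ' * θ j u σ' * p j σ' u τ

/-- How much agent `i` with private signal `σ` and report signal `u` expects to differ from those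
who also report `u`. -/
def disagreement (M : Moments S) (θ : Fin n → S → S → ℝ) (p : Fin n → S → S → Dist S) (i : Fin n)
    (σ u : S) : ℝ :=
  ∑ j ∈ Finset.univ.erase i, ∑ σ', M.cond σ σ' * θ j u σ' *
    √(sqHellinger (p i σ u) (p j σ' u))

theorem disagreement_nonneg (hθ : ∀ i, IsChannel (θ i)) (i : Fin n) (σ u : S) :
    0 ≤ disagreement M θ p i σ u :=
  Finset.sum_nonneg fun j _ => Finset.sum_nonneg fun σ' _ =>
    mul_nonneg (mul_nonneg (stdSimplex.zero_le _ _) ((hθ j).nonneg u σ')) (Real.sqrt_nonneg _)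

/-- The prediction exceeds the honest forecast `θ₋ᵢ q_σ` in divergence from any `b` by at most a
multiple of the disagreement: by convexity, the mixture can only gain from the predictions that are
mixed in as far as they differ from it. -/
theorem IsPredictionEquilibrium.sqHellinger_le (hp : IsPredictionEquilibrium M α β θ p) (hn : 3 ≤ n)
    (hα : 0 < α) (hβ : 0 ≤ β) (hθ : ∀ i, IsChannel (θ i)) (i : Fin n) (σ u : S) {b : S → ℝ}
    (hb : b ∈ stdSimplex ℝ S) :
    sqHellinger (p i σ u) b ≤ sqHellinger (channel (othersChannel θ i) (M.cond σ)) b +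
      2 * √2 * β / (((n : ℝ) - 1) * α) * disagreement M θ p i σ u := by
  have hn' : (3 : ℝ) ≤ n := by exact_mod_cast hn
  have hN : 0 < ((n : ℝ) - 1) * α := mul_pos (by linarith) hα
  have hO := (othersChannel_isChannel hn hθ i).channel_mem (M.cond_mem σ)
  have hw : ∀ j σ', 0 ≤ M.cond σ σ' * θ j u σ' := fun j σ' =>
    mul_nonneg (stdSimplex.zero_le _ _) ((hθ j).nonneg u σ')
  set c := channel (othersChannel θ i) (M.cond σ) with hc
  set w : Option (Fin n × S) → ℝ := fun o =>
    o.elim (((n : ℝ) - 1) * α) fun k => β * (M.cond σ k.2 * θ k.1 u k.2) with hwdef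
  set z : Option (Fin n × S) → S → ℝ := fun o => o.elim c fun k => p k.1 k.2 u with hzdef
  have split : ∀ f : Option (Fin n × S) → ℝ,
      ∑ k ∈ Finset.insertNone (Finset.univ.erase i ×ˢ Finset.univ), f k =
        f none + ∑ j ∈ Finset.univ.erase i, ∑ σ', f (some (j, σ')) := by
    intro f
    rw [Finset.sum_insertNone, Finset.sum_product]
  have hconv := sqHellinger_convex (Finset.insertNone (Finset.univ.erase i ×ˢ Finset.univ)) w z
    (p i σ u) b (by
      rintro (_ | ⟨j, σ'⟩)
      · exact hN.le
      · exact mul_nonneg hβ (hw j σ')) (by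
      rintro (_ | ⟨j, σ'⟩) τ
      · exact hO.1 τ
      · exact stdSimplex.zero_le _ _) (stdSimplex.zero_le _) hb.1 (by
      intro τ
      simp only [split, hwdef, hzdef, Option.elim]
      have := hp i σ u τ
      simp only [Finset.mul_sum, mul_assoc] at this ⊢
      exact this)
  simp only [split, hwdef, hzdef, Option.elim] at hconv
  have hle : ∑ j ∈ Finset.univ.erase i, ∑ σ', β * (M.cond σ σ' * θ j u σ') *
      sqHellinger (p j σ' u) b ≤
      (∑ j ∈ Finset.univ.erase i, ∑ σ', β * (M.cond σ σ' * θ j u σ')) * sqHellinger (p i σ u) b +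
        2 * √2 * β * disagreement M θ p i σ u := by
    simp only [disagreement, Finset.mul_sum, Finset.sum_mul]
    rw [← Finset.sum_add_distrib]
    refine Finset.sum_le_sum fun j _ => ?_
    rw [← Finset.sum_add_distrib]
    refine Finset.sum_le_sum fun σ' _ => ?_
    have h1 := sqHellinger_le_add (dist_mem (p j σ' u)) (dist_mem (p i σ u)) hb
    rw [sqHellinger_comm (p j σ' u) (p i σ u)] at h1
    have h2 := mul_le_mul_of_nonneg_left h1 (mul_nonneg hβ (hw j σ'))
    exact h2.trans (le_of_eq (by ring))
  have h3 : ((n : ℝ) - 1) * α * sqHellinger (p i σ u) b ≤ ((n : ℝ) - 1) * α * sqHellinger c b +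
      2 * √2 * β * disagreement M θ p i σ u := by linarith
  rw [div_mul_eq_mul_div, ← sub_le_iff_le_add', le_div_iff₀ hN]
  linarith

/-- The loss from agents who report the same signal with different predictions. -/
def totalDisagreement (M : Moments S) (θ : Fin n → S → S → ℝ) (p : Fin n → S → S → Dist S) : ℝ :=
  ∑ i, ∑ σ, M.q σ * ∑ u, θ i u σ * disagreement M θ p i σ u

theorem sum_loss_eq_totalDisagreement (M : Moments S) (θ : Fin n → S → S → ℝ)
    (p : Fin n → S → S → Dist S) :
    ∑ i, ∑ k ∈ Finset.univ.erase i, ∑ σ, ∑ τ, M.q σ * M.cond σ τ *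
      ∑ u, θ i u σ * θ k u τ * √(sqHellinger (p i σ u) (p k τ u)) = totalDisagreement M θ p := by
  simp only [totalDisagreement, disagreement, Finset.mul_sum]
  refine Finset.sum_congr rfl fun i _ => ?_
  rw [Finset.sum_comm]
  refine Finset.sum_congr rfl fun σ _ => ?_
  rw [Finset.sum_comm (s := Finset.univ (α := S))]
  refine Finset.sum_congr rfl fun k _ => ?_
  rw [Finset.sum_comm]
  exact Finset.sum_congr rfl fun u _ => Finset.sum_congr rfl fun τ _ => by ring

variable [DecidableEq S]

/-- The classification score of two agents is, in expectation, at most the divergence of the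
honest forecasts, up to the disagreement between agents who report the same signal, which
enters as a gain of order `β / α` and as a loss. -/
theorem IsPredictionEquilibrium.sum_scoreC_le (hp : IsPredictionEquilibrium M α β θ p) (hn : 3 ≤ n)
    (hα : 0 < α) (hβ : 0 ≤ β) (hθ : ∀ i, IsChannel (θ i)) (i k : Fin n) (σ τ : S) :
    ∑ u, θ i u σ * ∑ v, θ k v τ * scoreC (u, p i σ u) (v, p k τ v) ≤
      sqHellinger (channel (othersChannel θ i) (M.cond σ))
        (channel (othersChannel θ k) (M.cond τ)) +
      2 * √2 * β / (((n : ℝ) - 1) * α) * (∑ u, θ i u σ * disagreement M θ p i σ u +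
        ∑ v, θ k v τ * disagreement M θ p k τ v) -
      ∑ u, θ i u σ * θ k u τ * √(sqHellinger (p i σ u) (p k τ u)) := by
  have hn' : (3 : ℝ) ≤ n := by exact_mod_cast hn
  set C := 2 * √2 * β / (((n : ℝ) - 1) * α) with hC
  have hC0 : 0 ≤ C := div_nonneg (by positivity) (mul_nonneg (by linarith) hα.le)
  set H := sqHellinger (channel (othersChannel θ i) (M.cond σ))
    (channel (othersChannel θ k) (M.cond τ)) with hH
  have hH0 : 0 ≤ H := sqHellinger_nonneg _ _
  have pointwise : ∀ u v, scoreC (u, p i σ u) (v, p k τ v) ≤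
      H + C * disagreement M θ p i σ u + C * disagreement M θ p k τ v -
        if u = v then √(sqHellinger (p i σ u) (p k τ u)) else 0 := by
    intro u v
    have d1 := mul_nonneg hC0 (disagreement_nonneg (M := M) (p := p) hθ i σ u)
    have d2 := mul_nonneg hC0 (disagreement_nonneg (M := M) (p := p) hθ k τ v)
    by_cases huv : u = v
    · subst huv
      simp only [scoreC, if_true, hellinger_eq_sqHellinger]
      linarith
    · have e1 := hp.sqHellinger_le hn hα hβ hθ i σ u (b := p k τ v) (p k τ v).2
      have e2 := hp.sqHellinger_le hn hα hβ hθ k τ v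
        ((othersChannel_isChannel hn hθ i).channel_mem (M.cond_mem σ))
      rw [sqHellinger_comm, sqHellinger_comm (channel (othersChannel θ k) _)] at e2
      simp only [scoreC, huv, if_false, hellinger_eq_sqHellinger]
      linarith
  have sum_θ : ∀ (j : Fin n) ρ (X : ℝ), ∑ v, θ j v ρ * X = X := fun j ρ X => by
    rw [← Finset.sum_mul, (hθ j).sum_eq_one, one_mul]
  calc ∑ u, θ i u σ * ∑ v, θ k v τ * scoreC (u, p i σ u) (v, p k τ v)
      ≤ ∑ u, θ i u σ * ∑ v, θ k v τ * (H + C * disagreement M θ p i σ u +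
          C * disagreement M θ p k τ v -
            if u = v then √(sqHellinger (p i σ u) (p k τ u)) else 0) :=
        Finset.sum_le_sum fun u _ => mul_le_mul_of_nonneg_left (Finset.sum_le_sum fun v _ =>
          mul_le_mul_of_nonneg_left (pointwise u v) ((hθ k).nonneg v τ)) ((hθ i).nonneg u σ)
    _ = ∑ u, θ i u σ * (H + C * disagreement M θ p i σ u +
          C * ∑ v, θ k v τ * disagreement M θ p k τ v -
            θ k u τ * √(sqHellinger (p i σ u) (p k τ u))) := by
        refine Finset.sum_congr rfl fun u _ => ?_
        congr 1
        simp only [mul_sub, mul_add, Finset.sum_sub_distrib, Finset.sum_add_distrib, sum_θ, mul_ite,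
          mul_zero, Finset.sum_ite_eq, Finset.mem_univ, if_true, Finset.mul_sum, mul_left_comm C]
    _ = _ := by
        generalize ∑ v, θ k v τ * disagreement M θ p k τ v = B
        simp only [mul_sub, mul_add, Finset.sum_sub_distrib, Finset.sum_add_distrib, sum_θ,
          mul_left_comm _ C, ← Finset.mul_sum, mul_assoc, add_assoc]

/-- For small `β / α`, the loss outweighs the gain, and the agents do at most as well as with
the honest forecasts. -/
theorem IsPredictionEquilibrium.sum_sum_scoreC_le (hp : IsPredictionEquilibrium M α β θ p)
    (hn : 3 ≤ n) (hM : M.NonZero) (hsymm : ∀ σ τ, M.q σ * M.cond σ τ = M.q τ * M.cond τ σ)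
    (hα : 0 < α) (hβ : 0 ≤ β) (hβα : 4 * √2 * β ≤ α) (hθ : ∀ i, IsChannel (θ i)) :
    ∑ i, ∑ k ∈ Finset.univ.erase i, ∑ σ, ∑ τ, M.q σ * M.cond σ τ *
        ∑ u, θ i u σ * ∑ v, θ k v τ * scoreC (u, p i σ u) (v, p k τ v) ≤
      ∑ i, ∑ k ∈ Finset.univ.erase i, ∑ σ, ∑ τ, M.q σ * M.cond σ τ *
        sqHellinger (channel (othersChannel θ i) (M.cond σ))
          (channel (othersChannel θ k) (M.cond τ)) := by
  have hn' : (3 : ℝ) ≤ n := by exact_mod_cast hn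
  set C := 2 * √2 * β / (((n : ℝ) - 1) * α) with hC
  set B : Fin n → S → ℝ := fun i σ => ∑ u, θ i u σ * disagreement M θ p i σ u with hB
  set T := totalDisagreement M θ p with hT
  have hTB : T = ∑ i, ∑ σ, M.q σ * B i σ := rfl
  have hT0 : 0 ≤ T := Finset.sum_nonneg fun i _ => Finset.sum_nonneg fun σ _ =>
    mul_nonneg (hM.1 σ).le (Finset.sum_nonneg fun u _ =>
      mul_nonneg ((hθ i).nonneg u σ) (disagreement_nonneg hθ i σ u))
  have s1 : ∀ i, ∑ σ, ∑ τ, M.q σ * M.cond σ τ * B i σ = ∑ σ, M.q σ * B i σ := by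
    intro i
    refine Finset.sum_congr rfl fun σ _ => ?_
    rw [← Finset.sum_mul, ← Finset.mul_sum, stdSimplex.sum_eq_one, mul_one]
  have s2 : ∀ k, ∑ σ, ∑ τ, M.q σ * M.cond σ τ * B k τ = ∑ σ, M.q σ * B k σ := by
    intro k
    rw [Finset.sum_comm, ← s1 k]
    exact Finset.sum_congr rfl fun σ _ => Finset.sum_congr rfl fun τ _ => by rw [hsymm]
  have h1 : ∑ i, ∑ k ∈ Finset.univ.erase i, ∑ σ, ∑ τ, M.q σ * M.cond σ τ *
        ∑ u, θ i u σ * ∑ v, θ k v τ * scoreC (u, p i σ u) (v, p k τ v) ≤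
      ∑ i, ∑ k ∈ Finset.univ.erase i, ∑ σ, ∑ τ, (M.q σ * M.cond σ τ *
        sqHellinger (channel (othersChannel θ i) (M.cond σ))
          (channel (othersChannel θ k) (M.cond τ)) +
        (C * (M.q σ * M.cond σ τ * B i σ) + C * (M.q σ * M.cond σ τ * B k τ)) -
        M.q σ * M.cond σ τ * ∑ u, θ i u σ * θ k u τ * √(sqHellinger (p i σ u) (p k τ u))) := by
    refine Finset.sum_le_sum fun i _ => Finset.sum_le_sum fun k _ => Finset.sum_le_sum fun σ _ =>
      Finset.sum_le_sum fun τ _ => ?_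
    refine (mul_le_mul_of_nonneg_left (hp.sum_scoreC_le hn hα hβ hθ i k σ τ)
      (mul_pos (hM.1 σ) (hM.2 σ τ)).le).trans (le_of_eq ?_)
    ring
  refine h1.trans ?_
  simp only [Finset.sum_sub_distrib, Finset.sum_add_distrib, ← Finset.mul_sum]
  simp only [s1, s2]
  rw [sum_loss_eq_totalDisagreement, sum_sum_erase_fst (fun i => ∑ σ, M.q σ * B i σ) hn,
    sum_sum_erase_snd (fun i => ∑ σ, M.q σ * B i σ) hn, ← hTB]
  have e : C * (((n : ℝ) - 1) * T) = 2 * √2 * β / α * T := by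
    have : (n : ℝ) - 1 ≠ 0 := by linarith
    rw [hC]
    field_simp
  have h2 : 2 * √2 * β / α ≤ 1 / 2 := by
    rw [div_le_div_iff₀ hα (by norm_num)]
    linarith
  have h3 := mul_le_mul_of_nonneg_right h2 hT0
  linarith

end PredictionDivergence

/-! ### The welfare of equilibria -/

section EquilibriumWelfare

variable {S : Type*} [Fintype S] {n : ℕ} {M : Moments S}

/-- The expected divergence between the forecasts `b σ`, `b τ` of two agents with private signals
`σ`, `τ`. -/
def expectedDivergence (M : Moments S) (b : S → S → ℝ) : ℝ :=
  ∑ σ, ∑ τ, M.q σ * M.cond σ τ * sqHellinger (b σ) (b τ)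

theorem expectedDivergence_channel_le (hM : M.NonZero) {θ : S → S → ℝ} (hθ : IsChannel θ) :
    expectedDivergence M (fun σ => channel θ (M.cond σ)) ≤
      expectedDivergence M fun σ => M.cond σ :=
  Finset.sum_le_sum fun σ _ => Finset.sum_le_sum fun τ _ =>
    mul_le_mul_of_nonneg_left (sqHellinger_channel_le hθ (M.cond_mem σ) (M.cond_mem τ))
      (mul_pos (hM.1 σ) (hM.2 σ τ)).le

/-- A bound for the divergences of each pair of beliefs carries over to the expectation. -/
theorem sum_sum_le_expectedDivergence (hM : M.NonZero) (hq : ∑ σ, M.q σ = 1)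
    {b : Fin n → S → S → ℝ} {b' : S → S → ℝ} {A E : ℝ}
    (h : ∀ σ τ, ∑ i, ∑ k ∈ Finset.univ.erase i, sqHellinger (b i σ) (b k τ) ≤
      A * sqHellinger (b' σ) (b' τ) + E) :
    ∑ i, ∑ k ∈ Finset.univ.erase i, ∑ σ, ∑ τ, M.q σ * M.cond σ τ * sqHellinger (b i σ) (b k τ) ≤
      A * expectedDivergence M b' + E := by
  have e : ∑ i, ∑ k ∈ Finset.univ.erase i, ∑ σ, ∑ τ,
        M.q σ * M.cond σ τ * sqHellinger (b i σ) (b k τ) =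
      ∑ σ, ∑ τ, M.q σ * M.cond σ τ *
        ∑ i, ∑ k ∈ Finset.univ.erase i, sqHellinger (b i σ) (b k τ) := by
    have e1 : ∀ i, ∑ k ∈ Finset.univ.erase i, ∑ σ, ∑ τ,
        M.q σ * M.cond σ τ * sqHellinger (b i σ) (b k τ) =
        ∑ σ, ∑ τ, ∑ k ∈ Finset.univ.erase i,
          M.q σ * M.cond σ τ * sqHellinger (b i σ) (b k τ) := fun i => by
      rw [Finset.sum_comm]
      exact Finset.sum_congr rfl fun σ _ => Finset.sum_comm
    simp only [e1, Finset.mul_sum]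
    rw [Finset.sum_comm]
    exact Finset.sum_congr rfl fun σ _ => Finset.sum_comm
  have e2 : ∑ σ, ∑ τ, M.q σ * M.cond σ τ * E = E := by
    simp only [mul_assoc, ← Finset.mul_sum, ← Finset.sum_mul]
    simp only [stdSimplex.sum_eq_one, one_mul, ← Finset.sum_mul, hq]
  rw [e]
  calc _ ≤ ∑ σ, ∑ τ, M.q σ * M.cond σ τ * (A * sqHellinger (b' σ) (b' τ) + E) :=
        Finset.sum_le_sum fun σ _ => Finset.sum_le_sum fun τ _ =>
          mul_le_mul_of_nonneg_left (h σ τ) (mul_pos (hM.1 σ) (hM.2 σ τ)).le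
    _ = _ := by
        simp only [mul_add, Finset.sum_add_distrib, e2, expectedDivergence, mul_left_comm _ A,
          ← Finset.mul_sum]

variable [DecidableEq S] [MeasurableSpace S] [MeasurableSingletonClass S] {Q : PMF (Fin n → S)}
  {α β : ℝ} {PS : S → Dist S → ℝ} {D : DivisionRule n} {s : Fin n → Strategy S}

theorem IsEquilibrium.isPredictionEquilibrium (hQ : IsSymmetricPrior M Q) (hM : M.NonZero)
    (hn : 3 ≤ n) (hα : 0 < α) (hβ : 0 ≤ β) (hPS_meas : ∀ σ, Measurable (PS σ))
    (hPS : StrictlyProper PS) (hs : IsEquilibrium (disagreementMechanism α β PS D) Q s) :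
    IsPredictionEquilibrium M α β (fun i => signalStrategy (s i))
      (bestPrediction M hn hα hβ s) := by
  have hn' : (3 : ℝ) ≤ n := by exact_mod_cast hn
  have hn1 : (n : ℝ) - 1 ≠ 0 := by linarith
  have hae := hs.ae_eq_bestPrediction hQ hM hn hα hβ hPS_meas hPS D
  intro i σ u τ
  have e1 := sum_outcomeMass_mul_bestPrediction (M := M) hn hα hβ s i σ u τ
  have e2 : ∑ τ, outcomeMass M α β s i σ u τ = ((n : ℝ) - 1) * α +
      β * ∑ j ∈ Finset.univ.erase i, ∑ σ', M.cond σ σ' * signalStrategy (s j) u σ' := by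
    simp only [outcomeMass_eq hae]
    rw [Finset.sum_comm]
    have : ∀ j, ∑ τ, ∑ σ', M.cond σ σ' * (α * signalStrategy (s j) τ σ' +
        β * (signalStrategy (s j) u σ' * bestPrediction M hn hα hβ s j σ' u τ)) =
        α + β * ∑ σ', M.cond σ σ' * signalStrategy (s j) u σ' := by
      intro j
      rw [Finset.sum_comm]
      simp only [← Finset.mul_sum, Finset.sum_add_distrib,
        (signalStrategy_isChannel (s j)).sum_eq_one, stdSimplex.sum_eq_one, mul_one]
      simp only [mul_add, Finset.sum_add_distrib, ← Finset.sum_mul, stdSimplex.sum_eq_one, one_mul,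
        Finset.mul_sum, mul_left_comm β]
    simp only [this]
    rw [Finset.sum_add_distrib, Finset.sum_const, Finset.card_erase_of_mem (Finset.mem_univ i),
      Finset.card_univ, Fintype.card_fin, nsmul_eq_mul, Nat.cast_sub (by omega), Nat.cast_one,
      Finset.mul_sum]
  rw [← e2, e1, outcomeMass_eq hae, channel_othersChannel, avgOthers]
  simp only [channel, mul_add, Finset.sum_add_distrib]
  congr 1
  · rw [mul_div_assoc', mul_assoc, mul_div_cancel_left₀ _ hn1]
    simp only [Finset.mul_sum]
    exact Finset.sum_congr rfl fun j _ => Finset.sum_congr rfl fun σ' _ => by ring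
  · simp only [Finset.mul_sum]
    exact Finset.sum_congr rfl fun j _ => Finset.sum_congr rfl fun σ' _ => by ring

/-- In equilibrium, the welfare is at most that of honest forecasts of the reported signals. -/
theorem IsEquilibrium.welfare_le (hQ : IsSymmetricPrior M Q) (hM : M.NonZero)
    (hn : 3 ≤ n) (hα : 0 < α) (hβ : 0 < β) (hαβ : β / α < 1 / (4 * (Fintype.card S : ℝ)))
    (hPS_meas : ∀ σ, Measurable (PS σ))
    (hPS : StrictlyProper PS) (hs : IsEquilibrium (disagreementMechanism α β PS D) Q s) :
    welfare (disagreementMechanism α β PS D) Q s ≤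
      (∑ i, ∑ k ∈ Finset.univ.erase i, ∑ σ, ∑ τ, M.q σ * M.cond σ τ *
        sqHellinger (channel (othersChannel (fun i => signalStrategy (s i)) i) (M.cond σ))
          (channel (othersChannel (fun i => signalStrategy (s i)) k) (M.cond τ))) /
        ((n : ℝ) - 1) := by
  have hn' : (3 : ℝ) ≤ n := by exact_mod_cast hn
  have hae := hs.ae_eq_bestPrediction hQ hM hn hα hβ.le hPS_meas hPS D
  rw [welfare_disagreementMechanism hQ hn]
  refine div_le_div_of_nonneg_right ?_ (by linarith)
  rcases subsingleton_or_nontrivial S with hS | hS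
  · -- With a single signal there is only one distribution, and all divergences vanish.
    have hD : ∀ p p' : Dist S, p = p' := fun p p' => Subtype.ext (funext fun σ => by
      have h1 := stdSimplex.sum_eq_one p
      have h2 := stdSimplex.sum_eq_one p'
      rw [Fintype.sum_subsingleton _ σ] at h1 h2
      exact h1.trans h2.symm)
    have h0 : ∀ a b : Report S, scoreC a b = 0 := fun a b => by
      rw [scoreC, if_pos (Subsingleton.elim _ _), hD a.2 b.2, hellinger_eq_sqHellinger,
        sqHellinger_self, Real.sqrt_zero, neg_zero]
    simp only [h0, integral_zero, mul_zero, Finset.sum_const_zero]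
    exact Finset.sum_nonneg fun i _ => Finset.sum_nonneg fun k _ => Finset.sum_nonneg fun σ _ =>
      Finset.sum_nonneg fun τ _ => mul_nonneg (mul_pos (hM.1 σ) (hM.2 σ τ)).le
        (sqHellinger_nonneg _ _)
  · have hβα : 4 * √2 * β ≤ α := by
      have hm : (2 : ℝ) ≤ Fintype.card S := by exact_mod_cast Fintype.one_lt_card (α := S)
      have h1 : β / α < 1 / 8 := hαβ.trans_le (one_div_le_one_div_of_le (by norm_num) (by linarith))
      rw [div_lt_div_iff₀ hα (by norm_num)] at h1
      have h2 : √2 ≤ 2 := Real.sqrt_le_iff.2 ⟨by norm_num, by norm_num⟩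
      nlinarith
    simp only [integral_strategy (hae _ _)]
    exact (hs.isPredictionEquilibrium hQ hM hn hα hβ.le hPS_meas hPS).sum_sum_scoreC_le hn hM
      (hQ.q_mul_cond_comm (i := ⟨0, by omega⟩) (j := ⟨1, by omega⟩) (by simp)) hα hβ.le hβα
      fun i => signalStrategy_isChannel (s i)

/-- An equilibrium gains little over the average signal strategy: a bound for the total welfare. -/
theorem IsEquilibrium.welfare_le_add (hQ : IsSymmetricPrior M Q) (hM : M.NonZero)
    (hn : 3 ≤ n) (hα : 0 < α) (hβ : 0 < β) (hαβ : β / α < 1 / (4 * (Fintype.card S : ℝ)))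
    (hPS_meas : ∀ σ, Measurable (PS σ))
    (hPS : StrictlyProper PS) (hs : IsEquilibrium (disagreementMechanism α β PS D) Q s) :
    welfare (disagreementMechanism α β PS D) Q s ≤
      n * expectedDivergence M (fun σ => channel (averageSignalStrategy s) (M.cond σ)) +
        8 / M.c₁ * (Fintype.card S : ℝ) / √n := by
  have hn' : (3 : ℝ) ≤ n := by exact_mod_cast hn
  have hn1 : 0 < (n : ℝ) - 1 := by linarith
  have : Nonempty S := hQ.nonempty ⟨0, by omega⟩
  have hc := hM.c₁_pos
  refine (hs.welfare_le hQ hM hn hα hβ hαβ hPS_meas hPS).trans ?_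
  have h1 := sum_sum_le_expectedDivergence hM (hQ.sum_q ⟨0, by omega⟩) fun σ τ =>
    sum_sum_sqHellinger_othersChannel_le hn (fun i => signalStrategy_isChannel (s i))
      (M.cond_mem σ) (M.cond_mem τ) hc M.c₁_le_one (M.c₁_le σ) (M.c₁_le τ)
  rw [div_le_iff₀ hn1]
  refine h1.trans ?_
  change n * ((n : ℝ) - 1) * expectedDivergence M
    (fun σ => channel (averageSignalStrategy s) (M.cond σ)) + _ ≤ _
  have hr : 0 < √(n : ℝ) := Real.sqrt_pos.2 (by linarith)
  have hr2 : √(n : ℝ) ≤ n - 1 := Real.sqrt_le_iff.2 ⟨hn1.le, by nlinarith⟩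
  have h2 : (n : ℝ) / ((n : ℝ) - 1) ≤ 2 / √n * ((n : ℝ) - 1) := by
    rw [div_mul_eq_mul_div, div_le_div_iff₀ hn1 hr]
    nlinarith
  have h3 : (Fintype.card S : ℝ) * (4 / M.c₁ * (n / ((n : ℝ) - 1))) ≤
      (Fintype.card S : ℝ) * (4 / M.c₁ * (2 / √n * ((n : ℝ) - 1))) := by gcongr
  refine (add_le_add_right h3 _).trans (le_of_eq ?_)
  ring

theorem IsEquilibrium.averageWelfare_le_add (hQ : IsSymmetricPrior M Q) (hM : M.NonZero)
    (hn : 3 ≤ n) (hα : 0 < α) (hβ : 0 < β) (hαβ : β / α < 1 / (4 * (Fintype.card S : ℝ)))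
    (hPS_meas : ∀ σ, Measurable (PS σ))
    (hPS : StrictlyProper PS) (hs : IsEquilibrium (disagreementMechanism α β PS D) Q s) :
    averageWelfare (disagreementMechanism α β PS D) Q s ≤
      expectedDivergence M (fun σ => channel (averageSignalStrategy s) (M.cond σ)) +
        gamma₂ (Fintype.card S) n := by
  have hn' : (3 : ℝ) ≤ n := by exact_mod_cast hn
  have hn0 : 0 < (n : ℝ) := by linarith
  have hn1 : 0 < (n : ℝ) - 1 := by linarith
  have : Nonempty S := hQ.nonempty ⟨0, by omega⟩
  have h1 := sum_sum_le_expectedDivergence hM (hQ.sum_q ⟨0, by omega⟩) fun σ τ =>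
    sum_sum_sqHellinger_othersChannel_le' hn (fun i => signalStrategy_isChannel (s i))
      (M.cond_mem σ) (M.cond_mem τ)
  rw [averageWelfare, div_le_iff₀ hn0]
  refine (hs.welfare_le hQ hM hn hα hβ hαβ hPS_meas hPS).trans ?_
  rw [div_le_iff₀ hn1]
  refine h1.trans ?_
  change n * ((n : ℝ) - 1) * expectedDivergence M
    (fun σ => channel (averageSignalStrategy s) (M.cond σ)) + _ ≤ _
  have hr : 0 < √(n : ℝ) := Real.sqrt_pos.2 hn0
  have hr2 : √(n : ℝ) ≤ n - 1 := Real.sqrt_le_iff.2 ⟨hn1.le, by nlinarith⟩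
  have hm : (1 : ℝ) ≤ Fintype.card S := by exact_mod_cast Fintype.card_pos (α := S)
  have hm2 : √(Fintype.card S : ℝ) ≤ Fintype.card S :=
    Real.sqrt_le_iff.2 ⟨by linarith, by nlinarith⟩
  have h2 : (1 : ℝ) ≤ (n - 1) / √n := by rwa [le_div_iff₀ hr, one_mul]
  have h3 : 4 * √2 * n * √(Fintype.card S : ℝ) ≤
      4 * √2 * n * Fintype.card S * (((n : ℝ) - 1) / √n) :=
    (mul_le_mul_of_nonneg_left hm2 (by positivity)).trans
      (le_mul_of_one_le_right (by positivity) h2)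
  refine (add_le_add_right h3 _).trans (le_of_eq ?_)
  rw [gamma₂]
  ring

/-- In a symmetric profile, leaving out one agent does not change the average. -/
theorem IsEquilibrium.welfare_le_of_symmetric (hQ : IsSymmetricPrior M Q) (hM : M.NonZero)
    (hn : 3 ≤ n) (hα : 0 < α) (hβ : 0 < β) (hαβ : β / α < 1 / (4 * (Fintype.card S : ℝ)))
    (hPS_meas : ∀ σ, Measurable (PS σ))
    (hPS : StrictlyProper PS) (hs : IsEquilibrium (disagreementMechanism α β PS D) Q s)
    (hsymm : IsSymmetricProfile s) :
    welfare (disagreementMechanism α β PS D) Q s ≤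
      n * expectedDivergence M (fun σ => channel (averageSignalStrategy s) (M.cond σ)) := by
  have hn' : (3 : ℝ) ≤ n := by exact_mod_cast hn
  have hn1 : 0 < (n : ℝ) - 1 := by linarith
  have hθ : ∀ i, signalStrategy (s i) = signalStrategy (s ⟨0, by omega⟩) := fun i => by
    rw [hsymm i ⟨0, by omega⟩]
  have e1 : averageSignalStrategy s = signalStrategy (s ⟨0, by omega⟩) :=
    avgChannel_of_eq hn hθ
  have e2 := othersChannel_of_eq hn hθ
  refine (hs.welfare_le hQ hM hn hα hβ hαβ hPS_meas hPS).trans ?_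
  simp only [e1, e2]
  rw [sum_sum_erase_fst (fun _ => _) hn, div_le_iff₀ hn1, Finset.sum_const, Finset.card_univ,
    Fintype.card_fin, nsmul_eq_mul]
  refine le_of_eq ?_
  rw [expectedDivergence]
  ring

end EquilibriumWelfare

/-! ### Symmetric equilibria with the welfare of truth-telling -/

section Permutations

variable {S : Type*} [Fintype S] [DecidableEq S]

/-- A channel that never pools two signals is a permutation. -/
theorem IsChannel.exists_perm {θ : S → S → ℝ} (hθ : IsChannel θ)
    (h : ∀ u v w, 0 < θ u v → 0 < θ u w → v = w) :
    ∃ π : Equiv.Perm S, ∀ u σ, θ u σ = if u = π σ then 1 else 0 := by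
  have hex : ∀ σ, ∃ u, 0 < θ u σ := by
    intro σ
    by_contra hne
    push Not at hne
    have := Finset.sum_nonpos fun u (_ : u ∈ Finset.univ) => hne u
    rw [hθ.sum_eq_one] at this
    linarith
  choose f hf using hex
  have hinj : Function.Injective f := fun σ τ e => h (f σ) σ τ (hf σ) (e ▸ hf τ)
  refine ⟨Equiv.ofBijective f (Finite.injective_iff_bijective.1 hinj), fun u σ => ?_⟩
  have hzero : ∀ u, u ≠ f σ → θ u σ = 0 := by
    intro u hu
    obtain ⟨ρ, rfl⟩ := (Finite.injective_iff_surjective.1 hinj) u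
    refine le_antisymm (not_lt.1 fun hpos => hu ?_) (hθ.nonneg _ _)
    rw [h (f ρ) ρ σ (hf ρ) hpos]
  rw [Equiv.ofBijective_apply]
  split_ifs with hu
  · rw [hu, ← hθ.sum_eq_one σ]
    exact (Finset.sum_eq_single (f σ) (fun v _ hv => hzero v hv) (by simp)).symm
  · exact hzero u hu

variable [MeasurableSpace S] {n : ℕ} {M : Moments S} {α β : ℝ} {s : Fin n → Strategy S}

theorem outcomeMass_of_symmetric (hn : 3 ≤ n) (hsymm : IsSymmetricProfile s) (i j : Fin n)
    (σ u τ : S) : outcomeMass M α β s i σ u τ = outcomeMass M α β s j σ u τ := by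
  have h : ∀ i, outcomeMass M α β s i σ u τ = ((n : ℝ) - 1) * ∑ σ', M.cond σ σ' *
      ∫ b, outcomeWeight α β u τ b ∂(s ⟨0, by omega⟩ σ' : Measure (Report S)) := by
    intro i
    simp only [outcomeMass, hsymm _ ⟨0, by omega⟩, Finset.sum_const,
      Finset.card_erase_of_mem (Finset.mem_univ i), Finset.card_univ, Fintype.card_fin,
      nsmul_eq_mul]
    rw [Nat.cast_sub (by omega), Nat.cast_one]
  rw [h, h]

variable [MeasurableSingletonClass S]

/-- If all agents permute their signals with `π`, then those who report the same signal have the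
same private signal, and their common prediction is the honest forecast. -/
theorem bestPrediction_of_perm (hn : 3 ≤ n) (hα : 0 < α) (hβ : 0 ≤ β)
    (hsymm : IsSymmetricProfile s) (π : Equiv.Perm S)
    (hπ : ∀ i u σ, signalStrategy (s i) u σ = if u = π σ then 1 else 0)
    (hp : IsPredictionEquilibrium M α β (fun i => signalStrategy (s i))
      (bestPrediction M hn hα hβ s)) (i : Fin n) (σ : S) :
    bestPrediction M hn hα hβ s i σ (π σ) = (M.permute π).cond (π σ) := by
  have hn' : (3 : ℝ) ≤ n := by exact_mod_cast hn
  have hN : 0 < ((n : ℝ) - 1) * α := mul_pos (by linarith) hα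
  have hb : ∀ j σ u, bestPrediction M hn hα hβ s j σ u = bestPrediction M hn hα hβ s i σ u :=
    fun j σ u => Subtype.ext (funext fun τ => by
      simp only [bestPrediction, outcomeMass_of_symmetric hn hsymm j i])
  have hchan : ∀ τ, channel (othersChannel (fun i => signalStrategy (s i)) i) (M.cond σ) τ =
      M.cond σ (π.symm τ) := by
    intro τ
    rw [othersChannel_of_eq hn (κ := fun u σ => if u = π σ then 1 else 0)
      (fun i => funext fun u => funext fun σ => hπ i u σ)]
    simp only [channel, ← Equiv.symm_apply_eq, ite_mul, one_mul, zero_mul, Finset.sum_ite_eq,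
      Finset.mem_univ, if_true]
  refine Subtype.ext (funext fun τ => ?_)
  have h := hp i σ (π σ) τ
  simp only [hπ, hb, hchan, EmbeddingLike.apply_eq_iff_eq, mul_ite, mul_one, mul_zero, ite_mul,
    zero_mul, Finset.sum_ite_eq, Finset.mem_univ, if_true] at h
  change bestPrediction M hn hα hβ s i σ (π σ) τ = M.cond (π.symm (π σ)) (π.symm τ)
  rw [π.symm_apply_apply]
  rw [Finset.sum_const, Finset.sum_const, nsmul_eq_mul, nsmul_eq_mul, add_mul] at h
  refine mul_left_cancel₀ hN.ne' ?_
  linarith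

theorem eq_permProfile_of_perm (hn : 3 ≤ n) (hα : 0 < α) (hβ : 0 ≤ β)
    (hsymm : IsSymmetricProfile s) (π : Equiv.Perm S)
    (hπ : ∀ i u σ, signalStrategy (s i) u σ = if u = π σ then 1 else 0)
    (hp : IsPredictionEquilibrium M α β (fun i => signalStrategy (s i))
      (bestPrediction M hn hα hβ s))
    (hae : ∀ i σ, ∀ᵐ a ∂(s i σ : Measure (Report S)), a.2 = bestPrediction M hn hα hβ s i σ a.1) :
    s = permProfile n M π := by
  funext i σ
  refine Subtype.ext ?_
  have hu : ∀ᵐ a ∂(s i σ : Measure (Report S)), a.1 = π σ := by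
    have hms : MeasurableSet {a : Report S | a.1 = π σ} :=
      measurable_fst (measurableSet_singleton (π σ))
    rw [ae_iff]
    have h1 : (s i σ : Measure (Report S)).real {a | a.1 = π σ} = 1 := by
      have := hπ i (π σ) σ
      rwa [if_pos rfl] at this
    have h2 := probReal_compl_eq_one_sub (μ := (s i σ : Measure (Report S))) hms
    rw [h1, sub_self] at h2
    exact (measureReal_eq_zero_iff).1 h2
  have he : (fun a : Report S => a) =ᵐ[(s i σ : Measure (Report S))]
      fun _ => (π σ, (M.permute π).cond (π σ)) := by
    filter_upwards [hu, hae i σ] with a h1 h2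
    rw [h1, bestPrediction_of_perm hn hα hβ hsymm π hπ hp i σ] at h2
    exact Prod.ext h1 h2
  calc (s i σ : Measure (Report S)) = (s i σ : Measure (Report S)).map fun a => a :=
        Measure.map_id'.symm
    _ = (s i σ : Measure (Report S)).map fun _ => (π σ, (M.permute π).cond (π σ)) :=
        Measure.map_congr he
    _ = Measure.dirac (π σ, (M.permute π).cond (π σ)) := by
        rw [Measure.map_const, measure_univ, one_smul]

end Permutations

end PeerPrediction

end

open PeerPrediction in
theorem theorem4p2 {S : Type*} [Fintype S] [DecidableEq S] [MeasurableSpace S]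
    [MeasurableSingletonClass S]
    (PS : S → PeerPrediction.Dist S → ℝ) (hPS_meas : ∀ σ, Measurable (PS σ))
    (hPS : PeerPrediction.StrictlyProper PS)
    (α β : ℝ) (hα : 0 < α) (hβ : 0 < β) (hαβ : β / α < 1 / (4 * (Fintype.card S : ℝ)))
    (M : PeerPrediction.Moments S) (Q : (n : ℕ) → PMF (Fin n → S))
    (hQ : PeerPrediction.IsSNIFE M Q)
    (n : ℕ) (hn : 3 ≤ n) (D : PeerPrediction.DivisionRule n) :
    PeerPrediction.Truthful (PeerPrediction.disagreementMechanism α β PS D) ∧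
    PeerPrediction.SymmetricQuasiFocal
      (PeerPrediction.disagreementMechanism α β PS D) M (Q n) ∧
    PeerPrediction.RobustSymmetricQuasiFocal M.tau₁
      (PeerPrediction.disagreementMechanism α β PS D) M (Q n) ∧
    PeerPrediction.RobustApproximateQuasiFocal (M.tau₂ n)
      (PeerPrediction.gamma₂ (Fintype.card S) n)
      (PeerPrediction.disagreementMechanism α β PS D) M (Q n) ∧
    (∀ s : Fin n → PeerPrediction.Strategy S,
      PeerPrediction.IsEquilibrium (PeerPrediction.disagreementMechanism α β PS D) (Q n) s →
      PeerPrediction.welfare (PeerPrediction.disagreementMechanism α β PS D) (Q n) s ≤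
        PeerPrediction.welfare (PeerPrediction.disagreementMechanism α β PS D) (Q n)
            (PeerPrediction.truth n M) +
          8 / M.c₁ * (Fintype.card S : ℝ) / √n) := by
  have hn0 : 0 < (n : ℝ) := by
    have : (3 : ℝ) ≤ n := by exact_mod_cast hn
    linarith
  have hQn := hQ.symmetric n hn
  have hM := hQ.nonZero
  have hF := hQ.fineGrained
  have : Nonempty S := hQn.nonempty ⟨0, by omega⟩
  have hchan : ∀ s : Fin n → Strategy S, IsChannel (averageSignalStrategy s) := fun s =>
    avgChannel_isChannel hn fun i => signalStrategy_isChannel (s i)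
  have hperm : ∀ π : Equiv.Perm S,
      welfare (disagreementMechanism α β PS D) (Q n) (permProfile n M π) =
        n * expectedDivergence M fun σ => M.cond σ := fun π =>
    welfare_permProfile hQn hn α β PS D π
  have htruth : welfare (disagreementMechanism α β PS D) (Q n) (truth n M) =
      n * expectedDivergence M fun σ => M.cond σ := hperm 1
  have htruth' : averageWelfare (disagreementMechanism α β PS D) (Q n) (truth n M) =
      expectedDivergence M fun σ => M.cond σ := by
    rw [averageWelfare, htruth, mul_div_cancel_left₀ _ hn0.ne']
  have hpermW : ∀ s : Fin n → Strategy S, IsPermutationProfile M s →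
      welfare (disagreementMechanism α β PS D) (Q n) s =
        welfare (disagreementMechanism α β PS D) (Q n) (truth n M) := by
    rintro s ⟨π, rfl⟩
    rw [hperm, htruth]
  have hrobust : RobustSymmetricQuasiFocal M.tau₁
      (disagreementMechanism α β PS D) M (Q n) := by
    intro γ hγ s hs hsymm hle
    have h := hs.welfare_le_of_symmetric hQn hM hn hα hβ hαβ hPS_meas hPS hsymm
    rw [htruth', averageWelfare, le_div_iff₀ hn0] at hle
    exact Moments.close_of_le_sqHellinger_channel hM hF (hchan s) hγ
      (le_of_mul_le_mul_right (hle.trans (h.trans_eq (mul_comm _ _))) hn0)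
  refine ⟨truthful_disagreementMechanism hn hPS_meas hPS hα hβ D, ⟨hpermW, ?_⟩, hrobust,
    ⟨hpermW, ?_, ?_⟩, ?_⟩
  · intro s hs hsymm hnot
    by_contra hlt
    rw [not_lt] at hlt
    refine hnot ?_
    have hclose := hrobust 0 le_rfl s hs hsymm (by
      rw [sub_zero]
      exact div_le_div_of_nonneg_right hlt hn0.le)
    rw [M.tau₁_zero] at hclose
    obtain ⟨π, hπ⟩ := (hchan s).exists_perm hclose
    have hθ : ∀ i, signalStrategy (s i) = averageSignalStrategy s := fun i =>
      (avgChannel_of_eq hn fun j => by rw [hsymm j i]).symm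
    exact ⟨π, eq_permProfile_of_perm hn hα hβ.le hsymm π (fun i u σ => by rw [hθ, hπ])
      (hs.isPredictionEquilibrium hQn hM hn hα hβ.le hPS_meas hPS)
      (hs.ae_eq_bestPrediction hQn hM hn hα hβ.le hPS_meas hPS D)⟩
  · intro s hs
    rw [htruth']
    exact (hs.averageWelfare_le_add hQn hM hn hα hβ hαβ hPS_meas hPS).trans
      (add_le_add_left (expectedDivergence_channel_le hM (hchan s)) _)
  · intro s hs hle u v w hv hw
    by_contra hvw
    rw [hM.tau₂_eq_tau₁ (hM.c₃_pos hvw hF)] at hv hw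
    have h := hs.averageWelfare_le_add hQn hM hn hα hβ hαβ hPS_meas hPS
    rw [htruth'] at hle
    have hγ := Moments.gamma₂_nonneg (Fintype.card S) n
    refine hvw (Moments.close_of_le_sqHellinger_channel hM hF (hchan s)
      (γ := 2 * gamma₂ (Fintype.card S) n) (by linarith) ?_ u v w hv hw)
    change expectedDivergence M (fun σ => M.cond σ) - _ ≤
      expectedDivergence M (fun σ => channel (averageSignalStrategy s) (M.cond σ))
    linarith
  · intro s hs
    rw [htruth]
    exact (hs.welfare_le_add hQn hM hn hα hβ hαβ hPS_meas hPS).trans (add_le_add_left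
      (mul_le_mul_of_nonneg_left (expectedDivergence_channel_le hM (hchan s)) hn0.le) _)
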